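/- **Setting.** A quantum circuit $C$ on $n$ qubits is a sequence of gates from $\{H,T,CZ\}$; its size is the number of gates, and its depth is the least number of layers into which its gates can be arranged such that gates in one layer act on pairwise disjoint sets of qubits and gates sharing a qubit keep their order. We also write $C$ for its unitary operator. For $m\le n$ and $f:\{0,1\}^m\to\{0,1\}$, the computation "$C$ followed by $f$" applies $C$ to $|0^n\rangle$, measures the first $m$ qubits in the computational basis and applies $f$ to the outcome; it outputs $1$ with probability $$p(C,f)=\sum_{x\in\{0,1\}^m} f(x)\,\langle 0^n|C^\dagger(|x\rangle\langle x|\otimes I_{n-m})C|0^n\rangle .$$ Let $\widehat f(s)=2^{-m}\sum_x f(x)(-1)^{s\cdot x}$; the Fourier sparsity of $f$ is $|\{s:\widehat f(s)\ne0\}|$ and, for $f\neq 0$, $\deg(f)=\max\{|s| : \widehat f(s)\neq 0\}$, where $|s|$ is the Hamming weight. The support $\mathrm{supp}(U)$ of an operator $U$ on a set of qubits is the set of qubits on which $U$ acts non-trivially (i.e. $U$ is not the identity on that qubit tensored with an operator on the others). A commuting quantum circuit is a sequence of pairwise commuting unitary gates, each of them described by a circuit over $\{H,T,CZ\}$; a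 gate acts on the qubits in its support. An algorithm has access to a class of commuting quantum circuits on $n+1$ qubits if it may submit the description of a circuit of the class and receives the outcome of measuring all qubits in the computational basis after the circuit has been applied to $|0^{n+1}\rangle$; submitting anything else ends the run without output. **Theorem.** Let $d\ge 0$ be an integer and let $q,r,a,b,T$ be polynomials with natural-number coefficients, with $q(n)>0$ for all $n\geq 1$. There are a probabilistic algorithm $\mathcal A$ and a polynomial $R$ such that the following holds for all integers $0<m\le n\le r(m)$, every circuit $C$ on $n$ qubits of size at most $a(n)$ and depth at most $d$, every non-zero $f:\{0,1\}^m\to\{0,1\}$ of Fourier sparsity at most $b(m)$, and every deterministic classical algorithm $P$ that evaluates $f$ in time at most $T(m)$. Put $$k = 1+\max_{1\le j\le m}\bigl|\mathrm{supp}\bigl(C^\dagger (Z_j\otimes I_{n-m}) C\bigr)\bigr| .$$ Then $k\le 2^d+1$. Moreover, given $m$, $n$ and the classical description of $C$ as input, $P$ as a subroutine (each call costs the running time of $P$), and access to the commuting quantum circuits on $n+1$ qubits that consist of at most $\deg(f)$ gates, each acting on at most $k$ qubits, every run of $\mathcal A$ ends within time $R(n)$, and with probability greater than $1-1/\exp(n)$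 the algorithm $\mathcal A$ outputs a rational number $A$ with $$|p(C,f)-A|\le \frac1{q(n)} .$$ -/

import Mathlib

namespace SCP

open scoped Matrix

noncomputable section

/-- Computational basis states of `n` qubits. -/
abbrev Bits (n : ℕ) : Type := Fin n → Bool

/-- Operators on `n` qubits, in the computational basis. -/
abbrev Op (n : ℕ) : Type := Matrix (Bits n) (Bits n) ℂ

/-- The all-zero string. -/
def zeros (n : ℕ) : Bits n := fun _ => false

/-! ### Quantum circuits over the gate set H, T, CZ -/

/-- The elementary gates `H`, `T` on a qubit and `CZ` on two different qubits. -/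
inductive Gate (n : ℕ) : Type
  | h (i : Fin n)
  | t (i : Fin n)
  | cz (i j : Fin n) (hij : i ≠ j)

/-- The one-qubit operator `A` applied to qubit `i` (identity on all other qubits). -/
def onQubit {n : ℕ} (i : Fin n) (A : Matrix Bool Bool ℂ) : Op n :=
  Matrix.of fun x y => if ∀ k, k ≠ i → x k = y k then A (x i) (y i) else 0

/-- The Hadamard matrix. -/
def hMat : Matrix Bool Bool ℂ :=
  Matrix.of fun a b => ((Real.sqrt 2 : ℝ) : ℂ)⁻¹ * (if a && b then -1 else 1)

/-- The matrix `T = diag(1, exp(iπ/4))`. -/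
def tMat : Matrix Bool Bool ℂ :=
  Matrix.diagonal fun a => if a then Complex.exp (Real.pi * Complex.I / 4) else 1

/-- The operator of an elementary gate on `n` qubits. -/
def Gate.op {n : ℕ} : Gate n → Op n
  | .h i => onQubit i hMat
  | .t i => onQubit i tMat
  | .cz i j _ => Matrix.diagonal fun x => if x i && x j then -1 else 1

/-- The qubits to which an elementary gate is applied. -/
def Gate.qubits {n : ℕ} : Gate n → Finset (Fin n)
  | .h i => {i}
  | .t i => {i}
  | .cz i j _ => {i, j}

/-- A circuit: its elementary gates in the order of application. Its size is the length. -/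
abbrev Circuit (n : ℕ) : Type := List (Gate n)

/-- The operator of a circuit; the head of the list is applied first. -/
def Circuit.op {n : ℕ} : Circuit n → Op n
  | [] => 1
  | g :: c => Circuit.op c * g.op

/-- The gates of `C` can be arranged in `d` layers: gates of one layer act on pairwise disjoint
sets of qubits, and gates sharing a qubit keep their order. The depth of `C` is the least
such `d`. -/
def Circuit.DepthLE {n : ℕ} (C : Circuit n) (d : ℕ) : Prop :=
  ∃ layer : Fin C.length → Fin d, ∀ a b : Fin C.length, a < b →
    ¬ Disjoint (C.get a).qubits (C.get b).qubits → layer a < layer b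

/-- Pauli `Z` on qubit `j`. -/
def pauliZ {n : ℕ} (j : Fin n) : Op n :=
  onQubit j (Matrix.diagonal fun a => if a then -1 else 1)

/-- `U` acts trivially on qubit `k`: it is the tensor product of the identity on qubit `k` with an
operator on the other qubits. -/
def ActsTrivially {n : ℕ} (U : Op n) (k : Fin n) : Prop :=
  (∀ x y : Bits n, x k ≠ y k → U x y = 0) ∧
  (∀ (x y : Bits n) (b : Bool), x k = y k →
    U (Function.update x k b) (Function.update y k b) = U x y)

open Classical in
/-- The set of qubits on which `U` acts non-trivially. -/
def supp {n : ℕ} (U : Op n) : Finset (Fin n) :=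
  Finset.univ.filter fun k => ¬ ActsTrivially U k

/-- `max_{1 ≤ j ≤ m} |supp(C† Z_j C)|`. -/
def maxSupp {n m : ℕ} (hmn : m ≤ n) (C : Circuit n) : ℕ :=
  Finset.univ.sup fun j : Fin m => (supp (C.opᴴ * pauliZ (Fin.castLE hmn j) * C.op)).card

/-- `|x⟩⟨x| ⊗ I`, the projector onto the outcome `x` for the first `m` qubits. -/
def outcomeProj {n m : ℕ} (hmn : m ≤ n) (x : Bits m) : Op n :=
  Matrix.diagonal fun y => if ∀ j : Fin m, y (Fin.castLE hmn j) = x j then 1 else 0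

/-- `p_m(x) = ⟨0ⁿ| C† (|x⟩⟨x| ⊗ I) C |0ⁿ⟩`. -/
def outcomeProb {n m : ℕ} (hmn : m ≤ n) (C : Circuit n) (x : Bits m) : ℝ :=
  ((C.opᴴ * outcomeProj hmn x * C.op) (zeros n) (zeros n)).re

/-- The probability that `C` followed by `f` outputs `1`. -/
def acceptProb {n m : ℕ} (hmn : m ≤ n) (C : Circuit n) (f : Bits m → Bool) : ℝ :=
  ∑ x : Bits m, (if f x then 1 else 0) * outcomeProb hmn C x

/-! ### Fourier expansion of Boolean functions -/

/-- The Fourier coefficient of a `{0,1}`-valued function. -/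
def fourier {m : ℕ} (f : Bits m → Bool) (s : Bits m) : ℝ :=
  1 / 2 ^ m * ∑ x : Bits m, (if f x then 1 else 0) * (-1 : ℝ) ^ (∑ j, (s j && x j).toNat)

open Classical in
/-- The set of `s` with a non-zero Fourier coefficient; its size is the Fourier sparsity. -/
def spectrum {m : ℕ} (f : Bits m → Bool) : Finset (Bits m) :=
  Finset.univ.filter fun s => fourier f s ≠ 0

/-- The Fourier degree of a non-zero function. -/
def fourierDegree {m : ℕ} (f : Bits m → Bool) : ℕ :=
  (spectrum f).sup fun s => ∑ j, (s j).toNat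

/-! ### Circuits are unitary; measurement distributions -/

theorem sum_onQubit {n : ℕ} (i : Fin n) (x : Bits n) (F : Bits n → ℂ)
    (hF : ∀ z, ¬ (∀ k, k ≠ i → x k = z k) → F z = 0) :
    ∑ z, F z = ∑ b : Bool, F (Function.update x i b) := by
  classical
  have hinj : Function.Injective (fun b : Bool => Function.update x i b) :=
    Function.update_injective x i
  rw [← Finset.sum_image (s := Finset.univ) (g := fun b : Bool => Function.update x i b)
    (f := F) (fun a _ b _ h => hinj h)]
  symm
  apply Finset.sum_subset (Finset.subset_univ _)
  intro z _ hz
  apply hF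
  intro h
  apply hz
  rw [Finset.mem_image]
  refine ⟨z i, Finset.mem_univ _, ?_⟩
  funext k
  by_cases hk : k = i
  · subst hk; simp
  · simp [Function.update_of_ne hk, h k hk]

theorem onQubit_unitary {n : ℕ} (i : Fin n) (A : Matrix Bool Bool ℂ) (hA : Aᴴ * A = 1) :
    (onQubit i A)ᴴ * onQubit i A = 1 := by
  ext x y
  rw [Matrix.mul_apply, sum_onQubit i x]
  · have h1 : ∀ b, (∀ k, k ≠ i → Function.update x i b k = x k) := by
      intro b k hk; simp [Function.update_of_ne hk]
    have h2 : ∀ b, (∀ k, k ≠ i → Function.update x i b k = y k) ↔ ∀ k, k ≠ i → x k = y k := by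
      intro b
      refine forall_congr' fun k => forall_congr' fun hk => ?_
      rw [Function.update_of_ne hk]
    have h3 : (Aᴴ * A) (x i) (y i) = (1 : Matrix Bool Bool ℂ) (x i) (y i) := by rw [hA]
    rw [Matrix.mul_apply] at h3
    simp only [Matrix.conjTranspose_apply, onQubit, Matrix.of_apply, h2, if_pos (h1 _), Function.update_self]
    simp only [Matrix.conjTranspose_apply] at h3
    by_cases hxy : ∀ k, k ≠ i → x k = y k
    · simp only [if_pos hxy]
      rw [h3]
      by_cases hi : x i = y i
      · have : x = y := by
          funext k
          by_cases hk : k = i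
          · rw [hk, hi]
          · exact hxy k hk
        rw [this, Matrix.one_apply_eq, Matrix.one_apply_eq]
      · have : x ≠ y := fun h => hi (by rw [h])
        rw [Matrix.one_apply_ne hi, Matrix.one_apply_ne this]
    · have : x ≠ y := fun h => hxy (by intro k _; rw [h])
      simp [if_neg hxy, Matrix.one_apply_ne this]
  · intro z hz
    have : ¬ ∀ k, k ≠ i → z k = x k := fun h => hz fun k hk => (h k hk).symm
    simp [onQubit, if_neg this]

theorem hMat_unitary : hMatᴴ * hMat = 1 := by
  have h2 : ((Real.sqrt 2 : ℝ) : ℂ)⁻¹ * ((Real.sqrt 2 : ℝ) : ℂ)⁻¹ = 1 / 2 := by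
    rw [← mul_inv, ← Complex.ofReal_mul, Real.mul_self_sqrt (by norm_num)]
    norm_num
  ext a b
  rw [Matrix.mul_apply]
  cases a <;> cases b <;>
    simp [hMat, Matrix.conjTranspose_apply] <;> rw [h2] <;> norm_num

theorem tMat_unitary : tMatᴴ * tMat = 1 := by
  have h : (starRingEnd ℂ) (Complex.exp (Real.pi * Complex.I / 4)) *
      Complex.exp (Real.pi * Complex.I / 4) = 1 := by
    rw [← Complex.exp_conj, ← Complex.exp_add]
    have h4 : (starRingEnd ℂ) (4 : ℂ) = 4 := Complex.conj_ofNat 4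
    rw [map_div₀, map_mul, Complex.conj_ofReal, Complex.conj_I, h4]
    ring_nf
    exact Complex.exp_zero
  rw [tMat, Matrix.diagonal_conjTranspose, Matrix.diagonal_mul_diagonal, ← Matrix.diagonal_one]
  congr 1
  funext a
  cases a
  · simp
  · simpa using h

theorem Gate.op_unitary {n : ℕ} (g : Gate n) : g.opᴴ * g.op = 1 := by
  cases g with
  | h i => exact onQubit_unitary i _ hMat_unitary
  | t i => exact onQubit_unitary i _ tMat_unitary
  | cz i j hij =>
    simp only [Gate.op]
    rw [Matrix.diagonal_conjTranspose, Matrix.diagonal_mul_diagonal, ← Matrix.diagonal_one]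
    congr 1
    funext x
    cases hi : x i <;> cases hj : x j <;> simp [hi, hj]

theorem Circuit.op_unitary {n : ℕ} (C : Circuit n) : (Circuit.op C)ᴴ * Circuit.op C = 1 := by
  induction C with
  | nil => simp [Circuit.op]
  | cons g c ih =>
    simp only [Circuit.op]
    rw [Matrix.conjTranspose_mul, Matrix.mul_assoc, ← Matrix.mul_assoc (Circuit.op c)ᴴ, ih,
      Matrix.one_mul, g.op_unitary]

theorem born_sum {n : ℕ} (C : Circuit n) :
    ∑ y, ENNReal.ofReal (Complex.normSq (Circuit.op C y (zeros n))) = 1 := by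
  rw [← ENNReal.ofReal_sum_of_nonneg (fun _ _ => Complex.normSq_nonneg _)]
  have h : ((Circuit.op C)ᴴ * Circuit.op C) (zeros n) (zeros n) =
      (1 : Op n) (zeros n) (zeros n) := by rw [Circuit.op_unitary]
  rw [Matrix.mul_apply, Matrix.one_apply_eq] at h
  simp only [Matrix.conjTranspose_apply] at h
  have h' : ((∑ y, Complex.normSq (Circuit.op C y (zeros n)) : ℝ) : ℂ) = 1 := by
    rw [← h, Complex.ofReal_sum]
    refine Finset.sum_congr rfl fun y _ => ?_
    exact Complex.normSq_eq_conj_mul_self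
  have h'' : (∑ y, Complex.normSq (Circuit.op C y (zeros n)) : ℝ) = 1 := by exact_mod_cast h'
  rw [h'', ENNReal.ofReal_one]

/-- The distribution of the outcome when all qubits of `C |0ⁿ⟩` are measured in the
computational basis. -/
def measure {n : ℕ} (C : Circuit n) : PMF (Bits n) :=
  PMF.ofFintype (fun y => ENNReal.ofReal (Complex.normSq (Circuit.op C y (zeros n)))) (born_sum C)

/-! ### Data and encodings -/

/-- The data on which programs work: binary trees. -/
inductive Val : Type
  | nil
  | cons (a b : Val)
  deriving DecidableEq

/-- The number of nodes of a tree. -/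
def Val.size : Val → ℕ
  | .nil => 1
  | .cons a b => 1 + a.size + b.size

/-- First component. -/
def Val.fst : Val → Val
  | .nil => .nil
  | .cons a _ => a

/-- Second component. -/
def Val.snd : Val → Val
  | .nil => .nil
  | .cons _ b => b

def encBool : Bool → Val
  | false => .nil
  | true => .cons .nil .nil

/-- Natural numbers in unary. -/
def encNat : ℕ → Val
  | 0 => .nil
  | k + 1 => .cons .nil (encNat k)

def encList {α : Type} (e : α → Val) : List α → Val
  | [] => .nil
  | a :: l => .cons (e a) (encList e l)

def encBits {n : ℕ} (x : Bits n) : Val := encList encBool (List.ofFn x)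

def encGate {n : ℕ} : Gate n → Val
  | .h i => .cons (encNat 0) (encNat i)
  | .t i => .cons (encNat 1) (encNat i)
  | .cz i j _ => .cons (encNat 2) (.cons (encNat i) (encNat j))

/-- The classical description of a circuit. -/
def encCircuit {n : ℕ} (C : Circuit n) : Val := encList encGate C

theorem encNat_injective : Function.Injective encNat := by
  intro a
  induction a with
  | zero => intro b h; cases b <;> simp_all [encNat]
  | succ a ih =>
    intro b h
    cases b with
    | zero => simp [encNat] at h
    | succ b => simp only [encNat, Val.cons.injEq, true_and] at h; rw [ih h]

theorem encList_injective {α : Type} {e : α → Val} (he : Function.Injective e) :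
    Function.Injective (encList e) := by
  intro a
  induction a with
  | nil => intro b h; cases b <;> simp_all [encList]
  | cons a l ih =>
    intro b h
    cases b with
    | nil => simp [encList] at h
    | cons b l' =>
      simp only [encList, Val.cons.injEq] at h
      rw [he h.1, ih h.2]

theorem encGate_injective {n : ℕ} : Function.Injective (encGate (n := n)) := by
  intro a b h
  cases a <;> cases b <;> simp [encGate, encNat] at h
  · rw [Fin.ext (encNat_injective h)]
  · rw [Fin.ext (encNat_injective h)]
  · obtain ⟨h1, h2⟩ := h
    have h1 := Fin.ext (encNat_injective h1)
    have h2 := Fin.ext (encNat_injective h2)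
    subst h1; subst h2; rfl

theorem encCircuit_injective {n : ℕ} : Function.Injective (encCircuit (n := n)) :=
  encList_injective encGate_injective

/-! ### Commuting quantum circuits -/

/-- A circuit whose gates are the operators of the listed circuits over `H`, `T`, `CZ`, applied in
the order of the list. Each entry counts as one gate. -/
abbrev GateList (n : ℕ) : Type := List (Circuit n)

/-- `Q` is a commuting quantum circuit with at most `g` gates, each of which acts
(non-trivially) on at most `k` qubits. -/
def GateList.IsCommuting {N : ℕ} (g k : ℕ) (Q : GateList N) : Prop :=
  Q.length ≤ g ∧
  Q.Pairwise (fun U V => Commute (Circuit.op U) (Circuit.op V)) ∧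
  ∀ U ∈ Q, (supp (Circuit.op U)).card ≤ k

/-- The classical description of a circuit composed of compound gates. It is injective, by
`encList_injective` and `encCircuit_injective`. -/
def encGateList {N : ℕ} (Q : GateList N) : Val := encList encCircuit Q

/-! ### Probabilistic programs and their running time -/

/-- Programs of a first-order language on binary trees. Every program maps an input tree to an
output tree. `coin` is a fair coin, `sub` calls a given subroutine on the input, `query` submits
the input to a device. -/
inductive Prog : Type
  | id
  | nil
  | fst
  | snd
  | pair (a b : Prog)
  | comp (b a : Prog)
  | ite (c a b : Prog)
  | while (c a : Prog)
  | coin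
  | sub
  | query

/-- No coins, subroutine calls or queries. -/
def Prog.IsClassical : Prog → Prop
  | .id | .nil | .fst | .snd => True
  | .pair a b => a.IsClassical ∧ b.IsClassical
  | .comp b a => b.IsClassical ∧ a.IsClassical
  | .ite c a b => c.IsClassical ∧ a.IsClassical ∧ b.IsClassical
  | .while c a => c.IsClassical ∧ a.IsClassical
  | .coin | .sub | .query => False

/-- How a run ends: with an output, with a request refused by the device (or by a missing
subroutine), or by being cut off. -/
inductive Res : Type
  | out (v : Val)
  | refused
  | cutoff

/-- The random result of a run together with its running time. -/
abbrev Runs : Type := PMF (Res × ℕ)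

/-- End with output `v` after `t` time steps. -/
def Runs.done (v : Val) (t : ℕ) : Runs := PMF.pure (Res.out v, t)

/-- Spend `t` additional time steps. -/
def Runs.charge (t : ℕ) (p : Runs) : Runs := p.map fun o => (o.1, t + o.2)

/-- Sequential composition; running times are added. -/
def Runs.andThen (p : Runs) (k : Val → Runs) : Runs :=
  p.bind fun o => match o with
    | (.out v, t) => (k v).charge t
    | (.refused, t) => PMF.pure (.refused, t)
    | (.cutoff, t) => PMF.pure (.cutoff, t)

/-- Repeat `a` as long as `c` has a non-`nil` result, with at most `N` evaluations of `c`, after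
which the run is cut off. -/
def Runs.whileLoop (c a : Val → Runs) : ℕ → Val → Runs
  | 0, _ => PMF.pure (.cutoff, 0)
  | N + 1, v => (c v).andThen fun r =>
      if r = .nil then Runs.done v 1 else (a v).andThen (Runs.whileLoop c a N)

/-- The runs of a program. Each construct costs one step plus the size of its input. `N` bounds the
number of rounds of each loop; runs that would exceed it end in `cutoff`, and all other runs do
not depend on it. `sub` and `dev` give the behaviour of the subroutine and of the device. -/
def Prog.exec (sub dev : Val → Runs) (N : ℕ) : Prog → Val → Runs
  | .id, v => Runs.done v (1 + v.size)
  | .nil, v => Runs.done .nil (1 + v.size)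
  | .fst, v => Runs.done v.fst (1 + v.size)
  | .snd, v => Runs.done v.snd (1 + v.size)
  | .pair a b, v => Runs.charge (1 + v.size) <|
      (Prog.exec sub dev N a v).andThen fun x =>
      (Prog.exec sub dev N b v).andThen fun y => Runs.done (.cons x y) 0
  | .comp b a, v => Runs.charge (1 + v.size) <|
      (Prog.exec sub dev N a v).andThen (Prog.exec sub dev N b)
  | .ite c a b, v => Runs.charge (1 + v.size) <|
      (Prog.exec sub dev N c v).andThen fun r =>
        if r = .nil then Prog.exec sub dev N b v else Prog.exec sub dev N a v
  | .while c a, v => Runs.charge (1 + v.size) <|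
      Runs.whileLoop (Prog.exec sub dev N c) (Prog.exec sub dev N a) N v
  | .coin, v => Runs.charge (1 + v.size) <|
      (PMF.uniformOfFintype Bool).bind fun b => Runs.done (encBool b) (encBool b).size
  | .sub, v => Runs.charge (1 + v.size) (sub v)
  | .query, v => Runs.charge (1 + v.size) (dev v)

/-- Refuse every request. -/
def refuse : Val → Runs := fun _ => PMF.pure (.refused, 0)

open Classical in
/-- A device which runs commuting quantum circuits on `N` qubits initialized to `|0^N⟩`, with at most
`g` gates, each acting on at most `k` qubits, and returns the outcome of a measurement of all qubits
in the computational basis. Any other request is refused, which ends the run without output. -/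
def device (N g k : ℕ) (v : Val) : Runs :=
  match Function.partialInv (encGateList (N := N)) v with
  | some Q =>
      if Q.IsCommuting g k then
        (measure Q.flatten).bind fun y => Runs.done (encBits y) (encBits y).size
      else refuse v
  | none => refuse v

/-- `P` is a classical (deterministic) program that evaluates `f` on every input in time at
most `T`. -/
def Evaluates {m : ℕ} (P : Prog) (f : Bits m → Bool) (T : ℕ) : Prop :=
  P.IsClassical ∧ ∀ x : Bits m, ∃ t ≤ T,
    P.exec refuse refuse T (encBits x) = Runs.done (encBool (f x)) t

/-- The runs of the algorithm `A` when it is given the classical description of `C` (with the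
numbers `m` and `n`) as its input, the program `P` as its subroutine, and access to commuting
quantum circuits on `n + 1` qubits with at most `g` gates, each acting on at most `k` qubits.
A subroutine call costs the running time of `P`. -/
def Prog.runs (A P : Prog) {n : ℕ} (m : ℕ) (C : Circuit n) (g k N : ℕ) : Runs :=
  A.exec (P.exec refuse refuse N) (device (n + 1) g k) N
    (.cons (encNat m) (.cons (encNat n) (encCircuit C)))

/-- All runs end on their own, within time `R`. -/
def Prog.RunsInTime (A P : Prog) {n : ℕ} (m : ℕ) (C : Circuit n) (g k R : ℕ) : Prop :=
  ∀ o ∈ (A.runs P m C g k R).support, o.1 ≠ Res.cutoff ∧ o.2 ≤ R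

/-- The runs that output a fraction `a / b` (numerator and denominator in unary) at distance at
most `ε` from `p`. -/
def goodRuns (p ε : ℝ) : Set (Res × ℕ) :=
  {o | ∃ a b : ℕ, 0 < b ∧ o.1 = Res.out (.cons (encNat a) (encNat b)) ∧
    |p - (a : ℝ) / (b : ℝ)| ≤ ε}

end

end SCP

/-!
Expanding `f` in characters, `p(C, f) = ∑ₛ f̂(s) ⟨0ⁿ| C† Zˢ C |0ⁿ⟩`. For each `s` in the spectrum, a
Hadamard test for `C† Zˢ C = ∏_{sⱼ = 1} C† Zⱼ C` is a product of commuting gates, one for each `j`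
with `sⱼ = 1`, which act on the ancilla and on the support of `C† Zⱼ C`; this support lies in the
light cone of `j`, of size at most `2ᵈ`. The large Fourier coefficients are found by a
Kushilevitz-Mansour search: the weight `∑ f̂(t)²` over all `t` with a given prefix is an expectation
over pairs of correlated random inputs, hence can be estimated by sampling. By Hoeffding's
inequality polynomially many samples and measurements suffice for all these estimates at once.
-/

namespace SCP

open scoped Matrix

noncomputable section

/-! ### Tree encodings -/

/-- A type with a chosen representation of its elements by trees, so that programs can work on it.
Injectivity is not required. -/
class TreeEncoding (α : Type) where
  /-- The tree which represents an element. -/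
  enc : α → Val

open TreeEncoding (enc)

instance : TreeEncoding Val := ⟨fun v => v⟩
instance : TreeEncoding Unit := ⟨fun _ => .nil⟩
instance : TreeEncoding Bool := ⟨encBool⟩
instance : TreeEncoding ℕ := ⟨encNat⟩
instance {α β : Type} [TreeEncoding α] [TreeEncoding β] : TreeEncoding (α × β) :=
  ⟨fun p => .cons (enc p.1) (enc p.2)⟩
instance {α : Type} [TreeEncoding α] : TreeEncoding (List α) := ⟨encList enc⟩

/-- The size of the representation of an element, which measures the length of inputs. -/
def encSize {α : Type} [TreeEncoding α] (a : α) : ℕ := (enc a).size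

section Encoding

variable {α β : Type} [TreeEncoding α] [TreeEncoding β]

@[simp] theorem enc_nil : enc ([] : List α) = .nil := rfl
@[simp] theorem enc_cons (a : α) (l : List α) : enc (a :: l) = .cons (enc a) (enc l) := rfl

@[simp] theorem size_enc (a : α) : (enc a).size = encSize a := rfl
@[simp] theorem encSize_prodMk (a : α) (b : β) : encSize (a, b) = 1 + encSize a + encSize b := rfl
@[simp] theorem encSize_nil : encSize ([] : List α) = 1 := rfl
@[simp] theorem encSize_cons (a : α) (l : List α) :
    encSize (a :: l) = 1 + encSize a + encSize l := rfl

theorem encSize_bool_le (b : Bool) : encSize b ≤ 3 := by cases b <;> decide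

theorem encSize_pos (a : α) : 0 < encSize a := by
  unfold encSize
  cases enc a <;> simp [Val.size]

@[simp] theorem encSize_nat (k : ℕ) : encSize k = 2 * k + 1 := by
  induction k with
  | zero => rfl
  | succ k ih =>
    have : encSize (k + 1) = 1 + 1 + encSize k := rfl
    omega

theorem length_lt_encSize (l : List α) : l.length < encSize l := by
  induction l with
  | nil => simp
  | cons a l ih => simp only [List.length_cons, encSize_cons]; omega

theorem encSize_append (l l' : List α) : encSize (l ++ l') + 1 = encSize l + encSize l' := by
  induction l with
  | nil => simp only [List.nil_append, encSize_nil]; omega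
  | cons a l ih => simp only [List.cons_append, encSize_cons]; omega

theorem encSize_lt_of_mem {a : α} {l : List α} (h : a ∈ l) : encSize a < encSize l := by
  induction l with
  | nil => simp at h
  | cons b l ih =>
    rw [encSize_cons]
    rcases List.mem_cons.1 h with rfl | h
    · omega
    · have := ih h; omega

theorem encSize_le_of_suffix {l l' : List α} (h : l' <:+ l) : encSize l' ≤ encSize l := by
  obtain ⟨t, rfl⟩ := h
  have := encSize_append t l'
  have := encSize_pos t
  omega

theorem encSize_le_of_forall_mem {l : List α} {B : ℕ} (h : ∀ a ∈ l, encSize a ≤ B) :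
    encSize l ≤ 1 + l.length * (1 + B) := by
  induction l with
  | nil => simp
  | cons a l ih =>
    have ha := h a (by simp)
    have hl := ih fun b hb => h b (by simp [hb])
    simp only [encSize_cons, List.length_cons, Nat.add_mul]
    omega

end Encoding

/-! ### Random computations which may fail -/

/-- Random computations which may fail; failure models a refused request. This is a copy of
`OptionT PMF` whose only `Functor` instance is the one of its monad. -/
def RandM (α : Type) : Type := OptionT PMF α

instance : Monad RandM := inferInstanceAs (Monad (OptionT PMF))
instance : LawfulMonad RandM := inferInstanceAs (LawfulMonad (OptionT PMF))

section RandM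

variable {α β : Type}

/-- The random computation with a given distribution of results, `none` being failure. -/
def RandM.mk (D : PMF (Option α)) : RandM α := D

/-- The distribution of the results of a random computation, `none` being failure. -/
def RandM.run (D : RandM α) : PMF (Option α) := D

/-- A random computation which does not fail. -/
def RandM.ofPMF (D : PMF α) : RandM α := .mk (D.map some)

/-- The results which occur with positive probability. -/
def RandM.outcomes (D : RandM α) : Set α := {a | some a ∈ D.run.support}

@[simp] theorem RandM.run_pure (a : α) : (pure a : RandM α).run = PMF.pure (some a) := rfl

theorem RandM.mk_pure_some (a : α) : RandM.mk (PMF.pure (some a)) = pure a := rfl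

theorem RandM.run_bind (D : RandM α) (k : α → RandM β) :
    (D >>= k).run = D.run.bind fun o => o.elim (PMF.pure none) fun a => (k a).run :=
  OptionT.run_bind (m := PMF) k

theorem RandM.mem_outcomes_pure {a b : α} : b ∈ (pure a : RandM α).outcomes ↔ b = a := by
  simp [outcomes]

theorem RandM.mem_outcomes_bind {D : RandM α} {k : α → RandM β} {b : β} :
    b ∈ (D >>= k).outcomes ↔ ∃ a ∈ D.outcomes, b ∈ (k a).outcomes := by
  simp only [outcomes, Set.mem_ofPred_eq, RandM.run_bind, PMF.mem_support_bind_iff]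
  constructor
  · rintro ⟨_ | a, ho, h⟩
    · simp at h
    · exact ⟨a, ho, h⟩
  · rintro ⟨a, ha, h⟩
    exact ⟨some a, ha, h⟩

theorem RandM.mem_outcomes_map {f : α → β} {D : RandM α} {b : β} :
    b ∈ (f <$> D).outcomes ↔ ∃ a ∈ D.outcomes, b = f a := by
  simp only [map_eq_pure_bind, RandM.mem_outcomes_bind, RandM.mem_outcomes_pure]

theorem RandM.run_ofPMF (D : PMF α) : (RandM.ofPMF D).run = D.map some := rfl

theorem RandM.run_ofPMF_bind (D : PMF α) (k : α → RandM β) :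
    (RandM.ofPMF D >>= k).run = D.bind fun a => (k a).run := by
  rw [RandM.run_bind, RandM.run_ofPMF, PMF.bind_map]; rfl

theorem RandM.ofPMF_pure (a : α) : RandM.ofPMF (PMF.pure a) = pure a := PMF.pure_map _ _

theorem RandM.ofPMF_bind (D : PMF α) (k : α → PMF β) :
    RandM.ofPMF (D.bind k) = RandM.ofPMF D >>= fun a => RandM.ofPMF (k a) :=
  (PMF.map_bind _ _ _).trans (RandM.run_ofPMF_bind D fun a => RandM.ofPMF (k a)).symm

theorem RandM.map_ofPMF (f : α → β) (D : PMF α) : f <$> RandM.ofPMF D = RandM.ofPMF (D.map f) := by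
  rw [map_eq_pure_bind, ← PMF.bind_pure_comp, RandM.ofPMF_bind]
  simp only [Function.comp_apply, RandM.ofPMF_pure]

theorem RandM.mapM_ofPMF {κ : Type} (E : κ → PMF α) (l : List κ) :
    (l.mapM fun k => RandM.ofPMF (E k)) = RandM.ofPMF (l.mapM E) := by
  induction l with
  | nil => exact (RandM.ofPMF_pure _).symm
  | cons k l ih =>
    rw [List.mapM_cons, List.mapM_cons, ih]
    simp only [← RandM.ofPMF_pure, ← RandM.ofPMF_bind]
    rfl

theorem RandM.mem_outcomes_ofPMF {D : PMF α} {a : α} :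
    a ∈ (RandM.ofPMF D).outcomes ↔ a ∈ D.support := by
  simp [outcomes, RandM.run_ofPMF]

end RandM

/-! ### Specification of runs -/

/-- Outputs as results of runs. -/
def resOf {α : Type} [TreeEncoding α] : Option α → Res
  | none => .refused
  | some a => .out (enc a)

/-- The runs `μ` end within time `B`, with an output distributed as `D` and of size at most `B`. -/
structure Runs.Computes {α : Type} [TreeEncoding α] (μ : Runs) (D : RandM α) (B : ℕ) : Prop where
  dist : μ.map Prod.fst = D.run.map resOf
  time_le : ∀ o ∈ μ.support, o.2 ≤ B
  size_le : ∀ a ∈ D.outcomes, encSize a ≤ B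

/-- The effect on results of continuing with `k`, without regard to running times. -/
def Res.andThen (k : Val → PMF Res) : Res → PMF Res
  | .out v => k v
  | .refused => PMF.pure .refused
  | .cutoff => PMF.pure .cutoff

theorem Runs.map_fst_charge (t : ℕ) (μ : Runs) : (μ.charge t).map Prod.fst = μ.map Prod.fst := by
  rw [Runs.charge, PMF.map_comp]; rfl

theorem Runs.map_fst_andThen (μ : Runs) (k : Val → Runs) :
    (μ.andThen k).map Prod.fst =
      (μ.map Prod.fst).bind (Res.andThen fun v => (k v).map Prod.fst) := by
  rw [Runs.andThen, PMF.map_bind, PMF.bind_map]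
  congr 1
  funext ⟨r, t⟩
  cases r <;> simp [Runs.map_fst_charge, PMF.pure_map, Res.andThen]

namespace Runs.Computes

variable {α β γ σ : Type} [TreeEncoding α] [TreeEncoding β] [TreeEncoding γ] [TreeEncoding σ]
  {μ : Runs} {D : RandM α} {B B' : ℕ}

theorem mono (h : μ.Computes D B) (hB : B ≤ B') : μ.Computes D B' :=
  ⟨h.dist, fun o ho => (h.time_le o ho).trans hB, fun a ha => (h.size_le a ha).trans hB⟩

theorem done {a : α} {t : ℕ} (ht : t ≤ B) (ha : encSize a ≤ B) :
    (Runs.done (enc a) t).Computes (pure a) B where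
  dist := by
    rw [Runs.done, RandM.run_pure, PMF.pure_map, PMF.pure_map]; rfl
  time_le o ho := by
    rw [Runs.done, PMF.support_pure, Set.mem_singleton_iff] at ho
    rwa [ho]
  size_le b hb := by rwa [RandM.mem_outcomes_pure.1 hb]

theorem charge (t : ℕ) (h : μ.Computes D B) : (μ.charge t).Computes D (t + B) where
  dist := by rw [Runs.map_fst_charge, h.dist]
  time_le o ho := by
    rw [Runs.charge, PMF.mem_support_map_iff] at ho
    obtain ⟨o', ho', rfl⟩ := ho
    exact Nat.add_le_add_left (h.time_le o' ho') t
  size_le a ha := (h.size_le a ha).trans (Nat.le_add_left _ _)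

theorem exists_resOf_eq (h : μ.Computes D B) {r : Res} {t : ℕ} (hr : (r, t) ∈ μ.support) :
    ∃ o ∈ D.run.support, resOf o = r := by
  rw [← PMF.mem_support_map_iff, ← h.dist, PMF.mem_support_map_iff]
  exact ⟨_, hr, rfl⟩

theorem andThen {k : Val → Runs} {E : α → RandM β} (h : μ.Computes D B)
    (hk : ∀ a ∈ D.outcomes, (k (enc a)).Computes (E a) B') :
    (μ.andThen k).Computes (D >>= E) (B + B') where
  dist := by
    rw [Runs.map_fst_andThen, h.dist, PMF.bind_map, RandM.run_bind, PMF.map_bind]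
    ext r
    simp only [PMF.bind_apply]
    refine tsum_congr fun o => ?_
    rcases o with _ | a
    · simp [resOf, Res.andThen, PMF.pure_map]
    · by_cases ha : a ∈ D.outcomes
      · simp [resOf, Res.andThen, (hk a ha).dist]
      · have : D.run (some a) = 0 := by rwa [PMF.apply_eq_zero_iff]
        rw [this, zero_mul, zero_mul]
  time_le o ho := by
    rw [Runs.andThen, PMF.mem_support_bind_iff] at ho
    obtain ⟨⟨r, t⟩, hr, ho⟩ := ho
    have ht : t ≤ B := h.time_le _ hr
    obtain ⟨_ | a, ha, rfl⟩ := h.exists_resOf_eq hr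
    · simp only [resOf, PMF.support_pure, Set.mem_singleton_iff] at ho
      rw [ho]; exact ht.trans (Nat.le_add_right _ _)
    · simp only [resOf, Runs.charge, PMF.mem_support_map_iff] at ho
      obtain ⟨o', ho', rfl⟩ := ho
      exact Nat.add_le_add ht ((hk a ha).time_le _ ho')
  size_le b hb := by
    obtain ⟨a, ha, hb⟩ := RandM.mem_outcomes_bind.1 hb
    exact ((hk a ha).size_le b hb).trans (Nat.le_add_left _ _)

theorem andThen_pure {k : Val → Runs} {a : α} {E : RandM β} (h : μ.Computes (pure a) B)
    (hk : (k (enc a)).Computes E B') : (μ.andThen k).Computes E (B + B') := by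
  rw [← pure_bind a fun _ => E]
  refine h.andThen fun b hb => ?_
  rwa [RandM.mem_outcomes_pure.1 hb]

/-- The condition of the loop returns the part of the list that is still to be consumed; the
representation `.nil` of the empty list ends the loop. -/
theorem whileLoop {cond body : Val → Runs} {F : σ → α → RandM σ} {c : γ}
    {Inv : List α → σ → Prop}
    (hcond : ∀ l s, Inv l s → (cond (enc (c, s, l))).Computes (pure l) B)
    (hbody : ∀ a l s, Inv (a :: l) s →
      (body (enc (c, s, a :: l))).Computes ((fun s' => (c, s', l)) <$> F s a) B)
    (hInv : ∀ a l s, Inv (a :: l) s → ∀ s' ∈ (F s a).outcomes, Inv l s')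
    (hsize : ∀ l s, Inv l s → encSize (c, s, l) ≤ B) (l : List α) (s : σ) (N : ℕ)
    (hs : Inv l s) (hN : l.length < N) :
    (Runs.whileLoop cond body N (enc (c, s, l))).Computes
      ((fun s' => (c, s', ([] : List α))) <$> l.foldlM F s) ((l.length + 1) * (2 * B + 1)) := by
  induction l generalizing s N with
  | nil =>
    obtain ⟨N, rfl⟩ := Nat.exists_eq_add_of_lt hN
    rw [List.foldlM_nil, map_pure]
    have hdone := (hcond [] s hs).andThen_pure
      (k := fun r => if r = .nil then Runs.done (enc (c, s, ([] : List α))) 1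
        else (body (enc (c, s, ([] : List α)))).andThen (Runs.whileLoop cond body (0 + N)))
      (Computes.done (B := B + 1) (by omega) ((hsize [] s hs).trans (by omega)))
    exact hdone.mono (by simp only [List.length_nil]; omega)
  | cons a l ih =>
    obtain ⟨N, rfl⟩ := Nat.exists_eq_succ_of_ne_zero (n := N) (by omega)
    have hround := (hbody a l s hs).andThen (k := Runs.whileLoop cond body N)
      (E := fun x => (fun s' => (c, s', ([] : List α))) <$> l.foldlM F x.2.1) fun x hx => by
        obtain ⟨s', hs', rfl⟩ := RandM.mem_outcomes_map.1 hx
        exact ih s' N (hInv _ _ _ hs s' hs') (by simpa using hN)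
    have hloop := (hcond _ s hs).andThen_pure
      (k := fun r => if r = .nil then Runs.done (enc (c, s, a :: l)) 1
        else (body (enc (c, s, a :: l))).andThen (Runs.whileLoop cond body N)) hround
    rw [bind_map_left, ← map_bind, ← List.foldlM_cons] at hloop
    refine hloop.mono ?_
    simp only [List.length_cons]
    nlinarith

end Runs.Computes

/-! ### Programs with polynomial running time -/

/-- The environment of a program: the subroutine (which depends on the bound for loops) and the
device that it can call, and a parameter that may enter the bounds for the running time. -/
structure Env where
  /-- The behaviour of the subroutine. -/
  sub : ℕ → Val → Runs
  /-- The behaviour of the device. -/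
  dev : Val → Runs
  /-- The parameter. -/
  par : ℕ

/-- Environments indexed by the inputs of an algorithm. -/
abbrev EnvFamily (ι : Type) : Type := ι → Env

/-- The runs of a program in an environment. -/
def Env.exec (E : Env) (N : ℕ) (p : Prog) (v : Val) : Runs := p.exec (E.sub N) E.dev N v

/-- The quantity in which running times are polynomial. -/
def Env.inputSize (E : Env) {α : Type} [TreeEncoding α] (a : α) : ℕ := E.par + encSize a

theorem eval_mono (R : Polynomial ℕ) {a b : ℕ} (h : a ≤ b) : R.eval a ≤ R.eval b := by
  simp only [Polynomial.eval_eq_sum_range]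
  gcongr

/-- Some program computes `F i a` from every `a` in the domain `dom i`, in the environment `env i`,
with a running time polynomial in the size of `a` and the parameter of the environment. The program
and the polynomial do not depend on `i`. -/
def RandPolyTime {ι α β : Type} [TreeEncoding α] [TreeEncoding β] (env : EnvFamily ι)
    (dom : ι → α → Prop) (F : ι → α → RandM β) : Prop :=
  ∃ (p : Prog) (R : Polynomial ℕ), ∀ i a, dom i a → ∀ N, R.eval ((env i).inputSize a) ≤ N →
    ((env i).exec N p (enc a)).Computes (F i a) (R.eval ((env i).inputSize a))

/-- The function `f` is computed by a deterministic program in polynomial time. -/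
@[fun_prop]
def PolyTime {ι α β : Type} [TreeEncoding α] [TreeEncoding β] (env : EnvFamily ι) (f : α → β) :
    Prop :=
  RandPolyTime env (fun _ _ => True) fun _ a => pure (f a)

section Combinators

variable {ι α β γ δ σ : Type} [TreeEncoding α] [TreeEncoding β] [TreeEncoding γ] [TreeEncoding δ]
  [TreeEncoding σ] {env : EnvFamily ι}

theorem RandPolyTime.congr {dom dom' : ι → α → Prop} {F F' : ι → α → RandM β}
    (h : RandPolyTime env dom F) (hdom : ∀ i a, dom' i a → dom i a)
    (hF : ∀ i a, dom' i a → F i a = F' i a) : RandPolyTime env dom' F' := by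
  obtain ⟨p, R, h⟩ := h
  refine ⟨p, R, fun i a ha N hN => ?_⟩
  rw [← hF i a ha]
  exact h i a (hdom i a ha) N hN

theorem PolyTime.randPolyTime {f : α → β} (h : PolyTime env f) (dom : ι → α → Prop) :
    RandPolyTime env dom fun _ a => pure (f a) :=
  RandPolyTime.congr h (fun _ _ _ => trivial) fun _ _ _ => rfl

theorem PolyTime.congr {f g : α → β} (h : PolyTime env f) (hfg : ∀ a, f a = g a) :
    PolyTime env g := by
  rwa [← show f = g from funext hfg]

theorem PolyTime.of_exec_eq {f : α → β} (p : Prog)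
    (hp : ∀ (E : Env) N a, E.exec N p (enc a) = Runs.done (enc (f a)) (1 + encSize a))
    (hsize : ∀ a, encSize (f a) ≤ 1 + encSize a) : PolyTime env f := by
  refine ⟨p, 1 + Polynomial.X, fun i a _ N _ => ?_⟩
  rw [hp, Polynomial.eval_add, Polynomial.eval_one, Polynomial.eval_X, Env.inputSize]
  exact .done (by omega) ((hsize a).trans (by omega))

theorem PolyTime.of_enc_eq {f : α → β} (hf : ∀ a, enc (f a) = enc a) : PolyTime env f :=
  .of_exec_eq .id (fun _ _ a => by rw [hf]; rfl) fun a => by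
    rw [← size_enc, hf, size_enc]; omega

@[fun_prop]
theorem polyTime_id : PolyTime env (fun a : α => a) := .of_enc_eq fun _ => rfl

theorem RandPolyTime.comp {dom : ι → α → Prop} {dom' : ι → β → Prop} {F : ι → α → RandM β}
    {G : ι → β → RandM γ} (hG : RandPolyTime env dom' G) (hF : RandPolyTime env dom F)
    (hdom : ∀ i a, dom i a → ∀ b ∈ (F i a).outcomes, dom' i b) :
    RandPolyTime env dom fun i a => F i a >>= G i := by
  obtain ⟨p, R, hF⟩ := hF
  obtain ⟨p', R', hG⟩ := hG
  refine ⟨.comp p' p, 1 + Polynomial.X + R + R'.comp (Polynomial.X + R), fun i a ha N hN => ?_⟩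
  have hpa := hF i a ha N
  set u := (env i).inputSize a with hu
  simp only [Polynomial.eval_add, Polynomial.eval_one, Polynomial.eval_X,
    Polynomial.eval_comp] at hN ⊢
  replace hpa := hpa (by omega)
  have hcomp := hpa.andThen (k := (env i).exec N p') (B' := R'.eval (u + R.eval u)) fun b hb => by
    have hub : (env i).inputSize b ≤ u + R.eval u :=
      (Nat.add_le_add_left (hpa.size_le b hb) _).trans (by rw [hu, Env.inputSize]; omega)
    have hRb := eval_mono R' hub
    exact (hG i b (hdom i a ha b hb) N (hRb.trans (by omega))).mono hRb
  refine (hcomp.charge (1 + encSize a)).mono ?_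
  rw [hu, Env.inputSize]
  omega

@[fun_prop]
theorem PolyTime.comp {g : β → γ} {f : α → β} (hg : PolyTime env g) (hf : PolyTime env f) :
    PolyTime env fun a => g (f a) :=
  (RandPolyTime.comp hg hf fun _ _ _ _ _ => trivial).congr (fun _ _ h => h)
    fun _ _ _ => pure_bind _ _

@[fun_prop]
theorem PolyTime.fst {f : α → β × γ} (hf : PolyTime env f) : PolyTime env fun a => (f a).1 :=
  (PolyTime.of_exec_eq (f := Prod.fst) .fst (fun _ _ _ => rfl) fun x => by
    rw [encSize_prodMk]; omega).comp hf

@[fun_prop]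
theorem PolyTime.snd {f : α → β × γ} (hf : PolyTime env f) : PolyTime env fun a => (f a).2 :=
  (PolyTime.of_exec_eq (f := Prod.snd) .snd (fun _ _ _ => rfl) fun x => by
    rw [encSize_prodMk]; omega).comp hf

theorem RandPolyTime.comp_polyTime {dom : ι → β → Prop} {G : ι → β → RandM γ} {f : α → β}
    (hG : RandPolyTime env dom G) (hf : PolyTime env f) :
    RandPolyTime env (fun i a => dom i (f a)) fun i a => G i (f a) :=
  (RandPolyTime.comp hG (hf.randPolyTime _) fun i a h b hb => by
    rwa [RandM.mem_outcomes_pure.1 hb]).congr (fun _ _ h => h) fun _ _ _ => pure_bind _ _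

theorem RandPolyTime.map {dom : ι → α → Prop} {F : ι → α → RandM β} {g : β → γ}
    (hF : RandPolyTime env dom F) (hg : PolyTime env g) :
    RandPolyTime env dom fun i a => g <$> F i a :=
  (RandPolyTime.comp hg hF fun _ _ _ _ _ => trivial).congr (fun _ _ h => h)
    fun _ _ _ => (map_eq_pure_bind _ _).symm

theorem RandPolyTime.pair {dom : ι → α → Prop} {F : ι → α → RandM β} {G : ι → α → RandM γ}
    (hF : RandPolyTime env dom F) (hG : RandPolyTime env dom G) :
    RandPolyTime env dom fun i a => F i a >>= fun b => (fun c => (b, c)) <$> G i a := by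
  obtain ⟨p, R, hF⟩ := hF
  obtain ⟨p', R', hG⟩ := hG
  refine ⟨.pair p p', 1 + Polynomial.X + R + (R' + (1 + R + R')), fun i a ha N hN => ?_⟩
  have hpa := hF i a ha N
  have hpa' := hG i a ha N
  set u := (env i).inputSize a with hu
  simp only [Polynomial.eval_add, Polynomial.eval_one, Polynomial.eval_X] at hN ⊢
  replace hpa := hpa (by omega)
  replace hpa' := hpa' (by omega)
  have hpair := hpa.andThen (B' := R'.eval u + (1 + R.eval u + R'.eval u))
    (k := fun x => ((env i).exec N p' (enc a)).andThen fun y => Runs.done (.cons x y) 0)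
    (E := fun b => G i a >>= fun c => pure (b, c)) fun b hb => hpa'.andThen fun c hc =>
      Runs.Computes.done (a := (b, c)) (Nat.zero_le _) <| by
        have := hpa.size_le b hb
        have := hpa'.size_le c hc
        rw [encSize_prodMk]; omega
  simp only [← map_eq_pure_bind] at hpair
  refine (hpair.charge (1 + encSize a)).mono ?_
  rw [hu, Env.inputSize]
  omega

@[fun_prop]
theorem PolyTime.prodMk {f : α → β} {g : α → γ} (hf : PolyTime env f) (hg : PolyTime env g) :
    PolyTime env fun a => (f a, g a) :=
  (RandPolyTime.pair hf hg).congr (fun _ _ h => h) fun _ _ _ => by rw [pure_bind, map_pure]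

theorem polyTime_const_val (v : Val) : PolyTime env (fun _ : α => v) := by
  induction v with
  | nil => exact .of_exec_eq .nil (fun _ _ _ => rfl) fun _ => Nat.le_add_right 1 _
  | cons v w hv hw =>
    exact (PolyTime.of_enc_eq (f := fun p : Val × Val => Val.cons p.1 p.2)
      fun _ => rfl).comp (hv.prodMk hw)

@[fun_prop]
theorem polyTime_const (b : β) : PolyTime env (fun _ : α => b) := by
  obtain ⟨p, R, h⟩ := polyTime_const_val (env := env) (α := α) (enc b)
  refine ⟨p, R, fun i a ha N hN => ?_⟩
  have hp := h i a ha N hN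
  refine ⟨hp.dist.trans ?_, hp.time_le, fun c hc => ?_⟩
  · rw [RandM.run_pure, RandM.run_pure, PMF.pure_map, PMF.pure_map]; rfl
  · rw [RandM.mem_outcomes_pure.1 hc]
    exact hp.size_le _ (RandM.mem_outcomes_pure.2 rfl)

theorem RandPolyTime.ite_of_enc {dom domF domG : ι → α → Prop} {t : α → Prop} [DecidablePred t]
    {c : α → γ} {F G : ι → α → RandM β} (hc : PolyTime env c)
    (ht : ∀ a, enc (c a) = .nil ↔ ¬ t a) (hF : RandPolyTime env domF F)
    (hG : RandPolyTime env domG G) (hdomF : ∀ i a, dom i a → t a → domF i a)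
    (hdomG : ∀ i a, dom i a → ¬ t a → domG i a) :
    RandPolyTime env dom fun i a => if t a then F i a else G i a := by
  obtain ⟨p, R, hF⟩ := hF
  obtain ⟨p', R', hG⟩ := hG
  obtain ⟨pc, Rc, hc⟩ := hc
  refine ⟨.ite pc p p', 1 + Polynomial.X + Rc + (R + R'), fun i a ha N hN => ?_⟩
  have hpa := hF i a
  have hpa' := hG i a
  have hpc := hc i a trivial
  set u := (env i).inputSize a with hu
  simp only [Polynomial.eval_add, Polynomial.eval_one, Polynomial.eval_X] at hN ⊢
  have hbranch : (if enc (c a) = .nil then (env i).exec N p' (enc a)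
      else (env i).exec N p (enc a)).Computes (if t a then F i a else G i a)
        (R.eval u + R'.eval u) := by
    by_cases hta : t a
    · rw [if_neg ((ht a).not_left.2 hta), if_pos hta]
      exact (hpa (hdomF i a ha hta) N (by omega)).mono (by omega)
    · rw [if_pos ((ht a).2 hta), if_neg hta]
      exact (hpa' (hdomG i a ha hta) N (by omega)).mono (by omega)
  refine (((hpc N (by omega)).andThen_pure (k := fun r => if r = .nil
    then (env i).exec N p' (enc a) else (env i).exec N p (enc a)) hbranch).charge
      (1 + encSize a)).mono ?_
  rw [hu, Env.inputSize]
  omega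

theorem PolyTime.ite_of_enc {t : α → Prop} [DecidablePred t] {c : α → γ} {f g : α → β}
    (hc : PolyTime env c) (ht : ∀ a, enc (c a) = .nil ↔ ¬ t a) (hf : PolyTime env f)
    (hg : PolyTime env g) : PolyTime env fun a => if t a then f a else g a :=
  (RandPolyTime.ite_of_enc (dom := fun _ _ => True) hc ht hf hg (fun _ _ _ _ => trivial)
    fun _ _ _ _ => trivial).congr (fun _ _ h => h) fun _ _ _ => (apply_ite pure _ _ _).symm

theorem enc_bool_eq_nil (b : Bool) : enc b = .nil ↔ ¬ b = true := by
  cases b <;> simp [enc, encBool]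

theorem enc_list_eq_nil (l : List α) : enc l = .nil ↔ l = [] := by
  cases l <;> simp

@[fun_prop]
theorem PolyTime.ite {p : α → Prop} [DecidablePred p] {f g : α → β}
    (hp : PolyTime env fun a => decide (p a)) (hf : PolyTime env f) (hg : PolyTime env g) :
    PolyTime env fun a => if p a then f a else g a :=
  .ite_of_enc hp (fun a => by rw [enc_bool_eq_nil, decide_eq_true_iff]) hf hg

@[fun_prop]
theorem PolyTime.decide_coe {f : α → Bool} (hf : PolyTime env f) :
    PolyTime env fun a => decide (f a = true) :=
  hf.congr fun a => (Bool.decide_coe (f a)).symm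

@[fun_prop]
theorem PolyTime.not {f : α → Bool} (hf : PolyTime env f) : PolyTime env fun a => !f a :=
  (show PolyTime env fun a => if f a then false else true by fun_prop).congr fun a => by
    cases f a <;> rfl

@[fun_prop]
theorem PolyTime.and {f g : α → Bool} (hf : PolyTime env f) (hg : PolyTime env g) :
    PolyTime env fun a => f a && g a :=
  (show PolyTime env fun a => if f a then g a else false by fun_prop).congr fun a => by
    cases f a <;> rfl

@[fun_prop]
theorem PolyTime.or {f g : α → Bool} (hf : PolyTime env f) (hg : PolyTime env g) :
    PolyTime env fun a => f a || g a :=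
  (show PolyTime env fun a => if f a then true else g a by fun_prop).congr fun a => by
    cases f a <;> rfl

@[fun_prop]
theorem PolyTime.xor {f g : α → Bool} (hf : PolyTime env f) (hg : PolyTime env g) :
    PolyTime env fun a => f a ^^ g a :=
  (show PolyTime env fun a => if f a then !g a else g a by fun_prop).congr fun a => by
    cases f a <;> simp

@[fun_prop]
theorem PolyTime.list_tail {f : α → List β} (hf : PolyTime env f) :
    PolyTime env fun a => (f a).tail := by
  suffices h : PolyTime env (fun l : List β => l.tail) from h.comp hf
  refine .of_exec_eq .snd (fun _ _ l => by cases l <;> rfl) fun l => ?_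
  have := encSize_le_of_suffix l.tail_suffix
  omega

@[fun_prop]
theorem PolyTime.list_cons {f : α → β} {g : α → List β} (hf : PolyTime env f)
    (hg : PolyTime env g) : PolyTime env fun a => f a :: g a :=
  (PolyTime.of_enc_eq (f := fun p : β × List β => p.1 :: p.2) fun _ => rfl).comp (hf.prodMk hg)

theorem RandPolyTime.head :
    RandPolyTime env (fun _ l => l ≠ []) fun _ (l : List β) => .mk (PMF.pure l.head?) := by
  refine ⟨.fst, 1 + Polynomial.X, fun i l hl N _ => ?_⟩
  rw [Polynomial.eval_add, Polynomial.eval_one, Polynomial.eval_X, Env.inputSize]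
  obtain ⟨a, l, rfl⟩ := List.exists_cons_of_ne_nil hl
  refine .done (B := 1 + ((env i).par + encSize (a :: l))) (a := a) ?_ ?_
  · rw [size_enc]; omega
  · rw [encSize_cons]; omega

theorem PolyTime.list_head?_elim {f : α → List β} {d : α → γ} {k : α → β → γ}
    (hf : PolyTime env f) (hd : PolyTime env d) (hk : PolyTime env fun p : α × β => k p.1 p.2) :
    PolyTime env fun a => (f a).head?.elim (d a) (k a) := by
  have hhead := ((polyTime_id.randPolyTime _).pair (RandPolyTime.head.comp_polyTime hf)).map hk
  refine (RandPolyTime.ite_of_enc (dom := fun _ _ => True) (t := fun a => f a ≠ []) hf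
    (fun a => by rw [enc_list_eq_nil, not_not]) hhead hd (fun _ _ _ h => h)
    fun _ _ _ _ => trivial).congr (fun _ _ h => h) fun _ a _ => ?_
  cases h : f a with
  | nil => simp [h]
  | cons b l => simp [RandM.mk_pure_some, h]

/-! ### Processing lists -/

/-- `Inv` is an invariant of the fold of `F` over `l`, relating the part of the list which remains
to the state. It ensures that states have size at most `B` and that `F` is only used on `dom`. -/
structure FoldInvariant {σ α : Type} [TreeEncoding σ] (F : σ → α → RandM σ)
    (dom : σ → α → Prop) (l : List α) (B : ℕ) (Inv : List α → σ → Prop) : Prop where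
  size_le : ∀ l' s, Inv l' s → encSize s ≤ B
  mem_dom : ∀ a l' s, a ∈ l → Inv (a :: l') s → dom s a
  step : ∀ a l' s, a ∈ l → Inv (a :: l') s → ∀ s' ∈ (F s a).outcomes, Inv l' s'

theorem RandPolyTime.foldBody {dom : ι → γ × σ × α → Prop} {F : ι → γ × σ × α → RandM σ}
    (hF : RandPolyTime env dom F) :
    RandPolyTime env
      (fun i (x : γ × σ × List α) => ∃ a t, x.2.2 = a :: t ∧ dom i (x.1, x.2.1, a))
      (fun i x => do
        let a ← RandM.mk (PMF.pure x.2.2.head?)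
        (fun s' => (x.1, s', x.2.2.tail)) <$> F i (x.1, x.2.1, a)) := by
  have hconst : PolyTime env (fun x : γ × σ × List α => x.1) := by fun_prop
  have hstate : PolyTime env (fun x : γ × σ × List α => x.2.1) := by fun_prop
  have hlist : PolyTime env (fun x : γ × σ × List α => x.2.2) := by fun_prop
  have hhead := (RandPolyTime.head (env := env) (β := α)).comp_polyTime hlist
  have harg := (hconst.randPolyTime _).pair ((hstate.randPolyTime _).pair hhead)
  have hstep := RandPolyTime.comp hF (harg.congr (dom' := fun i x =>
      ∃ a t, x.2.2 = a :: t ∧ dom i (x.1, x.2.1, a))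
      (by rintro i x ⟨a, t, h, -⟩; simp [h]) (fun _ _ _ => rfl)) <| by
    rintro i x ⟨a, t, h, hd⟩ b hb
    simp only [h, List.head?_cons, RandM.mk_pure_some, pure_bind, map_pure] at hb
    rwa [RandM.mem_outcomes_pure.1 hb]
  refine ((hconst.randPolyTime _).pair (hstep.pair (hlist.list_tail.randPolyTime _))).congr
    (fun _ _ h => h) fun i x _ => ?_
  simp only [pure_bind, map_eq_pure_bind, bind_assoc]

theorem RandPolyTime.foldWhile {dom : ι → γ × σ × α → Prop} {F : ι → γ × σ × α → RandM σ}
    (hF : RandPolyTime env dom F) {dom' : ι → γ × σ × List α → Prop} (Q : Polynomial ℕ)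
    (hInv : ∀ i c s l, dom' i (c, s, l) → ∃ Inv, Inv l s ∧
      FoldInvariant (fun s a => F i (c, s, a)) (fun s a => dom i (c, s, a)) l
        (Q.eval ((env i).inputSize (c, s, l))) Inv) :
    RandPolyTime env dom' fun i x =>
      (fun s => (x.1, s, ([] : List α))) <$> x.2.2.foldlM (fun s a => F i (x.1, s, a)) x.2.1 := by
  obtain ⟨p, R, hp⟩ := hF.foldBody
  obtain ⟨pc, Rc, hpc⟩ : PolyTime env (fun x : γ × σ × List α => x.2.2) := by fun_prop
  let S : Polynomial ℕ := 1 + 2 * Polynomial.X + Q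
  refine ⟨.while pc p, 1 + Polynomial.X +
    (Polynomial.X + 1) * (2 * (R.comp S + Rc.comp S + S) + 1), fun i ⟨c, s, l⟩ hx N hN => ?_⟩
  obtain ⟨Inv, hs, hI⟩ := hInv i c s l hx
  set u := (env i).inputSize (c, s, l) with hu
  set B := R.eval (S.eval u) + Rc.eval (S.eval u) + S.eval u with hB
  have hS : S.eval u = 1 + 2 * u + Q.eval u := by simp [S]
  simp only [Polynomial.eval_add, Polynomial.eval_one, Polynomial.eval_X,
    Polynomial.eval_comp, Polynomial.eval_mul, Polynomial.eval_ofNat, ← hB] at hN ⊢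
  rw [Env.inputSize, encSize_prodMk, encSize_prodMk] at hu
  have hlen : l.length + 1 ≤ u := by have := length_lt_encSize l; omega
  have hBN : B ≤ N := by nlinarith
  have hRB : R.eval (S.eval u) ≤ B := by omega
  have hRcB : Rc.eval (S.eval u) ≤ B := by omega
  have hstate : ∀ l' s', Inv l' s' ∧ l' <:+ l → (env i).inputSize (c, s', l') ≤ S.eval u := by
    rintro l' s' ⟨hs', hl'⟩
    have := hI.size_le _ _ hs'
    have := encSize_le_of_suffix hl'
    rw [Env.inputSize, encSize_prodMk, encSize_prodMk]
    omega
  have hloop := Runs.Computes.whileLoop (cond := (env i).exec N pc) (body := (env i).exec N p)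
    (F := fun s a => F i (c, s, a)) (c := c) (Inv := fun l' s' => Inv l' s' ∧ l' <:+ l) (B := B)
    (fun l' s' h => by
      have hRc := eval_mono Rc (hstate l' s' h)
      exact (hpc i (c, s', l') trivial N (hRc.trans (hRcB.trans hBN))).mono (hRc.trans hRcB))
    (fun a t s' h => by
      have hR := eval_mono R (hstate _ s' h)
      have hdom := hI.mem_dom a t s' (h.2.subset (by simp)) h.1
      have hbody := hp i (c, s', a :: t) ⟨a, t, rfl, hdom⟩ N (hR.trans (hRB.trans hBN))
      simp only [List.head?_cons, RandM.mk_pure_some, pure_bind, List.tail_cons] at hbody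
      exact hbody.mono (hR.trans hRB))
    (fun a t s' h s'' hs'' => ⟨hI.step a t s' (h.2.subset (by simp)) h.1 s'' hs'',
      (List.suffix_cons a t).trans h.2⟩)
    (fun l' s' h => (Nat.le_add_left _ _).trans ((hstate l' s' h).trans (by omega)))
    l s N ⟨hs, List.suffix_refl l⟩ (by nlinarith)
  refine (hloop.charge (1 + encSize (c, s, l))).mono ?_
  rw [encSize_prodMk, encSize_prodMk]
  gcongr <;> omega

theorem RandPolyTime.foldlM {dom : ι → γ × σ × α → Prop} {F : ι → γ × σ × α → RandM σ}
    (hF : RandPolyTime env dom F) {dom' : ι → γ × σ × List α → Prop} (Q : Polynomial ℕ)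
    (hInv : ∀ i c s l, dom' i (c, s, l) → ∃ Inv, Inv l s ∧
      FoldInvariant (fun s a => F i (c, s, a)) (fun s a => dom i (c, s, a)) l
        (Q.eval ((env i).inputSize (c, s, l))) Inv) :
    RandPolyTime env dom' fun i x => x.2.2.foldlM (fun s a => F i (x.1, s, a)) x.2.1 := by
  have hstate : PolyTime env (fun x : γ × σ × List α => x.2.1) := by fun_prop
  refine ((hF.foldWhile Q hInv).map hstate).congr (fun _ _ h => h) fun i x _ => ?_
  rw [Functor.map_map]
  exact id_map _

theorem PolyTime.list_foldl {f : γ → σ → α → σ} {s : γ → σ} {g : γ → List α}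
    (hf : PolyTime env fun p : γ × σ × α => f p.1 p.2.1 p.2.2) (hs : PolyTime env s)
    (hg : PolyTime env g) (Q : Polynomial ℕ)
    (hQ : ∀ i c l, l <+: g c → encSize (l.foldl (f c) (s c)) ≤ Q.eval ((env i).inputSize c)) :
    PolyTime env fun c => (g c).foldl (f c) (s c) := by
  have hfold := RandPolyTime.foldlM hf
    (dom' := fun _ x => x.2.1 = s x.1 ∧ x.2.2 = g x.1) Q <| by
      rintro i c s₀ l₀ ⟨hs₀, hl₀⟩
      obtain rfl : s₀ = s c := hs₀
      obtain rfl : l₀ = g c := hl₀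
      refine ⟨fun t s' => ∃ l, l ++ t = g c ∧ s' = l.foldl (f c) (s c), ⟨[], rfl, rfl⟩, ?_,
        fun _ _ _ _ _ => trivial, ?_⟩
      · rintro t _ ⟨l, hl, rfl⟩
        refine (hQ i c l ⟨t, hl⟩).trans (eval_mono Q ?_)
        simp only [Env.inputSize, encSize_prodMk]; omega
      · rintro a t _ - ⟨l, hl, rfl⟩ s' hs'
        rw [RandM.mem_outcomes_pure.1 hs']
        exact ⟨l ++ [a], by simp [hl], by simp⟩
  exact (hfold.comp_polyTime (polyTime_id.prodMk (hs.prodMk hg))).congr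
    (fun _ _ _ => ⟨rfl, rfl⟩) fun _ _ _ => List.foldlM_pure

omit [TreeEncoding α] in
theorem encSize_foldl_le {f : σ → α → σ} {G : ℕ} {l : List α}
    (hf : ∀ s, ∀ a ∈ l, encSize (f s a) ≤ encSize s + G) (s : σ) :
    encSize (l.foldl f s) ≤ encSize s + l.length * G := by
  induction l generalizing s with
  | nil => simp
  | cons a l ih =>
    have hl := ih (fun s b hb => hf s b (by simp [hb])) (f s a)
    have ha := hf s a (by simp)
    simp only [List.foldl_cons, List.length_cons, Nat.add_mul]
    omega

theorem PolyTime.exists_encSize_le {f : α → β} (hf : PolyTime env f) :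
    ∃ R : Polynomial ℕ, ∀ i a, encSize (f a) ≤ R.eval ((env i).inputSize a) := by
  obtain ⟨_, R, h⟩ := hf
  exact ⟨R, fun i a => (h i a trivial _ le_rfl).size_le _ (RandM.mem_outcomes_pure.2 rfl)⟩

theorem PolyTime.list_foldl_of_add {f : γ → σ → α → σ} {s : γ → σ} {g : γ → List α}
    (hf : PolyTime env fun p : γ × σ × α => f p.1 p.2.1 p.2.2) (hs : PolyTime env s)
    (hg : PolyTime env g) (G : Polynomial ℕ)
    (hG : ∀ c s a, encSize (f c s a) ≤ encSize s + G.eval (encSize c + encSize a)) :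
    PolyTime env fun c => (g c).foldl (f c) (s c) := by
  obtain ⟨S, hS⟩ := hs.exists_encSize_le
  obtain ⟨L, hL⟩ := hg.exists_encSize_le
  refine .list_foldl hf hs hg (S + L * G.comp (Polynomial.X + L)) fun i c l hl => ?_
  have hlen : l.length ≤ L.eval ((env i).inputSize c) :=
    (hl.length_le.trans (length_lt_encSize _).le).trans (hL i c)
  have hsum : ∀ a ∈ l, encSize c + encSize a ≤
      (env i).inputSize c + L.eval ((env i).inputSize c) := fun a ha =>
    Nat.add_le_add (Nat.le_add_left _ _) ((encSize_lt_of_mem (hl.subset ha)).le.trans (hL i c))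
  simp only [Polynomial.eval_add, Polynomial.eval_X, Polynomial.eval_mul, Polynomial.eval_comp]
  refine (encSize_foldl_le (fun s' a ha => (hG c s' a).trans
    (Nat.add_le_add_left (eval_mono G (hsum a ha)) _)) (s c)).trans ?_
  gcongr
  exact hS i c

@[fun_prop]
theorem PolyTime.list_reverse {f : α → List β} (hf : PolyTime env f) :
    PolyTime env fun a => (f a).reverse :=
  (PolyTime.list_foldl_of_add (f := fun _ l b => b :: l) (by fun_prop) (polyTime_const []) hf
    (1 + Polynomial.X) fun c s a => by
      simp only [encSize_cons, Polynomial.eval_add, Polynomial.eval_one, Polynomial.eval_X]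
      omega).congr fun a => by rw [List.foldl_flip_cons_eq_append]; simp

theorem RandPolyTime.mapM {dom : ι → γ × α → Prop} {F : ι → γ × α → RandM β}
    (hF : RandPolyTime env dom F) :
    RandPolyTime env (fun i (x : γ × List α) => ∀ a ∈ x.2, dom i (x.1, a))
      fun i x => x.2.mapM fun a => F i (x.1, a) := by
  obtain ⟨p, R, hp⟩ := id hF
  have hstep : RandPolyTime env (fun i (x : γ × List β × α) => dom i (x.1, x.2.2))
      (fun i x => (fun b => b :: x.2.1) <$> F i (x.1, x.2.2)) := by
    have hval := hF.comp_polyTime (show PolyTime env fun x : γ × List β × α => (x.1, x.2.2) by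
      fun_prop)
    have hacc : PolyTime env (fun x : γ × List β × α => x.2.1) := by fun_prop
    refine (((hacc.randPolyTime _).pair hval).map
      (g := fun y => y.2 :: y.1) (by fun_prop)).congr (fun _ _ h => h) fun i x _ => ?_
    rw [pure_bind, Functor.map_map]
  have hfold := hstep.foldlM (dom' := fun i x => x.2.1 = [] ∧ ∀ a ∈ x.2.2, dom i (x.1, a))
    (1 + Polynomial.X * (1 + R)) <| by
      rintro i c _ l ⟨rfl, hl⟩
      set u := (env i).inputSize (c, ([] : List β), l) with hu
      refine ⟨fun t r => t.length + r.length = l.length ∧ ∀ b ∈ r, encSize b ≤ R.eval u,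
        by simp, ?_, fun a _ _ ha _ => hl a ha, ?_⟩
      · rintro t r ⟨hlen, hr⟩
        have hru : r.length ≤ u := by
          have := length_lt_encSize l
          simp only [Env.inputSize, encSize_prodMk] at hu; omega
        simp only [Polynomial.eval_add, Polynomial.eval_X, Polynomial.eval_mul,
          Polynomial.eval_one]
        exact (encSize_le_of_forall_mem hr).trans (by gcongr)
      · rintro a t r ha ⟨hlen, hr⟩ _ hr'
        obtain ⟨b, hb, rfl⟩ := RandM.mem_outcomes_map.1 hr'
        refine ⟨by simp only [List.length_cons] at hlen ⊢; omega, List.forall_mem_cons.2 ⟨?_, hr⟩⟩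
        refine ((hp i (c, a) (hl a ha) _ le_rfl).size_le _ hb).trans (eval_mono R ?_)
        have := encSize_lt_of_mem ha
        simp only [Env.inputSize, encSize_prodMk] at hu ⊢; omega
  have harg : PolyTime env (fun x : γ × List α => (x.1, ([] : List β), x.2)) := by fun_prop
  exact ((hfold.comp_polyTime harg).map polyTime_id.list_reverse).congr
    (fun i x hx => ⟨rfl, hx⟩) fun i x _ =>
      (List.mapM_eq_reverse_foldlM_cons (f := fun a => F i (x.1, a)) (l := x.2)).symm

@[fun_prop]
theorem PolyTime.list_map {f : γ → α → β} {g : γ → List α}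
    (hf : PolyTime env fun p : γ × α => f p.1 p.2) (hg : PolyTime env g) :
    PolyTime env fun c => (g c).map (f c) :=
  ((RandPolyTime.mapM hf).comp_polyTime (polyTime_id.prodMk hg)).congr
    (fun _ _ _ _ _ => trivial) fun _ _ _ => List.mapM_pure

end Combinators

/-! ### Functions on lists and numbers which are computable in polynomial time -/

theorem foldl_tail (k : ℕ) {α : Type} (l : List α) :
    (List.replicate k ()).foldl (fun s _ => s.tail) l = l.drop k := by
  induction k generalizing l with
  | zero => rfl
  | succ k ih => rw [List.replicate_succ, List.foldl_cons, ih]; cases l <;> simp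

theorem foldl_zip_reverse {α β : Type} (l : List α) (l' : List β) (r : List (α × β)) :
    (l.foldl (fun (s : List β × List (α × β)) a =>
      (s.1.tail, s.1.head?.elim s.2 fun b => (a, b) :: s.2)) (l', r)).2 =
      (l.zip l').reverse ++ r := by
  induction l generalizing l' r with
  | nil => simp
  | cons a l ih => cases l' <;> simp [ih]

theorem map_fst_zip_replicate {α : Type} (l : List α) (k : ℕ) :
    (l.zip (List.replicate k ())).map Prod.fst = l.take k := by
  induction l generalizing k with
  | nil => simp
  | cons a l ih => cases k <;> simp [List.replicate_succ, ih]

theorem foldl_append_length {α : Type} (l : List α) :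
    l.foldl (fun (s : List ℕ) _ => s ++ [s.length]) [] = List.range l.length := by
  induction l using List.reverseRecOn with
  | nil => rfl
  | append_singleton l a ih => simp [ih, List.range_succ]

section

variable {ι α β γ : Type} [TreeEncoding α] [TreeEncoding β] [TreeEncoding γ] {env : EnvFamily ι}

@[fun_prop]
theorem PolyTime.list_append {f g : α → List β} (hf : PolyTime env f) (hg : PolyTime env g) :
    PolyTime env fun a => f a ++ g a :=
  (PolyTime.list_foldl_of_add (f := fun _ l b => b :: l) (by fun_prop) hg hf.list_reverse
    (1 + Polynomial.X) fun c s a => by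
      simp only [encSize_cons, Polynomial.eval_add, Polynomial.eval_one, Polynomial.eval_X]
      omega).congr fun a => by rw [List.foldl_flip_cons_eq_append']; simp

@[fun_prop]
theorem PolyTime.list_flatten {f : α → List (List β)} (hf : PolyTime env f) :
    PolyTime env fun a => (f a).flatten :=
  (PolyTime.list_foldl_of_add (f := fun _ l l' => l' ++ l) (by fun_prop) (polyTime_const [])
    hf.list_reverse Polynomial.X fun c s a => by
      have := encSize_append a s
      simp only [Polynomial.eval_X]
      omega).congr fun a => by
    rw [List.foldl_reverse]
    induction f a with
    | nil => rfl
    | cons a l ih => rw [List.foldr_cons, ih, List.flatten_cons]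

@[fun_prop]
theorem PolyTime.list_flatMap {f : γ → α → List β} {g : γ → List α}
    (hf : PolyTime env fun p : γ × α => f p.1 p.2) (hg : PolyTime env g) :
    PolyTime env fun c => (g c).flatMap (f c) :=
  (PolyTime.list_flatten (hf.list_map hg)).congr fun _ => List.flatMap_def.symm

@[fun_prop]
theorem PolyTime.list_filter {f : γ → α → Bool} {g : γ → List α}
    (hf : PolyTime env fun p : γ × α => f p.1 p.2) (hg : PolyTime env g) :
    PolyTime env fun c => (g c).filter (f c) :=
  (PolyTime.list_flatMap (f := fun c a => if f c a then [a] else []) (by fun_prop) hg).congr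
    fun c => by
      induction g c with
      | nil => rfl
      | cons a l ih => rw [List.flatMap_cons, ih, List.filter_cons]; split <;> rfl

@[fun_prop]
theorem PolyTime.list_zip {f : γ → List α} {g : γ → List β} (hf : PolyTime env f)
    (hg : PolyTime env g) : PolyTime env fun c => (f c).zip (g c) := by
  have hstep : PolyTime env fun p : γ × (List β × List (α × β)) × α =>
      (p.2.1.1.tail, p.2.1.1.head?.elim p.2.1.2 fun b => (p.2.2, b) :: p.2.1.2) :=
    .prodMk (by fun_prop) (.list_head?_elim (by fun_prop) (by fun_prop) (by fun_prop))
  have hfold := PolyTime.list_foldl_of_add (f := fun _ s a =>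
    (s.1.tail, s.1.head?.elim s.2 fun b => (a, b) :: s.2)) hstep
    (s := fun c => (g c, [])) (by fun_prop) hf (2 + Polynomial.X) (by
      rintro c ⟨_ | ⟨b, l⟩, r⟩ a <;>
      simp only [List.tail_nil, List.head?_nil, Option.elim_none, List.tail_cons, List.head?_cons,
        Option.elim_some, encSize_prodMk, encSize_cons, Polynomial.eval_add, Polynomial.eval_ofNat,
        Polynomial.eval_X] <;> omega)
  exact hfold.snd.list_reverse.congr fun x => by rw [foldl_zip_reverse]; simp

theorem PolyTime.replicate_unit {f : α → ℕ} (hf : PolyTime env f) :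
    PolyTime env fun a => List.replicate (f a) () := by
  refine (PolyTime.of_enc_eq (f := fun k : ℕ => List.replicate k ()) fun k => ?_).comp hf
  induction k with
  | zero => rfl
  | succ k ih => rw [List.replicate_succ, enc_cons, ih]; rfl

@[fun_prop]
theorem PolyTime.list_replicate {f : α → ℕ} {g : α → β} (hf : PolyTime env f)
    (hg : PolyTime env g) : PolyTime env fun a => List.replicate (f a) (g a) :=
  (PolyTime.list_map (f := fun a _ => g a) (by fun_prop) hf.replicate_unit).congr fun a => by simp

@[fun_prop]
theorem PolyTime.list_length {f : α → List β} (hf : PolyTime env f) :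
    PolyTime env fun a => (f a).length := by
  have hunit : PolyTime env (fun l : List Unit => l.length) := .of_enc_eq fun l => by
    induction l with
    | nil => rfl
    | cons a l ih => rw [List.length_cons, enc_cons, ← ih]; rfl
  have hmap : PolyTime env fun a => (f a).map fun _ => () := by fun_prop
  exact (hunit.comp hmap).congr fun a => List.length_map _

@[fun_prop]
theorem PolyTime.list_countP {f : γ → α → Bool} {g : γ → List α}
    (hf : PolyTime env fun p : γ × α => f p.1 p.2) (hg : PolyTime env g) :
    PolyTime env fun c => (g c).countP (f c) :=
  (PolyTime.list_length (hf.list_filter hg)).congr fun _ => List.countP_eq_length_filter.symm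

@[fun_prop]
theorem PolyTime.nat_add {f g : α → ℕ} (hf : PolyTime env f) (hg : PolyTime env g) :
    PolyTime env fun a => f a + g a :=
  (show PolyTime env fun a => (List.replicate (f a) () ++ List.replicate (g a) ()).length by
    fun_prop).congr fun a => by simp

@[fun_prop]
theorem PolyTime.nat_sub {f g : α → ℕ} (hf : PolyTime env f) (hg : PolyTime env g) :
    PolyTime env fun a => f a - g a :=
  (PolyTime.list_foldl_of_add (f := fun _ s _ => s.tail) (by fun_prop) hf.replicate_unit
    hg.replicate_unit 0 fun _ s _ => by
      simpa using encSize_le_of_suffix s.tail_suffix).list_length.congr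
      fun a => by rw [foldl_tail]; simp

@[fun_prop]
theorem PolyTime.nat_le {f g : α → ℕ} (hf : PolyTime env f) (hg : PolyTime env g) :
    PolyTime env fun a => decide (f a ≤ g a) :=
  (PolyTime.ite_of_enc (t := fun a => ¬ f a ≤ g a) (hf.nat_sub hg).replicate_unit
    (fun a => by rw [enc_list_eq_nil, List.replicate_eq_nil_iff, Nat.sub_eq_zero_iff_le, not_not])
    (polyTime_const false) (polyTime_const true)).congr fun a => by
      by_cases h : f a ≤ g a <;> simp [h]

@[fun_prop]
theorem PolyTime.nat_eq {f g : α → ℕ} (hf : PolyTime env f) (hg : PolyTime env g) :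
    PolyTime env fun a => decide (f a = g a) :=
  ((hf.nat_le hg).and (hg.nat_le hf)).congr fun a => by
    rw [← Bool.decide_and]
    exact decide_eq_decide.2 le_antisymm_iff.symm

@[fun_prop]
theorem PolyTime.nat_mul {f g : α → ℕ} (hf : PolyTime env f) (hg : PolyTime env g) :
    PolyTime env fun a => f a * g a :=
  (show PolyTime env fun a => ((List.replicate (f a) ()).flatMap fun _ =>
    List.replicate (g a) ()).length by fun_prop).congr fun a => by simp [List.length_flatMap]

@[fun_prop]
theorem PolyTime.eval (p : Polynomial ℕ) {f : α → ℕ} (hf : PolyTime env f) :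
    PolyTime env fun a => p.eval (f a) := by
  induction p using Polynomial.induction_on' with
  | add p q hp hq => exact (hp.nat_add hq).congr fun a => Polynomial.eval_add.symm
  | monomial k c =>
    have hpow : PolyTime env fun a => f a ^ k := by
      induction k with
      | zero => exact (polyTime_const 1).congr fun a => (pow_zero _).symm
      | succ k ih => exact (ih.nat_mul hf).congr fun a => (pow_succ _ _).symm
    exact ((polyTime_const c).nat_mul hpow).congr fun a => (Polynomial.eval_monomial ..).symm

@[fun_prop]
theorem PolyTime.list_take {f : α → ℕ} {g : α → List β} (hf : PolyTime env f)
    (hg : PolyTime env g) : PolyTime env fun a => (g a).take (f a) :=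
  (show PolyTime env fun a => ((g a).zip (List.replicate (f a) ())).map Prod.fst by
    fun_prop).congr fun a => map_fst_zip_replicate _ _

@[fun_prop]
theorem PolyTime.list_range {f : α → ℕ} (hf : PolyTime env f) :
    PolyTime env fun a => List.range (f a) := by
  suffices h : PolyTime env List.range from h.comp hf
  refine (PolyTime.list_foldl (f := fun _ (s : List ℕ) _ => s ++ [s.length]) (by fun_prop)
    (polyTime_const []) polyTime_id.replicate_unit (1 + Polynomial.X * (2 + 2 * Polynomial.X))
    fun i k l hl => ?_).congr fun k => ?_
  · have hlk : l.length ≤ (env i).inputSize k := by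
      have := hl.length_le
      rw [List.length_replicate] at this
      rw [Env.inputSize, encSize_nat]
      omega
    rw [foldl_append_length]
    refine (encSize_le_of_forall_mem (B := 1 + 2 * l.length) fun a ha => ?_).trans ?_
    · rw [encSize_nat]; have := List.mem_range.1 ha; omega
    · simp only [List.length_range, Polynomial.eval_add, Polynomial.eval_one, Polynomial.eval_mul,
        Polynomial.eval_X, Polynomial.eval_ofNat]
      exact Nat.add_le_add_left (Nat.mul_le_mul hlk (by omega)) 1
  · rw [foldl_append_length, List.length_replicate]

@[fun_prop]
theorem PolyTime.encNat {f : α → ℕ} (hf : PolyTime env f) : PolyTime env fun a => encNat (f a) :=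
  (PolyTime.of_enc_eq (f := SCP.encNat) fun _ => rfl).comp hf

@[fun_prop]
theorem PolyTime.val_cons {f g : α → Val} (hf : PolyTime env f) (hg : PolyTime env g) :
    PolyTime env fun a => Val.cons (f a) (g a) :=
  (PolyTime.of_enc_eq (f := fun p : Val × Val => Val.cons p.1 p.2) fun _ => rfl).comp
    (hf.prodMk hg)

end

/-! ### The deterministic parts of the algorithm -/

/-- The parity of the inner product of two bit strings. -/
def parity (s u : List Bool) : Bool := ((s.zip u).map fun p => p.1 && p.2).foldl xor false

/-- The weighted votes for `s` which estimate a Fourier coefficient or a sum of squares of Fourier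
coefficients: a pair `(u, v)` counts with weight `v` and sign `(-1)^(s·u)`. In a vote the first bit
is the weight, and the second bit is true for a negative sign. -/
def votes (s : List Bool) (D : List (List Bool × Bool)) : List (Bool × Bool) :=
  D.map fun x => (x.2, parity s x.1)

/-- The number of positive votes. -/
def posVotes (V : List (Bool × Bool)) : ℕ := V.countP fun x => x.1 && !x.2

/-- The number of negative votes. -/
def negVotes (V : List (Bool × Bool)) : ℕ := V.countP fun x => x.1 && x.2

/-- A sample `(u, x, y)`: a bit string `u` at which a character is evaluated, and two inputs `x` and
`y` for the Boolean function. -/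
abbrev Sample : Type := List Bool × List Bool × List Bool

/-- The sample for estimating a Fourier coefficient, from random bits. -/
def coeffSample (w : List (Bool × Bool × Bool)) : Sample :=
  (w.map fun t => t.1, w.map fun t => t.1, w.map fun t => t.1)

/-- The sample for estimating the sum of the squares of the Fourier coefficients at the strings that
agree with a given string on the positions in `mask`, from random bits: the inputs are independent
on `mask` and equal outside of it. -/
def weightSample (mask : List Bool) (w : List (Bool × Bool × Bool)) : Sample :=
  (w.map fun t => xor t.1 t.2.1,
    (mask.zip w).map fun p => if p.1 then p.2.1 else p.2.2.2,
    (mask.zip w).map fun p => if p.1 then p.2.2.1 else p.2.2.2)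

/-- The indicator of the positions `0, …, j` among `m` positions. -/
def maskBits (m j : ℕ) : List Bool := (List.range m).map fun i => decide (i ≤ j)

/-- The indicator of the position `j` among `m` positions. -/
def unitBits (m j : ℕ) : List Bool := (List.range m).map fun i => decide (i = j)

/-- The samples for Fourier coefficients, and those for their sums of squares, one list for each
round of the search. -/
def samples (m : ℕ) (W : List (List (Bool × Bool × Bool))) : List Sample × List (List Sample) :=
  (W.map coeffSample, (List.range m).map fun j => W.map (weightSample (maskBits m j)))

/-- Set the positions of `s` in `e` to one if `b` is true. -/
def extend (b : Bool) (e s : List Bool) : List Bool := (s.zip e).map fun p => p.1 || (b && p.2)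

/-- One round of the search for large Fourier coefficients: extend the candidates and keep at most
`cap` of those that win by at least `thr` votes. -/
def searchStep (thr cap : ℕ) (L : List (List Bool)) (x : List Bool × List (List Bool × Bool)) :
    List (List Bool) :=
  ((L.map (extend false x.1) ++ L.map (extend true x.1)).filter fun s =>
    decide (negVotes (votes s x.2) + thr ≤ posVotes (votes s x.2))).take cap

/-- The search for the strings with large Fourier coefficients, one position at a time. -/
def search (m thr cap : ℕ) (D : List (List (List Bool × Bool))) : List (List Bool) :=
  (((List.range m).map (unitBits m)).zip D).foldl (searchStep thr cap) [List.replicate m false]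

/-- Elementary gates as in descriptions of circuits: `(0, j)`, `(1, j)` and `(2, j, k)` stand for
`H` and `T` on qubit `j` and for `CZ` on the qubits `j` and `k`. -/
abbrev RawGate : Type := ℕ × Val

/-- The inverse circuit. -/
def rawInverse (C : List RawGate) : List RawGate :=
  -- `T ^ 8 = 1`, hence `T⁻¹ = T ^ 7`
  C.reverse.flatMap fun g => if g.1 = 1 then List.replicate 7 g else [g]

/-- `H C† CZ C H` where `H` acts on qubit `n` and `CZ` on the qubits `n` and `j`. -/
def rawTestGate (n : ℕ) (C : List RawGate) (j : ℕ) : List RawGate :=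
  (0, encNat n) :: (C ++ (2, Val.cons (encNat n) (encNat j)) :: (rawInverse C ++ [(0, encNat n)]))

/-- The commuting circuit whose last qubit has the mean `⟨0ⁿ|C† Z^s C|0ⁿ⟩` when it is measured. -/
def rawTest (m n : ℕ) (C : List RawGate) (s : List Bool) : List (List RawGate) :=
  (s.zip (List.range m)).flatMap fun p => if p.1 then [rawTestGate n C p.2] else []

/-- The requests for the device, each with the vote of a sample. -/
def requests (m n : ℕ) (C : List RawGate) (L : List (List Bool)) (D : List (List Bool × Bool)) :
    List ((Bool × Bool) × List (List RawGate)) :=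
  L.flatMap fun s => (votes s D).map fun w => (w, rawTest m n C s)

/-- Change the sign of a vote by the last bit of a measurement outcome. -/
def combine (w : Bool × Bool) (y : List Bool) : Bool × Bool := (w.1, xor w.2 (y.getLastD false))

theorem encSize_extend_le (b : Bool) (e s : List Bool) :
    encSize (extend b e s) ≤ 1 + 4 * encSize e := by
  have hsize := encSize_le_of_forall_mem (l := extend b e s) fun c _ => encSize_bool_le c
  have hlen : (extend b e s).length ≤ e.length := by simp [extend]
  have := length_lt_encSize e
  omega

theorem encSize_searchStep_le (thr cap : ℕ) (L : List (List Bool))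
    (x : List Bool × List (List Bool × Bool)) :
    encSize (searchStep thr cap L x) ≤ 1 + cap * (2 + 4 * encSize x.1) := by
  have hlen : (searchStep thr cap L x).length ≤ cap := by simp [searchStep]
  have hmem : ∀ s ∈ searchStep thr cap L x, encSize s ≤ 1 + 4 * encSize x.1 := by
    intro s hs
    obtain ⟨hs, -⟩ := List.mem_filter.1 (List.mem_of_mem_take hs)
    rcases List.mem_append.1 hs with hs | hs
    all_goals
      obtain ⟨s', -, rfl⟩ := List.mem_map.1 hs
      exact encSize_extend_le _ _ _
  exact (encSize_le_of_forall_mem hmem).trans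
    (Nat.add_le_add_left (Nat.mul_le_mul hlen (by omega)) 1)

section

variable {ι α : Type} [TreeEncoding α] {env : EnvFamily ι}

@[fun_prop]
theorem PolyTime.parity {f g : α → List Bool} (hf : PolyTime env f) (hg : PolyTime env g) :
    PolyTime env fun x => parity (f x) (g x) := by
  unfold SCP.parity
  refine .list_foldl_of_add (by fun_prop) (by fun_prop) (by fun_prop) 3 fun _ s b => ?_
  have := encSize_bool_le (s ^^ b)
  simp only [Polynomial.eval_ofNat]
  omega

@[fun_prop]
theorem PolyTime.votes {f : α → List Bool} {g : α → List (List Bool × Bool)}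
    (hf : PolyTime env f) (hg : PolyTime env g) : PolyTime env fun x => votes (f x) (g x) := by
  unfold SCP.votes; fun_prop

@[fun_prop]
theorem PolyTime.posVotes {f : α → List (Bool × Bool)} (hf : PolyTime env f) :
    PolyTime env fun x => posVotes (f x) := by
  unfold SCP.posVotes; fun_prop

@[fun_prop]
theorem PolyTime.negVotes {f : α → List (Bool × Bool)} (hf : PolyTime env f) :
    PolyTime env fun x => negVotes (f x) := by
  unfold SCP.negVotes; fun_prop

@[fun_prop]
theorem PolyTime.samples {f : α → ℕ} {g : α → List (List (Bool × Bool × Bool))}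
    (hf : PolyTime env f) (hg : PolyTime env g) : PolyTime env fun x => samples (f x) (g x) := by
  unfold SCP.samples SCP.coeffSample SCP.weightSample SCP.maskBits; fun_prop

theorem PolyTime.searchStep : PolyTime env fun p : (ℕ × ℕ) × List (List Bool) ×
    (List Bool × List (List Bool × Bool)) => searchStep p.1.1 p.1.2 p.2.1 p.2.2 := by
  unfold SCP.searchStep SCP.extend; fun_prop

@[fun_prop]
theorem PolyTime.search {f g h : α → ℕ} {D : α → List (List (List Bool × Bool))}
    (hf : PolyTime env f) (hg : PolyTime env g) (hh : PolyTime env h) (hD : PolyTime env D) :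
    PolyTime env fun x => search (f x) (g x) (h x) (D x) := by
  suffices hfold : PolyTime env fun p : (ℕ × ℕ) × ℕ × List (List (List Bool × Bool)) =>
      SCP.search p.2.1 p.1.1 p.1.2 p.2.2 from
    hfold.comp (f := fun x => ((g x, h x), f x, D x)) (by fun_prop)
  have hstep : PolyTime env fun p : ((ℕ × ℕ) × ℕ × List (List (List Bool × Bool))) ×
      List (List Bool) × (List Bool × List (List Bool × Bool)) =>
        SCP.searchStep p.1.1.1 p.1.1.2 p.2.1 p.2.2 :=
    PolyTime.searchStep.comp (f := fun p : ((ℕ × ℕ) × ℕ × List (List (List Bool × Bool))) ×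
      List (List Bool) × (List Bool × List (List Bool × Bool)) => (p.1.1, p.2)) (by fun_prop)
  refine .list_foldl_of_add hstep (by fun_prop) (by unfold SCP.unitBits; fun_prop)
    (1 + Polynomial.X * (2 + 4 * Polynomial.X)) ?_
  rintro ⟨⟨thr, cap⟩, m, D⟩ L ⟨e, D'⟩
  refine (encSize_searchStep_le thr cap L (e, D')).trans (le_add_left ?_)
  simp only [Polynomial.eval_add, Polynomial.eval_one, Polynomial.eval_mul, Polynomial.eval_X,
    Polynomial.eval_ofNat]
  gcongr <;> simp only [encSize_prodMk, encSize_nat] <;> omega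

@[fun_prop]
theorem PolyTime.requests {f g : α → ℕ} {C : α → List RawGate} {L : α → List (List Bool)}
    {D : α → List (List Bool × Bool)} (hf : PolyTime env f) (hg : PolyTime env g)
    (hC : PolyTime env C) (hL : PolyTime env L) (hD : PolyTime env D) :
    PolyTime env fun x => requests (f x) (g x) (C x) (L x) (D x) := by
  unfold SCP.requests SCP.rawTest SCP.rawTestGate SCP.rawInverse; fun_prop

@[fun_prop]
theorem PolyTime.combine {f : α → Bool × Bool} {g : α → List Bool}
    (hf : PolyTime env f) (hg : PolyTime env g) : PolyTime env fun x => combine (f x) (g x) := by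
  have hlast : PolyTime env fun x => (g x).getLastD false :=
    (PolyTime.list_head?_elim (k := fun _ b => b) hg.list_reverse (polyTime_const false)
      (by fun_prop)).congr fun x => by
        rw [List.head?_reverse, List.getLastD_eq_getLast?]; cases (g x).getLast? <;> rfl
  unfold SCP.combine; fun_prop

end

/-! ### Supports and light cones -/

section

variable {n : ℕ}

/-- Flip the bit at position `k`. Acting trivially on qubit `k` is being invariant under flips, see
`actsTrivially_iff`. -/
def flipBit (k : Fin n) (x : Bits n) : Bits n := Function.update x k (!x k)

@[simp] theorem flipBit_self (k : Fin n) (x : Bits n) : flipBit k x k = !x k := by simp [flipBit]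

theorem flipBit_of_ne {k i : Fin n} (h : i ≠ k) (x : Bits n) : flipBit k x i = x i := by
  simp [flipBit, Function.update_of_ne h]

theorem flipBit_involutive (k : Fin n) : Function.Involutive (flipBit k) := by
  intro x
  funext i
  by_cases h : i = k
  · subst h; simp
  · rw [flipBit_of_ne h, flipBit_of_ne h]

theorem actsTrivially_iff {U : Op n} {k : Fin n} : ActsTrivially U k ↔
    (∀ x y : Bits n, x k ≠ y k → U x y = 0) ∧
      ∀ x y : Bits n, U (flipBit k x) (flipBit k y) = U x y := by
  refine and_congr_right fun hzero => ⟨fun h x y => ?_, fun h x y b hxy => ?_⟩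
  · by_cases hxy : x k = y k
    · have := h x y (!x k) hxy
      rwa [show Function.update y k (!x k) = flipBit k y by rw [flipBit, hxy]] at this
    · rw [hzero x y hxy, hzero]
      simpa using hxy
  · by_cases hb : b = x k
    · rw [hb, Function.update_eq_self, hxy, Function.update_eq_self]
    · have := h x y
      rwa [flipBit, flipBit, ← hxy, ← Bool.eq_not_of_ne hb] at this

theorem ActsTrivially.mul {U V : Op n} {k : Fin n} (hU : ActsTrivially U k)
    (hV : ActsTrivially V k) : ActsTrivially (U * V) k := by
  rw [actsTrivially_iff] at *
  refine ⟨fun x y hxy => ?_, fun x y => ?_⟩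
  · rw [Matrix.mul_apply]
    refine Finset.sum_eq_zero fun z _ => ?_
    by_cases hz : x k = z k
    · rw [hV.1 z y (by rwa [← hz]), mul_zero]
    · rw [hU.1 x z hz, zero_mul]
  · rw [Matrix.mul_apply, Matrix.mul_apply,
      ← Equiv.sum_comp (flipBit_involutive k).toPerm]
    exact Finset.sum_congr rfl fun z _ => congrArg₂ _ (hU.2 x z) (hV.2 z y)

theorem ActsTrivially.conjTranspose {U : Op n} {k : Fin n} (hU : ActsTrivially U k) :
    ActsTrivially Uᴴ k := by
  rw [actsTrivially_iff] at *
  exact ⟨fun x y h => by rw [Matrix.conjTranspose_apply, hU.1 _ _ h.symm, star_zero],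
    fun x y => by rw [Matrix.conjTranspose_apply, hU.2, Matrix.conjTranspose_apply]⟩

theorem onQubit_actsTrivially {i k : Fin n} (h : k ≠ i) (A : Matrix Bool Bool ℂ) :
    ActsTrivially (onQubit i A) k := by
  rw [actsTrivially_iff]
  refine ⟨fun x y hxy => if_neg fun h' => hxy (h' k h), fun x y => ?_⟩
  simp only [onQubit, Matrix.of_apply, flipBit_of_ne h.symm]
  congr 1
  refine propext (forall_congr' fun l => forall_congr' fun _ => ?_)
  by_cases hl : l = k
  · subst hl; simp
  · rw [flipBit_of_ne hl, flipBit_of_ne hl]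

theorem diagonal_actsTrivially {k : Fin n} {D : Bits n → ℂ} (h : ∀ x, D (flipBit k x) = D x) :
    ActsTrivially (Matrix.diagonal D) k := by
  rw [actsTrivially_iff]
  refine ⟨fun x y hxy => Matrix.diagonal_apply_ne _ fun h => hxy (by rw [h]), fun x y => ?_⟩
  simp only [Matrix.diagonal_apply, (flipBit_involutive k).injective.eq_iff, h]

theorem Gate.actsTrivially (g : Gate n) {k : Fin n} (hk : k ∉ g.qubits) :
    ActsTrivially g.op k := by
  cases g with
  | h i => exact onQubit_actsTrivially (by simpa [Gate.qubits] using hk) _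
  | t i => exact onQubit_actsTrivially (by simpa [Gate.qubits] using hk) _
  | cz i j hij =>
    simp only [Gate.qubits, Finset.mem_insert, Finset.mem_singleton, not_or] at hk
    refine diagonal_actsTrivially fun x => ?_
    rw [flipBit_of_ne (Ne.symm hk.1), flipBit_of_ne (Ne.symm hk.2)]

theorem sum_mul_onQubit {i : Fin n} (F : Bits n → ℂ) (A : Matrix Bool Bool ℂ) (y : Bits n) :
    ∑ z, F z * onQubit i A z y = ∑ b, F (Function.update y i b) * A b (y i) := by
  rw [sum_onQubit i y]
  · refine Finset.sum_congr rfl fun b _ => ?_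
    rw [onQubit, Matrix.of_apply, if_pos fun k hk => Function.update_of_ne hk _ _,
      Function.update_self]
  · intro z hz
    rw [onQubit, Matrix.of_apply, if_neg fun h => hz fun k hk => (h k hk).symm, mul_zero]

theorem sum_onQubit_mul {i : Fin n} (A : Matrix Bool Bool ℂ) (F : Bits n → ℂ) (x : Bits n) :
    ∑ z, onQubit i A x z * F z = ∑ b, A (x i) b * F (Function.update x i b) := by
  rw [sum_onQubit i x]
  · refine Finset.sum_congr rfl fun b _ => ?_
    rw [onQubit, Matrix.of_apply, if_pos fun k hk => (Function.update_of_ne hk _ _).symm,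
      Function.update_self]
  · intro z hz
    rw [onQubit, Matrix.of_apply, if_neg hz, zero_mul]

theorem ActsTrivially.commute_onQubit {U : Op n} {i : Fin n} (hU : ActsTrivially U i)
    (A : Matrix Bool Bool ℂ) : Commute U (onQubit i A) := by
  ext x y
  rw [Matrix.mul_apply, Matrix.mul_apply, sum_mul_onQubit, sum_onQubit_mul,
    Fintype.sum_eq_single (x i), Fintype.sum_eq_single (y i)]
  · have := hU.2 x (Function.update y i (x i)) (y i) (by rw [Function.update_self])
    rw [Function.update_idem, Function.update_eq_self] at this
    rw [this, mul_comm]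
  · intro b hb
    rw [hU.1 _ _ (by rwa [Function.update_self]), mul_zero]
  · intro b hb
    rw [hU.1 _ _ (by rw [Function.update_self]; exact hb.symm), zero_mul]

theorem Gate.commute_of_actsTrivially (g : Gate n) {U : Op n}
    (h : ∀ k ∈ g.qubits, ActsTrivially U k) : Commute U g.op := by
  cases g with
  | h i => exact (h i (Finset.mem_singleton_self i)).commute_onQubit _
  | t i => exact (h i (Finset.mem_singleton_self i)).commute_onQubit _
  | cz i j hij =>
    have hi := h i (Finset.mem_insert_self i _)
    have hj := h j (Finset.mem_insert_of_mem (Finset.mem_singleton_self j))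
    ext x y
    simp only [Gate.op, Matrix.mul_diagonal, Matrix.diagonal_mul]
    by_cases hxi : x i = y i
    · by_cases hxj : x j = y j
      · rw [hxi, hxj, mul_comm]
      · rw [hj.1 x y hxj, mul_zero, zero_mul]
    · rw [hi.1 x y hxi, mul_zero, zero_mul]

theorem Gate.card_qubits_le (g : Gate n) : g.qubits.card ≤ 2 := by
  cases g with
  | h i | t i => simp [Gate.qubits]
  | cz i j hij => exact Finset.card_le_two

theorem mem_supp {U : Op n} {k : Fin n} : k ∈ supp U ↔ ¬ ActsTrivially U k := by
  simp [supp]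

theorem supp_onQubit_subset (i : Fin n) (A : Matrix Bool Bool ℂ) :
    supp (onQubit i A) ⊆ {i} := fun _ hk =>
  Finset.mem_singleton.2 (not_imp_comm.1 (onQubit_actsTrivially · A) (mem_supp.1 hk))

theorem supp_conj_subset (g : Gate n) (U : Op n) :
    supp (g.opᴴ * U * g.op) ⊆ supp U ∪ g.qubits := by
  intro k hk
  by_contra h
  rw [Finset.mem_union, not_or, mem_supp, not_not] at h
  exact mem_supp.1 hk (((g.actsTrivially h.2).conjTranspose.mul h.1).mul (g.actsTrivially h.2))

theorem conj_eq_self_of_disjoint_supp (g : Gate n) (U : Op n) (h : Disjoint g.qubits (supp U)) :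
    g.opᴴ * U * g.op = U := by
  have hcomm : U * g.op = g.op * U := g.commute_of_actsTrivially fun k hk =>
    not_not.1 (mem_supp.not.1 (Finset.disjoint_left.1 h hk))
  rw [mul_assoc, hcomm, ← mul_assoc, g.op_unitary, one_mul]

theorem Circuit.op_conj_cons (g : Gate n) (c : Circuit n) (U : Op n) :
    (Circuit.op (g :: c))ᴴ * U * Circuit.op (g :: c) =
      g.opᴴ * ((Circuit.op c)ᴴ * U * Circuit.op c) * g.op := by
  simp only [Circuit.op, Matrix.conjTranspose_mul, Matrix.mul_assoc]

/-- The backward light cone of qubit `j`: the qubits on which `C† Z_j C` can act, found by going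
through the circuit from its last gate to its first. -/
def Circuit.lightCone (j : Fin n) : Circuit n → Finset (Fin n)
  | [] => {j}
  | g :: c =>
    if Disjoint g.qubits (lightCone j c) then lightCone j c else lightCone j c ∪ g.qubits

theorem supp_conj_subset_lightCone (j : Fin n) (C : Circuit n) :
    supp (C.opᴴ * pauliZ j * C.op) ⊆ C.lightCone j := by
  induction C with
  | nil =>
    rw [Circuit.op, Matrix.conjTranspose_one, one_mul, mul_one]
    exact supp_onQubit_subset j _
  | cons g c ih =>
    rw [Circuit.op_conj_cons, Circuit.lightCone]
    split_ifs with h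
    · rwa [conj_eq_self_of_disjoint_supp g _ (h.mono_right ih)]
    · exact (supp_conj_subset g _).trans (Finset.union_subset_union_left ih)

theorem sum_two_pow_union_le {ι : Type*} [DecidableEq ι] {S G : Finset ι} {lam : ι → ℕ} {ℓ : ℕ}
    (hmeet : ¬ Disjoint G S) (hcard : G.card ≤ 2) (hlam : ∀ i ∈ G, lam i ≤ ℓ) :
    ∑ i ∈ S ∪ G, 2 ^ lam i ≤ ∑ i ∈ S, 2 ^ (if i ∈ G then ℓ + 1 else lam i) := by
  obtain ⟨i₀, hG, hS⟩ := Finset.not_disjoint_iff.1 hmeet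
  rw [← Finset.sdiff_union_self_eq_union, Finset.sum_union Finset.sdiff_disjoint,
    ← Finset.sum_sdiff (Finset.inter_subset_left : S ∩ G ⊆ S), Finset.sdiff_inter_self_left]
  gcongr ?_ + ?_
  · exact le_of_eq (Finset.sum_congr rfl fun i hi => by rw [if_neg (Finset.mem_sdiff.1 hi).2])
  · calc ∑ i ∈ G, 2 ^ lam i ≤ ∑ _i ∈ G, 2 ^ ℓ :=
          Finset.sum_le_sum fun i hi => Nat.pow_le_pow_right two_pos (hlam i hi)
      _ = G.card * 2 ^ ℓ := by rw [Finset.sum_const, smul_eq_mul]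
      _ ≤ 2 ^ (if i₀ ∈ G then ℓ + 1 else lam i₀) := by
          rw [if_pos hG, pow_succ']
          exact Nat.mul_le_mul_right _ hcard
      _ ≤ ∑ i ∈ S ∩ G, 2 ^ (if i ∈ G then ℓ + 1 else lam i) :=
          Finset.single_le_sum (f := fun i => 2 ^ (if i ∈ G then ℓ + 1 else lam i))
            (fun _ _ => Nat.zero_le _) (Finset.mem_inter.2 ⟨hS, hG⟩)

/- A qubit first used in layer `l` gets the weight `2 ^ l`: prepending a gate that meets the cone
then replaces a weight of at least `2 ^ (ℓ + 1)` by at most two weights `2 ^ ℓ`. -/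
theorem sum_two_pow_lightCone_le {d : ℕ} (j : Fin n) (C : Circuit n)
    (layer : Fin C.length → Fin d)
    (hlayer : ∀ a b : Fin C.length, a < b →
      ¬ Disjoint (C.get a).qubits (C.get b).qubits → layer a < layer b)
    (lam : Fin n → ℕ) (hd : ∀ i, lam i ≤ d)
    (hlam : ∀ i a, i ∈ (C.get a).qubits → lam i ≤ layer a) :
    ∑ i ∈ C.lightCone j, 2 ^ lam i ≤ 2 ^ d := by
  induction C generalizing lam with
  | nil => simpa [Circuit.lightCone] using Nat.pow_le_pow_right two_pos (hd j)
  | cons g c ih =>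
    let ℓ : ℕ := layer ⟨0, c.length.succ_pos⟩
    have hcone : ∑ i ∈ Circuit.lightCone j c, 2 ^ (if i ∈ g.qubits then ℓ + 1 else lam i) ≤
        2 ^ d := by
      refine ih (fun a => layer a.succ) (fun a b hab h => hlayer _ _ (Fin.succ_lt_succ_iff.2 hab) h)
        _ (fun i => ?_) fun i a ha => ?_
      · split_ifs
        exacts [(layer _).2, hd i]
      · split_ifs with hi
        · exact hlayer ⟨0, c.length.succ_pos⟩ a.succ a.succ_pos
            (Finset.not_disjoint_iff.2 ⟨i, hi, ha⟩)
        · exact hlam i a.succ ha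
    rw [Circuit.lightCone]
    split_ifs with hdisj
    · refine le_of_eq_of_le (Finset.sum_congr rfl fun i hi => ?_) hcone
      rw [if_neg (Finset.disjoint_right.1 hdisj hi)]
    · exact (sum_two_pow_union_le hdisj g.card_qubits_le fun i hi => hlam i ⟨0, _⟩ hi).trans hcone

theorem maxSupp_le_of_depthLE {m d : ℕ} (hmn : m ≤ n) {C : Circuit n} (hC : C.DepthLE d) :
    maxSupp hmn C ≤ 2 ^ d := by
  obtain ⟨layer, hlayer⟩ := hC
  refine Finset.sup_le fun j _ => (Finset.card_le_card (supp_conj_subset_lightCone _ C)).trans ?_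
  simpa using sum_two_pow_lightCone_le (Fin.castLE hmn j) C layer hlayer (fun _ => 0)
    (fun _ => Nat.zero_le d) fun _ _ _ => Nat.zero_le _

end

/-! ### Expectations and concentration -/

section

variable {α β κ : Type}

/-- The mean of a real function on a finite probability space. -/
def mean [Fintype α] (D : PMF α) (g : α → ℝ) : ℝ := ∑ a, (D a).toReal * g a

/-- The expectation of a non-negative function with values in `[0, ∞]`, which exists on infinite
probability spaces as well. -/
def expect (D : PMF α) (F : α → ENNReal) : ENNReal := ∑' a, D a * F a

section mean

variable [Fintype α]

theorem mean_uniformOfFintype [Nonempty α] (g : α → ℝ) :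
    mean (PMF.uniformOfFintype α) g = (∑ a, g a) / Fintype.card α := by
  simp [mean, ← Finset.mul_sum, div_eq_inv_mul]

theorem mean_measure {n : ℕ} (C : Circuit n) (g : Bits n → ℝ) :
    mean (measure C) g = ∑ x, Complex.normSq (C.op x (zeros n)) * g x := by
  refine Finset.sum_congr rfl fun x _ => ?_
  rw [measure, PMF.ofFintype_apply, ENNReal.toReal_ofReal (Complex.normSq_nonneg _)]

theorem mean_sum {ι : Type} (D : PMF α) (s : Finset ι) (g : ι → α → ℝ) :
    mean D (fun a => ∑ i ∈ s, g i a) = ∑ i ∈ s, mean D (g i) := by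
  simp only [mean, Finset.mul_sum]
  exact Finset.sum_comm

theorem mean_const_mul (D : PMF α) (c : ℝ) (g : α → ℝ) :
    mean D (fun a => c * g a) = c * mean D g := by
  simp only [mean, Finset.mul_sum, mul_left_comm]

theorem mean_nonneg (D : PMF α) {g : α → ℝ} (hg : ∀ a, 0 ≤ g a) : 0 ≤ mean D g :=
  Finset.sum_nonneg fun a _ => mul_nonneg ENNReal.toReal_nonneg (hg a)

theorem abs_mean_le (D : PMF α) {g : α → ℝ} (hg : ∀ a, |g a| ≤ 1) : |mean D g| ≤ 1 := by
  calc |mean D g| ≤ ∑ a, |(D a).toReal * g a| := Finset.abs_sum_le_sum_abs _ _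
    _ ≤ ∑ a, (D a).toReal := Finset.sum_le_sum fun a _ => by
        rw [abs_mul, abs_of_nonneg ENNReal.toReal_nonneg]
        exact mul_le_of_le_one_right ENNReal.toReal_nonneg (hg a)
    _ = 1 := by
        rw [← ENNReal.toReal_sum fun a _ => D.apply_ne_top a,
          ← tsum_fintype (L := .unconditional α), D.tsum_coe, ENNReal.toReal_one]

end mean

theorem expect_bind (D : PMF α) (k : α → PMF β) (F : β → ENNReal) :
    expect (D.bind k) F = expect D fun a => expect (k a) F := by
  simp only [expect, PMF.bind_apply, ← ENNReal.tsum_mul_right, ← ENNReal.tsum_mul_left, mul_assoc]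
  exact ENNReal.tsum_comm

theorem expect_pure (a : α) (F : α → ENNReal) : expect (PMF.pure a) F = F a := by
  rw [expect, tsum_eq_single a fun b hb => by simp [hb]]
  simp

theorem expect_mono (D : PMF α) {F G : α → ENNReal} (h : ∀ a ∈ D.support, F a ≤ G a) :
    expect D F ≤ expect D G := by
  refine ENNReal.tsum_le_tsum fun a => ?_
  by_cases ha : D a = 0
  · simp [ha]
  · exact mul_le_mul_right (h a ((D.mem_support_iff a).2 ha)) _

theorem expect_mul_const (D : PMF α) (F : α → ENNReal) (c : ENNReal) :
    expect D (fun a => F a * c) = expect D F * c := by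
  simp only [expect, ← mul_assoc, ENNReal.tsum_mul_right]

theorem expect_add_const (D : PMF α) (F : α → ENNReal) (c : ENNReal) :
    expect D (fun a => F a + c) = expect D F + c := by
  simp only [expect, mul_add, ENNReal.tsum_add, ENNReal.tsum_mul_right, D.tsum_coe, one_mul]

theorem toOuterMeasure_eq_expect (D : PMF α) (S : Set α) :
    D.toOuterMeasure S = expect D (S.indicator fun _ => 1) := by
  rw [PMF.toOuterMeasure_apply, expect]
  exact tsum_congr fun a => by by_cases h : a ∈ S <;> simp [h]

theorem toOuterMeasure_le_one (D : PMF α) (S : Set α) : D.toOuterMeasure S ≤ 1 := by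
  rw [PMF.toOuterMeasure_apply, ← D.tsum_coe]
  exact ENNReal.tsum_le_tsum fun a => Set.indicator_le_self _ _ _

theorem one_sub_lt_toReal_toOuterMeasure (D : PMF α) {S : Set α} {ε : ℝ}
    (h : D.toOuterMeasure Sᶜ < ENNReal.ofReal ε) : 1 - ε < (D.toOuterMeasure S).toReal := by
  have hadd : D.toOuterMeasure S + D.toOuterMeasure Sᶜ = 1 := by
    rw [PMF.toOuterMeasure_apply, PMF.toOuterMeasure_apply, ← ENNReal.tsum_add, ← D.tsum_coe]
    exact tsum_congr fun a => by by_cases h : a ∈ S <;> simp [h]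
  have hfin (S : Set α) : D.toOuterMeasure S ≠ ⊤ :=
    ne_top_of_le_ne_top ENNReal.one_ne_top (toOuterMeasure_le_one D S)
  have hreal := congrArg ENNReal.toReal hadd
  rw [ENNReal.toReal_add (hfin _) (hfin _), ENNReal.toReal_one] at hreal
  linarith [(ENNReal.lt_ofReal_iff_toReal_lt (hfin _)).1 h]

theorem toOuterMeasure_bind_le (D : PMF α) (k : α → PMF β) {S : Set α} {G : Set β}
    {c c' : ENNReal} (hS : D.toOuterMeasure S ≤ c)
    (hk : ∀ a ∈ D.support, a ∉ S → (k a).toOuterMeasure G ≤ c') :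
    (D.bind k).toOuterMeasure G ≤ c + c' := by
  calc (D.bind k).toOuterMeasure G = expect D fun a => (k a).toOuterMeasure G :=
        PMF.toOuterMeasure_bind_apply _ _ _
    _ ≤ expect D fun a => S.indicator (fun _ => 1) a + c' := by
        refine expect_mono D fun a ha => ?_
        by_cases h : a ∈ S
        · simpa only [h, Set.indicator_of_mem] using
            (toOuterMeasure_le_one _ _).trans le_self_add
        · simpa only [h, not_false_eq_true, Set.indicator_of_notMem, zero_add] using hk a ha h
    _ = D.toOuterMeasure S + c' := by rw [expect_add_const, toOuterMeasure_eq_expect]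
    _ ≤ c + c' := by gcongr

theorem chernoff_of_subgaussian {D : PMF α} {X : α → ℝ} {K d : ℝ} (hK : 0 < K) (hd : 0 ≤ d)
    (h : ∀ t : ℝ, expect D (fun a => ENNReal.ofReal (Real.exp (t * X a))) ≤
      ENNReal.ofReal (Real.exp (K * t ^ 2 / 2))) :
    D.toOuterMeasure {a | d ≤ |X a|} ≤ 2 * ENNReal.ofReal (Real.exp (-(d ^ 2 / (2 * K)))) := by
  have tail (t : ℝ) (ht : |t| = d / K) : D.toOuterMeasure {a | |t| * d ≤ t * X a} ≤
      ENNReal.ofReal (Real.exp (-(d ^ 2 / (2 * K)))) := by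
    calc D.toOuterMeasure {a | |t| * d ≤ t * X a}
        ≤ expect D fun a => ENNReal.ofReal (Real.exp (t * X a)) *
            ENNReal.ofReal (Real.exp (-(|t| * d))) := by
          rw [toOuterMeasure_eq_expect]
          refine expect_mono D fun a _ => ?_
          by_cases ha : |t| * d ≤ t * X a
          · rw [← ENNReal.ofReal_mul (Real.exp_nonneg _), ← Real.exp_add]
            simp [ha]
          · simp [ha]
      _ ≤ ENNReal.ofReal (Real.exp (K * t ^ 2 / 2)) * ENNReal.ofReal (Real.exp (-(|t| * d))) := by
          rw [expect_mul_const]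
          gcongr
          exact h t
      _ = ENNReal.ofReal (Real.exp (-(d ^ 2 / (2 * K)))) := by
          rw [← ENNReal.ofReal_mul (Real.exp_nonneg _), ← Real.exp_add, ← sq_abs, ht]
          congr 2
          field_simp
          ring
  have hpos : 0 ≤ d / K := by positivity
  calc D.toOuterMeasure {a | d ≤ |X a|}
      ≤ D.toOuterMeasure ({a | |d / K| * d ≤ d / K * X a} ∪
          {a | |-(d / K)| * d ≤ -(d / K) * X a}) := by
        refine MeasureTheory.measure_mono fun a ha => ?_
        simp only [Set.mem_union, Set.mem_ofPred_eq, abs_neg, abs_of_nonneg hpos] at ha ⊢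
        rw [neg_mul, ← mul_neg]
        exact (le_abs.1 ha).imp (mul_le_mul_of_nonneg_left · hpos)
          (mul_le_mul_of_nonneg_left · hpos)
    _ ≤ _ := (MeasureTheory.measure_union_le _ _).trans <| by
        rw [two_mul]
        exact add_le_add (tail _ (abs_of_nonneg hpos))
          (tail _ (by rw [abs_neg, abs_of_nonneg hpos]))

theorem expect_exp_le [Fintype α] (D : PMF α) {g : α → ℝ} (hg : ∀ a, |g a| ≤ 1) (t : ℝ) :
    expect D (fun a => ENNReal.ofReal (Real.exp (t * (g a - mean D g)))) ≤
      ENNReal.ofReal (Real.exp (t ^ 2 / 2)) := by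
  let _ : MeasurableSpace α := ⊤
  have hsub := ProbabilityTheory.hasSubgaussianMGF_of_mem_Icc (μ := D.toMeasure) (X := g)
    (a := -1) (b := 1) measurable_from_top.aemeasurable (.of_forall fun a => abs_le.1 (hg a))
  have hmean : ∫ a, g a ∂D.toMeasure = mean D g := by
    rw [PMF.integral_eq_sum, mean]
    rfl
  have hexpect : expect D (fun a => ENNReal.ofReal (Real.exp (t * (g a - mean D g)))) =
      ENNReal.ofReal (ProbabilityTheory.mgf (fun a => g a - mean D g) D.toMeasure t) := by
    rw [ProbabilityTheory.mgf, PMF.integral_eq_sum, expect, tsum_fintype,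
      ENNReal.ofReal_sum_of_nonneg fun a _ => smul_nonneg ENNReal.toReal_nonneg (Real.exp_nonneg _)]
    refine Finset.sum_congr rfl fun a _ => ?_
    rw [smul_eq_mul, ENNReal.ofReal_mul ENNReal.toReal_nonneg,
      ENNReal.ofReal_toReal (D.apply_ne_top a)]
  rw [hmean] at hsub
  rw [hexpect]
  refine ENNReal.ofReal_le_ofReal ((hsub.mgf_le t).trans_eq ?_)
  norm_num

theorem mapM_nil_eq_pure (E : κ → PMF α) : [].mapM E = PMF.pure [] :=
  List.mapM_nil

theorem mapM_cons_eq_bind (E : κ → PMF α) (k : κ) (l : List κ) :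
    (k :: l).mapM E = (E k).bind fun a => (l.mapM E).map (a :: ·) := by
  rw [List.mapM_cons]
  rfl

theorem expect_exp_mapM_le [Fintype α] (E : κ → PMF α) {g : κ → α → ℝ}
    (hg : ∀ k a, |g k a| ≤ 1) (t : ℝ) (l : List κ) :
    expect (l.mapM E) (fun r => ENNReal.ofReal (Real.exp
      (t * ((List.zipWith g l r).sum - (l.map fun k => mean (E k) (g k)).sum)))) ≤
      ENNReal.ofReal (Real.exp (l.length * t ^ 2 / 2)) := by
  induction l with
  | nil => rw [mapM_nil_eq_pure, expect_pure]; simp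
  | cons k l ih =>
    have hsplit (a : α) (r : List α) :
        t * ((List.zipWith g (k :: l) (a :: r)).sum -
          ((k :: l).map fun k => mean (E k) (g k)).sum) =
        t * ((List.zipWith g l r).sum - (l.map fun k => mean (E k) (g k)).sum) +
          t * (g k a - mean (E k) (g k)) := by
      simp only [List.zipWith_cons_cons, List.sum_cons, List.map_cons]
      ring
    simp only [mapM_cons_eq_bind, expect_bind, ← PMF.bind_pure_comp, expect_pure,
      Function.comp_apply, hsplit, Real.exp_add, ENNReal.ofReal_mul (Real.exp_nonneg _),
      expect_mul_const]
    simp only [mul_comm (expect (l.mapM E) _), expect_mul_const]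
    refine (mul_le_mul' (expect_exp_le (E k) (hg k) t) ih).trans_eq ?_
    rw [← ENNReal.ofReal_mul (Real.exp_nonneg _), ← Real.exp_add]
    push_cast [List.length_cons]
    ring_nf

theorem hoeffding_mapM [Fintype α] (E : κ → PMF α) {g : κ → α → ℝ}
    (hg : ∀ k a, |g k a| ≤ 1) {l : List κ} {K d : ℝ} (hl : l.length ≤ K) (hK : 0 < K)
    (hd : 0 ≤ d) :
    (l.mapM E).toOuterMeasure
      {r | d ≤ |(List.zipWith g l r).sum - (l.map fun k => mean (E k) (g k)).sum|} ≤
      2 * ENNReal.ofReal (Real.exp (-(d ^ 2 / (2 * K)))) := by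
  refine chernoff_of_subgaussian hK hd fun t => (expect_exp_mapM_le E hg t l).trans ?_
  gcongr

theorem length_of_mem_support_mapM {E : κ → PMF α} {l : List κ} {r : List α}
    (h : r ∈ (l.mapM E).support) : r.length = l.length := by
  induction l generalizing r with
  | nil =>
    rw [mapM_nil_eq_pure] at h
    rw [(PMF.mem_support_pure_iff _ _).1 h, List.length_nil, List.length_nil]
  | cons k l ih =>
    rw [mapM_cons_eq_bind] at h
    simp only [PMF.mem_support_bind_iff, PMF.mem_support_map_iff] at h
    obtain ⟨a, -, r, hr, rfl⟩ := h
    rw [List.length_cons, List.length_cons, ih hr]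

theorem mapM_map_eq_map_mapM_zipWith (E : κ → PMF α) (g : κ → α → β) (l : List κ) :
    (l.mapM fun k => (E k).map (g k)) = (l.mapM E).map (List.zipWith g l) := by
  induction l with
  | nil => rw [mapM_nil_eq_pure, mapM_nil_eq_pure, PMF.pure_map, List.zipWith_nil_left]
  | cons k l ih =>
    simp only [mapM_cons_eq_bind, ih, PMF.bind_map, PMF.map_bind, PMF.map_comp]
    rfl

theorem mapM_map (E : κ → PMF α) (g : α → β) (l : List κ) :
    (l.mapM fun k => (E k).map g) = (l.mapM E).map (List.map g) := by
  induction l with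
  | nil => rw [mapM_nil_eq_pure, mapM_nil_eq_pure, PMF.pure_map, List.map_nil]
  | cons k l ih =>
    simp only [mapM_cons_eq_bind, ih, PMF.bind_map, PMF.map_bind, PMF.map_comp]
    rfl

theorem uniformOfFintype_map_equiv [Fintype α] [Nonempty α] [Fintype β] [Nonempty β] (e : α ≃ β) :
    (PMF.uniformOfFintype α).map e = PMF.uniformOfFintype β := by
  classical
  ext b
  rw [PMF.map_apply, tsum_eq_single (e.symm b) fun a ha => if_neg fun h => ha (by simp [h])]
  simp [Fintype.card_congr e]

theorem uniformOfFintype_prod [Fintype α] [Nonempty α] [Fintype β] [Nonempty β] :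
    PMF.uniformOfFintype (α × β) = (PMF.uniformOfFintype α).bind fun a =>
      (PMF.uniformOfFintype β).map (Prod.mk a) := by
  classical
  ext ⟨a, b⟩
  simp only [PMF.bind_apply, PMF.map_apply, PMF.uniformOfFintype_apply, Prod.mk.injEq, ite_and]
  rw [tsum_eq_single a fun a' ha => by simp [ha.symm],
    tsum_eq_single b fun b' hb => by simp [hb.symm]]
  simp only [if_true, Fintype.card_prod, Nat.cast_mul]
  exact ENNReal.mul_inv (.inr (ENNReal.natCast_ne_top _)) (.inl (ENNReal.natCast_ne_top _))

theorem mapM_replicate_uniformOfFintype [Fintype α] [Nonempty α] (u : κ) (m : ℕ) :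
    ((List.replicate m u).mapM fun _ => PMF.uniformOfFintype α) =
      (PMF.uniformOfFintype (Fin m → α)).map List.ofFn := by
  induction m with
  | zero =>
    rw [funext fun x : Fin 0 → α => List.ofFn_zero (f := x)]
    exact (PMF.map_const _ _).symm
  | succ m ih =>
    rw [List.replicate_succ, mapM_cons_eq_bind, ih,
      ← uniformOfFintype_map_equiv (Fin.consEquiv fun _ : Fin (m + 1) => α), uniformOfFintype_prod]
    simp only [PMF.map_bind, PMF.map_comp]
    congr! 3
    funext x
    simp [Fin.consEquiv, List.ofFn_succ]

end

/-! ### The Hadamard test -/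

section

variable {n : ℕ}

theorem Circuit.op_append (C D : Circuit n) :
    Circuit.op (C ++ D) = Circuit.op D * Circuit.op C := by
  induction C with
  | nil => simp [Circuit.op]
  | cons g C ih => simp only [List.cons_append, Circuit.op, ih, mul_assoc]

theorem Circuit.op_mul_conjTranspose (C : Circuit n) : C.op * C.opᴴ = 1 :=
  mul_eq_one_comm.1 C.op_unitary

/-- The inverse of an elementary gate as a circuit; `T` has order eight. -/
def Gate.inverse : Gate n → Circuit n
  | .h i => [.h i]
  | .t i => List.replicate 7 (.t i)
  | .cz i j hij => [.cz i j hij]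

/-- The circuit that undoes `C`. -/
def Circuit.inverse (C : Circuit n) : Circuit n := C.reverse.flatMap Gate.inverse

theorem onQubit_conjTranspose (i : Fin n) (A : Matrix Bool Bool ℂ) :
    (onQubit i A)ᴴ = onQubit i Aᴴ := by
  ext x y
  simp only [onQubit, Matrix.conjTranspose_apply, Matrix.of_apply, eq_comm (a := y _),
    apply_ite star, star_zero]

theorem hMat_conjTranspose : hMatᴴ = hMat := by
  ext a b
  cases a <;> cases b <;> simp [hMat]

theorem onQubit_diagonal (i : Fin n) (D : Bool → ℂ) :
    onQubit i (Matrix.diagonal D) = Matrix.diagonal fun x : Bits n => D (x i) := by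
  ext x y
  by_cases hxy : x = y
  · subst hxy
    simp [onQubit]
  · rw [Matrix.diagonal_apply_ne _ hxy, onQubit, Matrix.of_apply, ite_eq_right_iff]
    refine fun h => Matrix.diagonal_apply_ne _ fun hi => hxy (funext fun k => ?_)
    by_cases hk : k = i
    · rw [hk, hi]
    · exact h k hk

theorem t_op_pow_eight (i : Fin n) : (Gate.t i).op ^ 8 = 1 := by
  have h : Complex.exp (Real.pi * Complex.I / 4) ^ 8 = 1 := by
    rw [← Complex.exp_nat_mul, ← Complex.exp_two_pi_mul_I]
    congr 1
    push_cast
    ring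
  rw [Gate.op, tMat, onQubit_diagonal, Matrix.diagonal_pow, ← Matrix.diagonal_one]
  congr 1
  funext x
  cases hx : x i <;> simp [hx, h]

theorem Gate.op_inverse (g : Gate n) : Circuit.op g.inverse = g.opᴴ := by
  cases g with
  | h i => simp only [inverse, Circuit.op, one_mul, op, onQubit_conjTranspose, hMat_conjTranspose]
  | t i =>
    calc Circuit.op (Gate.t i).inverse = (Gate.t i).opᴴ * (Gate.t i).op * (Gate.t i).op ^ 7 := by
          simp only [inverse, List.replicate, Circuit.op, Gate.op_unitary, pow_succ, pow_zero,
            one_mul]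
      _ = (Gate.t i).opᴴ := by rw [mul_assoc, ← pow_succ', t_op_pow_eight, mul_one]
  | cz i j hij =>
    simp only [inverse, Circuit.op, one_mul, op, Matrix.diagonal_conjTranspose]
    congr 1
    funext x
    simp only [Pi.star_apply, apply_ite star, star_neg, star_one]

theorem Circuit.op_inverse (C : Circuit n) : Circuit.op C.inverse = C.opᴴ := by
  induction C with
  | nil => simp [inverse, op]
  | cons g C ih =>
    rw [show inverse (g :: C) = inverse C ++ g.inverse by simp [inverse], op_append, ih,
      g.op_inverse, op, Matrix.conjTranspose_mul]

/-- Separates the last of `n + 1` qubits. -/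
def splitLast (n : ℕ) : Bits (n + 1) ≃ Bits n × Bool :=
  (Fin.snocEquiv fun _ => Bool).symm.trans (Equiv.prodComm _ _)

/-- The operator on `n + 1` qubits that applies `M b` to the first `n` qubits when the last one is
in the basis state `b`. -/
def control (n : ℕ) : (Bool → Op n) →+* Op (n + 1) :=
  (Matrix.reindexRingEquiv ℂ (splitLast n).symm).toRingHom.comp
    (Matrix.blockDiagonalRingHom (Bits n) Bool ℂ)

theorem control_apply (M : Bool → Op n) (x y : Bits (n + 1)) : control n M x y =
    if x (Fin.last n) = y (Fin.last n) then M (x (Fin.last n)) (Fin.init x) (Fin.init y) else 0 :=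
  rfl

theorem control_eq_submatrix (M : Bool → Op n) :
    control n M = (Matrix.blockDiagonal M).submatrix (splitLast n) (splitLast n) :=
  rfl

theorem control_conjTranspose (M : Bool → Op n) :
    (control n M)ᴴ = control n fun b => (M b)ᴴ := by
  rw [control_eq_submatrix, control_eq_submatrix, Matrix.conjTranspose_submatrix,
    Matrix.blockDiagonal_conjTranspose]

theorem control_diagonal (D : Bool → Bits n → ℂ) :
    control n (fun b => Matrix.diagonal (D b)) =
      Matrix.diagonal fun x => D (x (Fin.last n)) (Fin.init x) := by
  rw [control_eq_submatrix, Matrix.blockDiagonal_diagonal, Matrix.submatrix_diagonal_equiv]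
  rfl

theorem onQubit_castSucc (i : Fin n) (A : Matrix Bool Bool ℂ) :
    onQubit i.castSucc A = control n fun _ => onQubit i A := by
  ext x y
  rw [control_apply]
  simp only [onQubit, Matrix.of_apply, ← ite_and]
  refine if_congr ?_ rfl rfl
  simp [Fin.forall_fin_succ', Fin.init, (Fin.castSucc_lt_last i).ne', and_comm]

/-- The same gate on one more qubit. -/
def Gate.lift : Gate n → Gate (n + 1)
  | .h i => .h i.castSucc
  | .t i => .t i.castSucc
  | .cz i j hij => .cz i.castSucc j.castSucc (by simpa using hij)

/-- The same circuit on one more qubit. -/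
def Circuit.lift (C : Circuit n) : Circuit (n + 1) := C.map Gate.lift

theorem Gate.op_lift (g : Gate n) : g.lift.op = control n fun _ => g.op := by
  cases g with
  | h i => exact onQubit_castSucc i _
  | t i => exact onQubit_castSucc i _
  | cz i j hij => exact (control_diagonal fun _ x => if x i && x j then -1 else 1).symm

theorem Circuit.op_lift (C : Circuit n) : Circuit.op C.lift = control n fun _ => C.op := by
  induction C with
  | nil => exact (map_one (control n)).symm
  | cons g C ih =>
    rw [show lift (g :: C) = g.lift :: lift C from rfl, op, ih, g.op_lift, ← map_mul]
    rfl

/-- The Hadamard gate on the last qubit. -/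
def lastH (n : ℕ) : Op (n + 1) := onQubit (Fin.last n) hMat

theorem lastH_mul_lastH : lastH n * lastH n = 1 := by
  have h := onQubit_unitary (Fin.last n) hMat hMat_unitary
  rwa [onQubit_conjTranspose, hMat_conjTranspose] at h

/-- The Hadamard test of `U`: controlled on the last qubit, which is conjugated by `H`, apply `U`
to the others. -/
def hadamardTest (U : Op n) : Op (n + 1) := lastH n * control n (Pi.mulSingle true U) * lastH n

theorem conj_mul_conj {M : Type*} [Monoid M] {a b : M} (h : b * a = 1) (x y : M) :
    (a * x * b) * (a * y * b) = a * (x * y) * b := by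
  calc (a * x * b) * (a * y * b) = a * x * (b * a) * y * b := by simp only [mul_assoc]
    _ = a * (x * y) * b := by rw [h, mul_one, mul_assoc a x y]

theorem hadamardTest_mul (U V : Op n) :
    hadamardTest U * hadamardTest V = hadamardTest (U * V) := by
  rw [hadamardTest, hadamardTest, conj_mul_conj lastH_mul_lastH, ← map_mul, ← Pi.mulSingle_mul]
  rfl

theorem hadamardTest_one : hadamardTest (1 : Op n) = 1 := by
  rw [hadamardTest, Pi.mulSingle_one, map_one, mul_one, lastH_mul_lastH]

theorem hadamardTest_actsTrivially {U : Op n} {k : Fin n} (hU : ActsTrivially U k) :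
    ActsTrivially (hadamardTest U) k.castSucc := by
  have hH : ActsTrivially (lastH n) k.castSucc :=
    onQubit_actsTrivially (Fin.castSucc_lt_last k).ne _
  have hM : ∀ b, ActsTrivially ((Pi.mulSingle true U : Bool → Op n) b) k := by
    have hone : ActsTrivially (1 : Op n) k := by
      rw [← Matrix.diagonal_one]
      exact diagonal_actsTrivially fun _ => rfl
    intro b
    cases b
    · simpa using hone
    · simpa using hU
  refine (hH.mul ⟨fun x y hxy => ?_, fun x y b hxy => ?_⟩).mul hH
  · rw [control_apply, (hM _).1 _ _ hxy, ite_self]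
  · simp only [control_apply, Fin.init_update_castSucc,
      Function.update_of_ne (Fin.castSucc_lt_last k).ne',
      (hM _).2 (Fin.init x) (Fin.init y) b hxy]

theorem hadamardTest_apply_zeros (U : Op n) (x : Bits (n + 1)) :
    hadamardTest U x (zeros (n + 1)) = ((1 : Op n) (Fin.init x) (zeros n) +
      (if x (Fin.last n) then -1 else 1) * U (Fin.init x) (zeros n)) / 2 := by
  have hsq : ((Real.sqrt 2 : ℝ) : ℂ)⁻¹ * ((Real.sqrt 2 : ℝ) : ℂ)⁻¹ = 1 / 2 := by
    rw [← mul_inv, ← Complex.ofReal_mul, Real.mul_self_sqrt (by norm_num)]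
    norm_num
  have hz : (Fin.init (zeros (n + 1)) : Bits n) = zeros n := rfl
  rw [hadamardTest, mul_assoc, Matrix.mul_apply, lastH, sum_onQubit_mul]
  simp only [Matrix.mul_apply, sum_mul_onQubit, control_apply, Function.update_self,
    Fin.init_update_last, hz, Fintype.sum_bool, hMat, Matrix.of_apply]
  simp only [zeros, Bool.and_false, Bool.false_eq_true, if_false, Bool.and_true, mul_one,
    if_true, reduceCtorEq, zero_mul, add_zero, zero_add, Pi.mulSingle_eq_same,
    Pi.mulSingle_eq_of_ne Bool.false_ne_true]
  split_ifs
  · linear_combination ((1 : Op n) (Fin.init x) (zeros n) - U (Fin.init x) (zeros n)) * hsq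
  · linear_combination ((1 : Op n) (Fin.init x) (zeros n) + U (Fin.init x) (zeros n)) * hsq

theorem hadamardTest_bias (U : Op n) :
    ∑ y, Complex.normSq (hadamardTest U y (zeros (n + 1))) * (if y (Fin.last n) then -1 else 1) =
      (U (zeros n) (zeros n)).re := by
  have hpolar (a u : ℂ) : ∑ b : Bool, Complex.normSq ((a + (if b then -1 else 1) * u) / 2) *
      (if b then -1 else 1) = (a * star u).re := by
    simp [Complex.normSq_apply]
    ring
  simp only [hadamardTest_apply_zeros]
  refine ((splitLast n).sum_comp fun p : Bits n × Bool => Complex.normSq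
    (((1 : Op n) p.1 (zeros n) + (if p.2 then -1 else 1) * U p.1 (zeros n)) / 2) *
      (if p.2 then -1 else 1)).trans ?_
  refine (Fintype.sum_prod_type _).trans
    ((Finset.sum_congr rfl fun x _ => hpolar ((1 : Op n) x (zeros n)) (U x (zeros n))).trans ?_)
  simp [Matrix.one_apply, apply_ite Complex.re]

end

section

variable {n m : ℕ}

/-- The gate `H C† CZ C H` with `H` on the last qubit and `CZ` on the last qubit and `j`. -/
def testGate (C : Circuit n) (j : Fin n) : Circuit (n + 1) :=
  .h (Fin.last n) :: (C.lift ++ .cz (Fin.last n) j.castSucc (Fin.castSucc_lt_last j).ne' ::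
    (Circuit.inverse C.lift ++ [.h (Fin.last n)]))

theorem pauliZ_eq_diagonal (j : Fin n) :
    pauliZ j = Matrix.diagonal fun x : Bits n => if x j then (-1 : ℂ) else 1 :=
  onQubit_diagonal j _

theorem op_cz_last (j : Fin n) (h : Fin.last n ≠ j.castSucc) :
    (Gate.cz (Fin.last n) j.castSucc h).op = control n (Pi.mulSingle true (pauliZ j)) := by
  refine (control_diagonal fun b (x : Bits n) => if b && x j then -1 else 1).symm.trans ?_
  congr 1
  funext b
  cases b <;> simp [pauliZ_eq_diagonal]

theorem op_testGate (C : Circuit n) (j : Fin n) :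
    Circuit.op (testGate C j) = hadamardTest (C.opᴴ * pauliZ j * C.op) := by
  have hcontrol : control n (fun _ => C.opᴴ) * control n (Pi.mulSingle true (pauliZ j)) *
      control n (fun _ => C.op) = control n (Pi.mulSingle true (C.opᴴ * pauliZ j * C.op)) := by
    rw [← map_mul, ← map_mul]
    congr 1
    funext b
    cases b <;> simp [C.op_unitary]
  simp only [testGate, Circuit.op, Circuit.op_append, Circuit.op_inverse, Circuit.op_lift, one_mul,
    op_cz_last, control_conjTranspose]
  rw [hadamardTest, ← hcontrol]
  simp only [Gate.op, lastH, mul_assoc]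

theorem card_supp_testGate_le (C : Circuit n) (j : Fin n) :
    (supp (Circuit.op (testGate C j))).card ≤ 1 + (supp (C.opᴴ * pauliZ j * C.op)).card := by
  have hsub : supp (Circuit.op (testGate C j)) ⊆
      insert (Fin.last n) ((supp (C.opᴴ * pauliZ j * C.op)).map Fin.castSuccEmb) := by
    intro k
    refine Fin.lastCases (by simp) (fun k hk => ?_) k
    rw [op_testGate, mem_supp] at hk
    exact Finset.mem_insert_of_mem (Finset.mem_map_of_mem Fin.castSuccEmb
      (mem_supp.2 fun h => hk (hadamardTest_actsTrivially h)))
  calc (supp (Circuit.op (testGate C j))).card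
      ≤ ((supp (C.opᴴ * pauliZ j * C.op)).map Fin.castSuccEmb).card + 1 :=
        (Finset.card_le_card hsub).trans (Finset.card_insert_le _ _)
    _ = 1 + (supp (C.opᴴ * pauliZ j * C.op)).card := by rw [Finset.card_map, add_comm]

theorem testGate_commute (C : Circuit n) (i j : Fin n) :
    Commute (Circuit.op (testGate C i)) (Circuit.op (testGate C j)) := by
  unfold Commute SemiconjBy
  rw [op_testGate, op_testGate, hadamardTest_mul, hadamardTest_mul,
    conj_mul_conj C.op_mul_conjTranspose, conj_mul_conj C.op_mul_conjTranspose,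
    pauliZ_eq_diagonal, pauliZ_eq_diagonal, Matrix.diagonal_mul_diagonal,
    Matrix.diagonal_mul_diagonal]
  simp only [mul_comm]

theorem op_flatten_map_testGate (C : Circuit n) (J : List (Fin n)) :
    Circuit.op (J.map (testGate C)).flatten = hadamardTest (C.opᴴ *
      (Matrix.diagonal fun x : Bits n => (J.map fun j => if x j then (-1 : ℂ) else 1).prod) *
        C.op) := by
  induction J with
  | nil =>
    simp only [List.map_nil, List.flatten_nil, List.prod_nil, Circuit.op, Matrix.diagonal_one,
      mul_one, C.op_unitary, hadamardTest_one]
  | cons j J ih =>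
    rw [List.map_cons, List.flatten_cons, Circuit.op_append, ih, op_testGate, hadamardTest_mul,
      conj_mul_conj C.op_mul_conjTranspose, pauliZ_eq_diagonal, Matrix.diagonal_mul_diagonal]
    simp only [List.map_cons, List.prod_cons, mul_comm]

/-- The character `(-1)^{s·x}`. -/
def chi (s x : Bits m) : ℝ := ∏ j, if s j && x j then -1 else 1

/-- `⟨0ⁿ| C† Z_s C |0ⁿ⟩` where `Z_s` is the product of the `Z_j` with `s_j = 1`. -/
def charMean (hmn : m ≤ n) (C : Circuit n) (s : Bits m) : ℝ :=
  mean (measure C) fun y => chi s fun j => y (Fin.castLE hmn j)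

/-- The commuting circuit that estimates the expectation of the character `s`. -/
def testCircuit (hmn : m ≤ n) (C : Circuit n) (s : Bits m) : GateList (n + 1) :=
  (((List.finRange m).filter fun j => s j).map (Fin.castLE hmn)).map (testGate C)

theorem testCircuit_isCommuting (hmn : m ≤ n) (C : Circuit n) (s : Bits m) :
    (testCircuit hmn C s).IsCommuting (∑ j, (s j).toNat) (1 + maxSupp hmn C) := by
  refine ⟨?_, ?_, ?_⟩
  · rw [testCircuit, List.length_map, List.length_map, ← List.countP_eq_length_filter,
      Fin.sum_univ_def]
    refine le_of_eq ?_
    induction List.finRange m with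
    | nil => rfl
    | cons j l ih =>
      rw [List.countP_cons, ih, List.map_cons, List.sum_cons, Nat.add_comm]
      cases s j <;> rfl
  · exact List.pairwise_map.2 (List.pairwise_of_forall fun i j => testGate_commute C i j)
  · intro U hU
    simp only [testCircuit, List.mem_map] at hU
    obtain ⟨_, ⟨j, -, rfl⟩, rfl⟩ := hU
    refine (card_supp_testGate_le C _).trans (Nat.add_le_add_left ?_ 1)
    exact Finset.le_sup (f := fun j : Fin m =>
      (supp (C.opᴴ * pauliZ (Fin.castLE hmn j) * C.op)).card) (Finset.mem_univ j)

theorem prod_map_filter_finRange {M : Type*} [CommMonoid M] (s : Bits m) (g : Fin m → M) :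
    (((List.finRange m).filter fun j => s j).map g).prod = ∏ j, if s j then g j else 1 := by
  rw [← List.prod_toFinset g ((List.nodup_finRange m).filter _), List.toFinset_filter,
    List.toFinset_finRange, Finset.prod_filter]

theorem mean_testCircuit (hmn : m ≤ n) (C : Circuit n) (s : Bits m) :
    mean (measure (testCircuit hmn C s).flatten) (fun y => if y (Fin.last n) then -1 else 1) =
      charMean hmn C s := by
  rw [mean_measure, testCircuit, op_flatten_map_testGate, hadamardTest_bias, charMean,
    mean_measure, Matrix.mul_apply, Complex.re_sum]
  refine Finset.sum_congr rfl fun y _ => ?_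
  have hchi : (((List.finRange m).filter fun j => s j).map
      ((fun j => if y j then (-1 : ℂ) else 1) ∘ Fin.castLE hmn)).prod =
      ((chi s fun j => y (Fin.castLE hmn j) : ℝ) : ℂ) := by
    rw [prod_map_filter_finRange, chi, Complex.ofReal_prod]
    refine Finset.prod_congr rfl fun j _ => ?_
    cases hs : s j <;> cases hy : y (Fin.castLE hmn j) <;> simp [hy]
  rw [Matrix.mul_diagonal, Matrix.conjTranspose_apply, List.map_map, hchi, mul_right_comm,
    Complex.star_def, ← Complex.normSq_eq_conj_mul_self, ← Complex.ofReal_mul, Complex.ofReal_re]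

end

/-! ### Fourier expansion -/

section

variable {m : ℕ}

/-- The values of a Boolean function as real numbers. -/
def realVal (f : Bits m → Bool) (x : Bits m) : ℝ := if f x then 1 else 0

theorem realVal_nonneg (f : Bits m → Bool) (x : Bits m) : 0 ≤ realVal f x := by
  unfold realVal; split_ifs <;> norm_num

theorem abs_realVal_le (f : Bits m → Bool) (x : Bits m) : |realVal f x| ≤ 1 := by
  unfold realVal; split_ifs <;> norm_num

theorem abs_chi (s x : Bits m) : |chi s x| = 1 := by
  rw [chi, Finset.abs_prod]
  exact Finset.prod_eq_one fun j _ => by split_ifs <;> simp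

theorem fourier_eq (f : Bits m → Bool) (s : Bits m) :
    fourier f s = 1 / 2 ^ m * ∑ x, realVal f x * chi s x := by
  have hchi (x : Bits m) : (-1 : ℝ) ^ (∑ j, (s j && x j).toNat) = chi s x := by
    rw [← Finset.prod_pow_eq_pow_sum, chi]
    exact Finset.prod_congr rfl fun j _ => by cases s j && x j <;> simp
  simp only [fourier, hchi, realVal]

theorem mean_prod_eq_ite {κ : Type} [Fintype κ] [Nonempty κ] {φ : Fin m → κ → ℝ}
    {p : Fin m → Prop} [DecidablePred p]
    (h : ∀ j, mean (PMF.uniformOfFintype κ) (φ j) = if p j then 1 else 0) :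
    mean (PMF.uniformOfFintype (Fin m → κ)) (fun w => ∏ j, φ j (w j)) =
      if ∀ j, p j then 1 else 0 := by
  simp only [mean_uniformOfFintype] at h ⊢
  rw [← Fintype.piFinset_univ, ← Finset.prod_univ_sum, Fintype.card_fun, Nat.cast_pow,
    Fintype.card_fin, ← Fin.prod_const, ← Finset.prod_div_distrib,
    Finset.prod_congr rfl fun j _ => h j, Finset.prod_ite_zero]
  simp

theorem mean_chi_mul_chi (x y : Bits m) :
    mean (PMF.uniformOfFintype (Bits m)) (fun s => chi s y * chi s x) = if y = x then 1 else 0 := by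
  simp only [chi, ← Finset.prod_mul_distrib, funext_iff]
  refine mean_prod_eq_ite
    (φ := fun j b => (if b && y j then -1 else 1) * if b && x j then -1 else 1) fun j => ?_
  rw [mean_uniformOfFintype, Fintype.sum_bool]
  cases x j <;> cases y j <;> norm_num

theorem realVal_eq_sum (f : Bits m → Bool) (x : Bits m) :
    realVal f x = ∑ s, fourier f s * chi s x := by
  calc realVal f x = ∑ y, realVal f y * if y = x then 1 else 0 := by simp
    _ = ∑ y, ∑ s, 1 / 2 ^ m * (realVal f y * chi s y) * chi s x := by
        refine Finset.sum_congr rfl fun y _ => ?_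
        rw [← mean_chi_mul_chi, mean_uniformOfFintype, Finset.sum_div, Finset.mul_sum]
        refine Finset.sum_congr rfl fun s _ => ?_
        simp only [Fintype.card_fun, Fintype.card_bool, Fintype.card_fin, Nat.cast_pow,
          Nat.cast_ofNat]
        ring
    _ = ∑ s, fourier f s * chi s x := by
        rw [Finset.sum_comm]
        simp only [fourier_eq, Finset.mul_sum, Finset.sum_mul]

/-- The random bits drawn for one sample: three per coordinate. -/
abbrev Draw (m : ℕ) : Type := Fin m → Bool × Bool × Bool

/-- The string that agrees with the first string of the draw on `mask` and with the third one
elsewhere. -/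
def mixFst (mask : Bits m) (w : Draw m) : Bits m := fun i => if mask i then (w i).1 else (w i).2.2

/-- The string that agrees with the second string of the draw on `mask` and with the third one
elsewhere. -/
def mixSnd (mask : Bits m) (w : Draw m) : Bits m :=
  fun i => if mask i then (w i).2.1 else (w i).2.2

/-- The value of one sample for the Fourier coefficient of `f` at `s`. -/
def coeffTerm (f : Bits m → Bool) (s : Bits m) (w : Draw m) : ℝ :=
  realVal f (fun i => (w i).1) * chi s fun i => (w i).1

/-- The value of one sample for `weight f mask a`. -/
def weightTerm (f : Bits m → Bool) (mask a : Bits m) (w : Draw m) : ℝ :=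
  realVal f (mixFst mask w) * realVal f (mixSnd mask w) * chi a fun i => xor (w i).1 (w i).2.1

/-- The sum of the squares of the Fourier coefficients at the `s` that agree with `a` on `mask`,
where `a` vanishes off `mask`. -/
def weight (f : Bits m → Bool) (mask a : Bits m) : ℝ :=
  ∑ s, if ∀ i, (s i && mask i) = a i then fourier f s ^ 2 else 0

theorem abs_coeffTerm_le (f : Bits m → Bool) (s : Bits m) (w : Draw m) :
    |coeffTerm f s w| ≤ 1 := by
  rw [coeffTerm, abs_mul, abs_chi, mul_one]
  exact abs_realVal_le _ _

theorem abs_weightTerm_le (f : Bits m → Bool) (mask a : Bits m) (w : Draw m) :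
    |weightTerm f mask a w| ≤ 1 := by
  rw [weightTerm, abs_mul, abs_chi, mul_one, abs_mul]
  exact mul_le_one₀ (abs_realVal_le _ _) (abs_nonneg _) (abs_realVal_le _ _)

theorem mean_coeffTerm (f : Bits m → Bool) (s : Bits m) :
    mean (PMF.uniformOfFintype (Draw m)) (coeffTerm f s) = fourier f s := by
  have hchi (t : Bits m) : mean (PMF.uniformOfFintype (Draw m))
      (fun w => (chi t fun i => (w i).1) * chi s fun i => (w i).1) = if t = s then 1 else 0 := by
    simp only [chi, ← Finset.prod_mul_distrib, funext_iff]
    refine mean_prod_eq_ite (φ := fun j (u : Bool × Bool × Bool) =>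
      (if t j && u.1 then -1 else 1) * if s j && u.1 then -1 else 1) fun j => ?_
    simp only [mean_uniformOfFintype, Fintype.sum_prod_type, Fintype.sum_bool,
      Fintype.card_prod, Fintype.card_bool]
    cases t j <;> cases s j <;> norm_num
  calc mean (PMF.uniformOfFintype (Draw m)) (coeffTerm f s)
      = mean (PMF.uniformOfFintype (Draw m)) (fun w => ∑ t, fourier f t *
          ((chi t fun i => (w i).1) * chi s fun i => (w i).1)) := by
        simp only [← mul_assoc, ← Finset.sum_mul, ← realVal_eq_sum]
        rfl
    _ = fourier f s := by simp [mean_sum, mean_const_mul, hchi]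

theorem mean_weightTerm (f : Bits m → Bool) {mask a : Bits m}
    (ha : ∀ i, mask i = false → a i = false) :
    mean (PMF.uniformOfFintype (Draw m)) (weightTerm f mask a) = weight f mask a := by
  have hchi (s t : Bits m) : mean (PMF.uniformOfFintype (Draw m))
      (fun w => chi s (mixFst mask w) * chi t (mixSnd mask w) *
        chi a fun i => xor (w i).1 (w i).2.1) =
      if ∀ i, t i = s i ∧ (s i && mask i) = a i then 1 else 0 := by
    simp only [chi, ← Finset.prod_mul_distrib, mixFst, mixSnd]
    refine mean_prod_eq_ite (φ := fun i (u : Bool × Bool × Bool) =>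
      (if s i && (if mask i then u.1 else u.2.2) then -1 else 1) *
      (if t i && (if mask i then u.2.1 else u.2.2) then -1 else 1) *
      (if a i && xor u.1 u.2.1 then -1 else 1)) fun i => ?_
    have hai := ha i
    simp only [mean_uniformOfFintype, Fintype.sum_prod_type, Fintype.sum_bool,
      Fintype.card_prod, Fintype.card_bool]
    cases hm : mask i
    · rw [hai hm]
      cases t i <;> cases s i <;> norm_num
    · cases t i <;> cases s i <;> cases a i <;> norm_num
  calc mean (PMF.uniformOfFintype (Draw m)) (weightTerm f mask a)
      = mean (PMF.uniformOfFintype (Draw m)) (fun w => ∑ s, ∑ t, fourier f s * fourier f t *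
          (chi s (mixFst mask w) * chi t (mixSnd mask w) *
            chi a fun i => xor (w i).1 (w i).2.1)) := by
        congr 1
        funext w
        rw [weightTerm, realVal_eq_sum, realVal_eq_sum, Finset.sum_mul_sum, Finset.sum_mul]
        refine Finset.sum_congr rfl fun s _ => ?_
        rw [Finset.sum_mul]
        exact Finset.sum_congr rfl fun t _ => by ring
    _ = ∑ s, ∑ t, fourier f s * fourier f t *
          if ∀ i, t i = s i ∧ (s i && mask i) = a i then 1 else 0 := by
        simp only [mean_sum, mean_const_mul, hchi]
    _ = weight f mask a := by
        refine Finset.sum_congr rfl fun s _ => ?_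
        rw [Finset.sum_eq_single s (fun t _ hts => ?_) (by simp)]
        · simp [sq]
        · rw [if_neg fun h => hts (funext fun i => (h i).1), mul_zero]

theorem sq_fourier_le_weight (f : Bits m → Bool) {mask a s : Bits m}
    (hs : ∀ i, (s i && mask i) = a i) : fourier f s ^ 2 ≤ weight f mask a := by
  have h := Finset.single_le_sum (f := fun s => if ∀ i, (s i && mask i) = a i then fourier f s ^ 2
    else 0) (fun t _ => by split_ifs <;> positivity) (Finset.mem_univ s)
  rwa [if_pos hs] at h

theorem exists_mem_spectrum_of_weight_pos {f : Bits m → Bool} {mask a : Bits m}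
    (h : 0 < weight f mask a) : ∃ s ∈ spectrum f, ∀ i, (s i && mask i) = a i := by
  obtain ⟨s, -, hs⟩ := Finset.exists_ne_zero_of_sum_ne_zero h.ne'
  obtain ⟨hagree, hne⟩ := ite_ne_right_iff.1 hs
  exact ⟨s, by simpa [spectrum] using hne, hagree⟩

theorem acceptProb_eq_mean {n : ℕ} (hmn : m ≤ n) (C : Circuit n) (f : Bits m → Bool) :
    acceptProb hmn C f =
      mean (measure C) fun y => realVal f fun j => y (Fin.castLE hmn j) := by
  have hprob (x : Bits m) : outcomeProb hmn C x =
      ∑ y, if x = (fun j => y (Fin.castLE hmn j)) then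
        Complex.normSq (C.op y (zeros n)) else 0 := by
    rw [outcomeProb, Matrix.mul_apply, Complex.re_sum]
    refine Finset.sum_congr rfl fun y _ => ?_
    rw [outcomeProj, Matrix.mul_diagonal, Matrix.conjTranspose_apply]
    simp only [funext_iff, eq_comm (a := x _)]
    split_ifs
    · rw [mul_one, Complex.star_def, ← Complex.normSq_eq_conj_mul_self, Complex.ofReal_re]
    · simp
  rw [mean_measure]
  simp only [acceptProb, hprob, Finset.mul_sum]
  rw [Finset.sum_comm]
  exact Finset.sum_congr rfl fun y _ => by simp [realVal, mul_comm]

theorem acceptProb_nonneg {n : ℕ} (hmn : m ≤ n) (C : Circuit n) (f : Bits m → Bool) :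
    0 ≤ acceptProb hmn C f := by
  rw [acceptProb_eq_mean]
  exact mean_nonneg _ fun y => realVal_nonneg _ _

theorem acceptProb_eq_sum_fourier {n : ℕ} (hmn : m ≤ n) (C : Circuit n) (f : Bits m → Bool) :
    acceptProb hmn C f = ∑ s, fourier f s * charMean hmn C s := by
  simp only [acceptProb_eq_mean, realVal_eq_sum, mean_sum, mean_const_mul, charMean]

theorem abs_charMean_le {n : ℕ} (hmn : m ≤ n) (C : Circuit n) (s : Bits m) :
    |charMean hmn C s| ≤ 1 :=
  abs_mean_le _ fun _ => (abs_chi _ _).le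

end

/-! ### Subroutine, device and coins -/

/-- No run is cut off. -/
def Runs.NoCutoff (μ : Runs) : Prop := ∀ o ∈ μ.support, o.1 ≠ Res.cutoff

namespace Runs.NoCutoff

theorem of_charge {t : ℕ} {μ : Runs} (h : (μ.charge t).NoCutoff) : μ.NoCutoff :=
  fun o ho => h (o.1, t + o.2) <| by
    rw [Runs.charge, PMF.mem_support_map_iff]; exact ⟨o, ho, rfl⟩

theorem of_andThen {μ : Runs} {k : Val → Runs} (h : (μ.andThen k).NoCutoff) : μ.NoCutoff := by
  rintro ⟨r, t⟩ ho rfl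
  refine h (.cutoff, t) ?_ rfl
  rw [Runs.andThen, PMF.mem_support_bind_iff]
  exact ⟨_, ho, by simp⟩

theorem of_andThen_out {μ : Runs} {k : Val → Runs} (h : (μ.andThen k).NoCutoff) {v : Val} {t : ℕ}
    (hv : (Res.out v, t) ∈ μ.support) : (k v).NoCutoff := by
  refine of_charge (t := t) fun o ho => h o ?_
  rw [Runs.andThen, PMF.mem_support_bind_iff]
  exact ⟨_, hv, ho⟩

theorem andThen_congr {μ μ' : Runs} {k k' : Val → Runs} (h : (μ.andThen k).NoCutoff)
    (hμ : μ.NoCutoff → μ' = μ) (hk : ∀ v, (k v).NoCutoff → k' v = k v) :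
    μ'.andThen k' = μ.andThen k := by
  rw [hμ h.of_andThen]
  ext o
  simp only [Runs.andThen, PMF.bind_apply]
  refine tsum_congr fun ⟨r, t⟩ => ?_
  by_cases ho : (r, t) ∈ μ.support
  · cases r with
    | out v => simp only [hk v (h.of_andThen_out ho)]
    | refused => rfl
    | cutoff => rfl
  · rw [(μ.apply_eq_zero_iff _).2 ho, zero_mul, zero_mul]

theorem whileLoop_congr {c a c' a' : Val → Runs} (hc : ∀ v, (c v).NoCutoff → c' v = c v)
    (ha : ∀ v, (a v).NoCutoff → a' v = a v) {N N' : ℕ} {v : Val} (hN : N ≤ N')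
    (h : (Runs.whileLoop c a N v).NoCutoff) :
    Runs.whileLoop c' a' N' v = Runs.whileLoop c a N v := by
  induction N generalizing N' v with
  | zero => exact absurd rfl (h (.cutoff, 0) (by simp [Runs.whileLoop]))
  | succ N ih =>
    obtain ⟨N', rfl⟩ := Nat.exists_eq_succ_of_ne_zero (n := N') (by omega)
    refine andThen_congr h (hc v) fun r hr => ?_
    split_ifs at hr ⊢
    · rfl
    · exact andThen_congr hr (ha v) fun w hw => ih (by omega) hw

end Runs.NoCutoff

theorem Prog.exec_eq_of_noCutoff (sub dev : Val → Runs) {N N' : ℕ} (hN : N ≤ N') (p : Prog)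
    {v : Val} (h : (p.exec sub dev N v).NoCutoff) :
    p.exec sub dev N' v = p.exec sub dev N v := by
  induction p generalizing v with
  | id | nil | fst | snd | coin | sub | query => rfl
  | pair a b iha ihb =>
    exact congrArg _ (h.of_charge.andThen_congr iha fun x hx =>
      hx.andThen_congr ihb fun _ _ => rfl)
  | comp b a ihb iha => exact congrArg _ (h.of_charge.andThen_congr iha fun _ => ihb)
  | ite c a b ihc iha ihb =>
    refine congrArg _ (h.of_charge.andThen_congr ihc fun r hr => ?_)
    split_ifs at hr ⊢
    · exact ihb hr
    · exact iha hr
  | _ c a ihc iha =>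
    exact congrArg _ (h.of_charge.whileLoop_congr (fun _ => ihc) (fun _ => iha) hN)

theorem Runs.Computes.bind_done {α γ : Type} [TreeEncoding α] (D : PMF γ) {g : γ → α} {B : ℕ}
    (hg : ∀ y, encSize (g y) ≤ B) :
    Runs.Computes (D.bind fun y => Runs.done (enc (g y)) (enc (g y)).size)
      (RandM.ofPMF (D.map g)) B where
  dist := by
    rw [RandM.run_ofPMF, PMF.map_bind, PMF.map_comp, PMF.map_comp, ← PMF.bind_pure_comp]
    simp only [Runs.done, PMF.pure_map]
    rfl
  time_le o ho := by
    obtain ⟨y, -, hy⟩ := (PMF.mem_support_bind_iff _ _ _).1 ho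
    rw [(PMF.mem_support_pure_iff _ _).1 hy, size_enc]
    exact hg y
  size_le a ha := by
    obtain ⟨y, -, rfl⟩ := (PMF.mem_support_map_iff _ _ _).1 (RandM.mem_outcomes_ofPMF.1 ha)
    exact hg y

theorem Runs.Computes.refuse {α : Type} [TreeEncoding α] (v : Val) (B : ℕ) :
    (refuse v).Computes (RandM.mk (PMF.pure none) : RandM α) B where
  dist := by simp [SCP.refuse, RandM.mk, RandM.run, PMF.pure_map, resOf]
  time_le o ho := by
    rw [(PMF.mem_support_pure_iff _ _).1 ho]
    exact Nat.zero_le B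
  size_le := by simp [RandM.outcomes, RandM.mk, RandM.run]

/-- An input of the algorithm, with a program for the Boolean function. -/
structure Instance (T : Polynomial ℕ) where
  /-- The number of qubits. -/
  n : ℕ
  /-- The number of measured qubits. -/
  m : ℕ
  hmn : m ≤ n
  /-- The circuit. -/
  C : Circuit n
  /-- The Boolean function. -/
  f : Bits m → Bool
  /-- The program for the Boolean function. -/
  P : Prog
  hP : Evaluates P f (T.eval m)

/-- The environment in which the algorithm runs on an input. -/
def Instance.env {T : Polynomial ℕ} (I : Instance T) : Env where
  sub N := I.P.exec refuse refuse N
  dev := device (I.n + 1) (fourierDegree I.f) (1 + maxSupp I.hmn I.C)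
  par := I.n

/-- A bit string read from a list, filled up with zeros. -/
def ofList {m : ℕ} (x : List Bool) : Bits m := fun j => x.getD j false

theorem ofList_ofFn {m : ℕ} (x : Bits m) : ofList (List.ofFn x) = x := by
  funext j
  simp [ofList, List.getD]

open Classical in
/-- The answer of the device to a request. -/
def answer {T : Polynomial ℕ} (I : Instance T) (Q : List (List RawGate)) : RandM (List Bool) :=
  match Function.partialInv (encGateList (N := I.n + 1)) (enc Q) with
  | some Q =>
      if Q.IsCommuting (fourierDegree I.f) (1 + maxSupp I.hmn I.C) then
        RandM.ofPMF ((measure Q.flatten).map List.ofFn)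
      else RandM.mk (PMF.pure none)
  | none => RandM.mk (PMF.pure none)

theorem encSize_ofFn_le {m : ℕ} (y : Bits m) : encSize (List.ofFn y) ≤ 1 + 4 * m := by
  have := encSize_le_of_forall_mem (l := List.ofFn y) fun b _ => encSize_bool_le b
  rw [List.length_ofFn] at this
  omega

section

variable {T : Polynomial ℕ} {ι α β γ : Type} [TreeEncoding α] [TreeEncoding β] [TreeEncoding γ]
  {env : EnvFamily ι}

theorem randPolyTime_sub : RandPolyTime (Instance.env (T := T))
    (fun I x => ∃ b : Bits I.m, x = List.ofFn b) fun I x => pure (I.f (ofList x)) := by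
  refine ⟨.sub, 4 + Polynomial.X + T, ?_⟩
  rintro I _ ⟨b, rfl⟩ N hN
  obtain ⟨t, ht, hexec⟩ := I.hP.2 b
  have hT : T.eval I.m ≤ T.eval (I.env.inputSize (List.ofFn b)) :=
    eval_mono _ (I.hmn.trans (Nat.le_add_right _ _))
  have hsize : I.env.inputSize (List.ofFn b) = I.n + encSize (List.ofFn b) := rfl
  simp only [Polynomial.eval_add, Polynomial.eval_X, Polynomial.eval_ofNat] at hN ⊢
  have hbool := encSize_bool_le (I.f b)
  have hrun : I.P.exec refuse refuse N (enc (List.ofFn b)) = Runs.done (enc (I.f b)) t := by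
    refine (Prog.exec_eq_of_noCutoff _ _ (N := T.eval I.m) (by omega) I.P ?_).trans hexec
    intro o ho
    replace ho : o ∈ (Runs.done (encBool (I.f b)) t).support := hexec ▸ ho
    rw [(PMF.mem_support_pure_iff _ _).1 ho]
    exact Res.noConfusion
  have hsub : (I.P.exec refuse refuse N (enc (List.ofFn b))).Computes
      (pure (I.f (ofList (List.ofFn b)))) (3 + T.eval I.m) := by
    rw [hrun, ofList_ofFn]
    exact .done (by omega) (by omega)
  exact (hsub.charge (1 + encSize (List.ofFn b))).mono (by omega)

theorem randPolyTime_query :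
    RandPolyTime (Instance.env (T := T)) (fun _ _ => True) answer := by
  refine ⟨.query, 10 + 5 * Polynomial.X, fun I Q _ N _ => ?_⟩
  have hanswer : (I.env.dev (enc Q)).Computes (answer I Q) (1 + 4 * (I.n + 1)) := by
    simp only [Instance.env, device, answer]
    cases Function.partialInv (encGateList (N := I.n + 1)) (enc Q) with
    | none => exact .refuse _ _
    | some Q =>
      dsimp only
      split_ifs
      · exact .bind_done _ encSize_ofFn_le
      · exact .refuse _ _
  refine (hanswer.charge (1 + encSize Q)).mono ?_
  have hsize : I.env.inputSize Q = I.n + encSize Q := rfl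
  simp only [Polynomial.eval_add, Polynomial.eval_mul, Polynomial.eval_X, Polynomial.eval_ofNat]
  omega

theorem randPolyTime_coin : RandPolyTime env (fun _ (_ : α) => True)
    fun _ _ => RandM.ofPMF (PMF.uniformOfFintype Bool) := by
  refine ⟨.coin, 4 + Polynomial.X, fun i a _ N _ => ?_⟩
  have hcoin := Runs.Computes.bind_done (PMF.uniformOfFintype Bool) encSize_bool_le
  rw [show (fun b : Bool => b) = id from rfl, PMF.map_id] at hcoin
  refine (hcoin.charge (1 + encSize a)).mono ?_
  simp only [Polynomial.eval_add, Polynomial.eval_X, Polynomial.eval_ofNat, Env.inputSize]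
  omega

theorem RandPolyTime.pair_uniformOfFintype [Fintype β] [Nonempty β] [Fintype γ] [Nonempty γ]
    (hβ : RandPolyTime env (fun _ (_ : α) => True) fun _ _ =>
      RandM.ofPMF (PMF.uniformOfFintype β))
    (hγ : RandPolyTime env (fun _ (_ : α) => True) fun _ _ =>
      RandM.ofPMF (PMF.uniformOfFintype γ)) :
    RandPolyTime env (fun _ (_ : α) => True) fun _ _ =>
      RandM.ofPMF (PMF.uniformOfFintype (β × γ)) := by
  refine (hβ.pair hγ).congr (fun _ _ h => h) fun _ _ _ => ?_
  simp only [RandM.map_ofPMF, ← RandM.ofPMF_bind, ← uniformOfFintype_prod]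

/-- The random strings for `num` samples. -/
def draws (m num : ℕ) : PMF (List (Draw m)) :=
  (List.replicate num ()).mapM fun _ => PMF.uniformOfFintype (Draw m)

theorem randPolyTime_draws {f g : α → ℕ} (hf : PolyTime env f) (hg : PolyTime env g) :
    RandPolyTime env (fun _ _ => True) fun _ x =>
      RandM.ofPMF ((draws (f x) (g x)).map (List.map List.ofFn)) := by
  have hbits : RandPolyTime env (fun _ (_ : ℕ × Unit) => True) fun _ _ =>
      RandM.ofPMF (PMF.uniformOfFintype (Bool × Bool × Bool)) :=
    randPolyTime_coin.pair_uniformOfFintype (randPolyTime_coin.pair_uniformOfFintype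
      randPolyTime_coin)
  have hdraw : RandPolyTime env (fun _ (_ : ℕ × Unit) => True) fun _ x =>
      RandM.ofPMF ((PMF.uniformOfFintype (Draw x.1)).map List.ofFn) := by
    refine (hbits.mapM.comp_polyTime (f := fun x : ℕ × Unit => (x.1, List.replicate x.1 ()))
      (by fun_prop)).congr (fun _ _ _ _ _ => trivial) fun _ x _ => ?_
    rw [RandM.mapM_ofPMF, mapM_replicate_uniformOfFintype]
  refine (hdraw.mapM.comp_polyTime (f := fun x => (f x, List.replicate (g x) ()))
    (by fun_prop)).congr (fun _ _ _ _ _ => trivial) fun _ x _ => ?_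
  rw [RandM.mapM_ofPMF fun _ => (PMF.uniformOfFintype (Draw (f x))).map List.ofFn, mapM_map]
  rfl

end

/-! ### The algorithm -/

/-- The number of samples, the number of votes by which a candidate of the search has to win, and
the maximal number of candidates, as polynomials in the number of qubits. -/
structure Params where
  /-- The number of samples. -/
  num : Polynomial ℕ
  /-- The margin for candidates. -/
  thr : Polynomial ℕ
  /-- The maximal number of candidates. -/
  cap : Polynomial ℕ

/-- Evaluate the Boolean function at the two inputs of a sample. -/
def evalSample {m : ℕ} (f : Bits m → Bool) (x : Sample) : List Bool × Bool :=
  (x.1, f (ofList x.2.1) && f (ofList x.2.2))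

/-- The data for estimating Fourier coefficients. -/
def coeffData {m : ℕ} (f : Bits m → Bool) (W : List (Draw m)) : List (List Bool × Bool) :=
  W.map fun w => evalSample f (coeffSample (List.ofFn w))

/-- The data for estimating sums of squares of Fourier coefficients in round `j` of the search. -/
def weightData {m : ℕ} (f : Bits m → Bool) (W : List (Draw m)) (j : ℕ) :
    List (List Bool × Bool) :=
  W.map fun w => evalSample f (weightSample (maskBits m j) (List.ofFn w))

/-- The candidates found by the search. -/
def candidates {m : ℕ} (f : Bits m → Bool) (thr cap : ℕ) (W : List (Draw m)) : List (List Bool) :=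
  search m thr cap ((List.range m).map (weightData f W))

/-- The description of a gate. -/
def rawGate {n : ℕ} : Gate n → RawGate
  | .h i => (0, encNat i)
  | .t i => (1, encNat i)
  | .cz i j _ => (2, .cons (encNat i) (encNat j))

/-- The description of a circuit. -/
def rawCircuit {n : ℕ} (C : Circuit n) : List RawGate := C.map rawGate

section

variable {T : Polynomial ℕ}

/-- The votes after the measurements, where the outcome of the last qubit is the sign of a vote. -/
def finalVotes (I : Instance T) (L : List ((Bool × Bool) × List (List RawGate))) :
    RandM (List (Bool × Bool)) :=
  L.mapM fun x => combine x.1 <$> answer I x.2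

/-- The random output, given the random strings for the samples. -/
def outcome (pr : Params) (I : Instance T) (W : List (Draw I.m)) : RandM (ℕ × ℕ) :=
  (fun V => (posVotes V - negVotes V, pr.num.eval I.n)) <$>
    finalVotes I (requests I.m I.n (rawCircuit I.C)
      (candidates I.f (pr.thr.eval I.n) (pr.cap.eval I.n) W) (coeffData I.f W))

/-- The input of the algorithm. -/
def Instance.input (I : Instance T) : ℕ × ℕ × List RawGate := (I.m, I.n, rawCircuit I.C)

/-- The inputs for the Boolean function in a sample have the right length. -/
def Sample.Valid (m : ℕ) (x : Sample) : Prop :=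
  (∃ b : Bits m, x.2.1 = List.ofFn b) ∧ ∃ b : Bits m, x.2.2 = List.ofFn b

theorem map_range_eq_ofFn {α : Type} (m : ℕ) (g : ℕ → α) :
    (List.range m).map g = List.ofFn fun i : Fin m => g i := by
  rw [← List.map_coe_finRange_eq_range, List.map_map, List.ofFn_eq_map]; rfl

theorem zip_ofFn {α β : Type} {m : ℕ} (x : Fin m → α) (y : Fin m → β) :
    (List.ofFn x).zip (List.ofFn y) = List.ofFn fun i => (x i, y i) :=
  List.ext_getElem (by simp) fun i _ _ => by simp

theorem coeffSample_ofFn {m : ℕ} (w : Draw m) : coeffSample (List.ofFn w) =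
    (List.ofFn fun i => (w i).1, List.ofFn fun i => (w i).1, List.ofFn fun i => (w i).1) := by
  simp [coeffSample, List.map_ofFn, Function.comp_def]

/-- The positions `0, …, j`. -/
def mask (m j : ℕ) : Bits m := fun i => decide ((i : ℕ) ≤ j)

theorem weightSample_ofFn {m : ℕ} (j : ℕ) (w : Draw m) :
    weightSample (maskBits m j) (List.ofFn w) =
      (List.ofFn fun i => xor (w i).1 (w i).2.1, List.ofFn (mixFst (mask m j) w),
        List.ofFn (mixSnd (mask m j) w)) := by
  simp only [weightSample, maskBits, map_range_eq_ofFn, zip_ofFn, List.map_ofFn, Function.comp_def]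
  rfl

theorem valid_of_mem_samples_fst {m : ℕ} {W : List (Draw m)} {x : Sample}
    (hx : x ∈ (samples m (W.map List.ofFn)).1) : x.Valid m := by
  simp only [samples, List.mem_map, exists_exists_and_eq_and] at hx
  obtain ⟨w, -, rfl⟩ := hx
  rw [coeffSample_ofFn]
  exact ⟨⟨_, rfl⟩, ⟨_, rfl⟩⟩

theorem valid_of_mem_samples_snd {m : ℕ} {W : List (Draw m)} {l : List Sample}
    (hl : l ∈ (samples m (W.map List.ofFn)).2) {x : Sample} (hx : x ∈ l) : x.Valid m := by
  obtain ⟨j, -, rfl⟩ := List.mem_map.1 hl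
  simp only [List.mem_map, exists_exists_and_eq_and] at hx
  obtain ⟨w, -, rfl⟩ := hx
  rw [weightSample_ofFn]
  exact ⟨⟨_, rfl⟩, ⟨_, rfl⟩⟩

section

variable {α : Type} [TreeEncoding α]

theorem randPolyTime_evalSample : RandPolyTime (Instance.env (T := T))
    (fun I (x : α × Sample) => x.2.Valid I.m) fun I x => pure (evalSample I.f x.2) := by
  have hpoint : RandPolyTime (Instance.env (T := T)) (fun _ (_ : α × Sample) => True)
      fun _ x => pure x.2.1 := PolyTime.randPolyTime (by fun_prop) _
  have hfst := (randPolyTime_sub (T := T)).comp_polyTime (f := fun x : α × Sample => x.2.2.1)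
    (by fun_prop)
  have hsnd := (randPolyTime_sub (T := T)).comp_polyTime (f := fun x : α × Sample => x.2.2.2)
    (by fun_prop)
  refine (((hpoint.congr (fun _ _ _ => trivial) fun _ _ _ => rfl).pair
    ((hfst.congr (fun _ _ h => h.1) fun _ _ _ => rfl).pair
      (hsnd.congr (fun _ _ h => h.2) fun _ _ _ => rfl))).map
    (g := fun y : List Bool × Bool × Bool => (y.1, y.2.1 && y.2.2)) (by fun_prop)).congr
    (fun _ _ h => h) fun I x _ => ?_
  simp only [map_pure, pure_bind]
  rfl

theorem randPolyTime_map_evalSample : RandPolyTime (Instance.env (T := T))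
    (fun I (x : α × List Sample) => ∀ s ∈ x.2, s.Valid I.m)
    fun I x => pure (x.2.map (evalSample I.f)) :=
  (randPolyTime_evalSample (α := α)).mapM.congr (fun _ _ h => h) fun _ _ _ => List.mapM_pure

theorem randPolyTime_map_map_evalSample : RandPolyTime (Instance.env (T := T))
    (fun I (x : α × List (List Sample)) => ∀ l ∈ x.2, ∀ s ∈ l, s.Valid I.m)
    fun I x => pure (x.2.map fun l => l.map (evalSample I.f)) :=
  (randPolyTime_map_evalSample (α := α)).mapM.congr (fun _ _ h => h) fun _ _ _ => List.mapM_pure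

end

theorem randPolyTime_data : RandPolyTime (Instance.env (T := T))
    (fun I (x : (ℕ × ℕ × List RawGate) × List (List (Bool × Bool × Bool))) =>
      x.1 = I.input ∧ ∃ W : List (Draw I.m), x.2 = W.map List.ofFn)
    fun I x => pure (x.1, (samples x.1.1 x.2).1.map (evalSample I.f),
      (samples x.1.1 x.2).2.map fun l => l.map (evalSample I.f)) := by
  have hinput : PolyTime (Instance.env (T := T))
      fun x : (ℕ × ℕ × List RawGate) × List (List (Bool × Bool × Bool)) => x.1 := by fun_prop
  have hsamples : PolyTime (Instance.env (T := T))
      fun x : (ℕ × ℕ × List RawGate) × List (List (Bool × Bool × Bool)) =>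
        samples x.1.1 x.2 := by fun_prop
  have hcoeff := (randPolyTime_map_evalSample (T := T)).comp_polyTime
    ((polyTime_const ()).prodMk hsamples.fst)
  have hweight := (randPolyTime_map_map_evalSample (T := T)).comp_polyTime
    ((polyTime_const ()).prodMk hsamples.snd)
  refine ((hinput.randPolyTime _).pair ((hcoeff.congr ?_ fun _ _ _ => rfl).pair
    (hweight.congr ?_ fun _ _ _ => rfl))).congr (fun _ _ h => h) fun _ _ _ => ?_
  · rintro I ⟨_, _⟩ ⟨rfl, W, rfl⟩ s hs
    exact valid_of_mem_samples_fst hs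
  · rintro I ⟨_, _⟩ ⟨rfl, W, rfl⟩ l hl s hs
    exact valid_of_mem_samples_snd hl hs
  · simp only [map_pure, pure_bind]

theorem randPolyTime_finalVotes :
    RandPolyTime (Instance.env (T := T)) (fun _ _ => True) finalVotes := by
  have hanswer : RandPolyTime (Instance.env (T := T)) (fun _ _ => True)
      fun I (x : Unit × (Bool × Bool) × List (List RawGate)) =>
        combine x.2.1 <$> answer I x.2.2 := by
    have hvote : PolyTime (Instance.env (T := T))
      fun x : Unit × (Bool × Bool) × List (List RawGate) => x.2.1 := by fun_prop
    refine (((hvote.randPolyTime _).pair ((randPolyTime_query (T := T)).comp_polyTime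
      (f := fun x : Unit × (Bool × Bool) × List (List RawGate) => x.2.2) (by fun_prop))).map
      (g := fun y : (Bool × Bool) × List Bool => combine y.1 y.2) (by fun_prop)).congr
      (fun _ _ _ => trivial) fun _ _ _ => ?_
    rw [pure_bind, Functor.map_map]
  exact (hanswer.mapM.comp_polyTime (f := fun L => ((), L)) (by fun_prop)).congr
    (fun _ _ _ _ _ => trivial) fun _ _ _ => rfl

/-- The input, the data for Fourier coefficients and the data for the search. -/
abbrev SampledData : Type :=
  (ℕ × ℕ × List RawGate) × List (List Bool × Bool) × List (List (List Bool × Bool))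

theorem randPolyTime_estimate (pr : Params) : RandPolyTime (Instance.env (T := T)) (fun _ _ => True)
    fun I (x : SampledData) => (fun V => (posVotes V - negVotes V, pr.num.eval x.1.2.1)) <$>
      finalVotes I (requests x.1.1 x.1.2.1 x.1.2.2
        (search x.1.1 (pr.thr.eval x.1.2.1) (pr.cap.eval x.1.2.1) x.2.2) x.2.1) := by
  have hnum : PolyTime (Instance.env (T := T)) fun x : SampledData => pr.num.eval x.1.2.1 := by
    fun_prop
  have hvotes := (randPolyTime_finalVotes (T := T)).comp_polyTime (f := fun x : SampledData =>
    requests x.1.1 x.1.2.1 x.1.2.2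
      (search x.1.1 (pr.thr.eval x.1.2.1) (pr.cap.eval x.1.2.1) x.2.2) x.2.1) (by fun_prop)
  refine (((hnum.randPolyTime _).pair hvotes).map (g := fun y : ℕ × List (Bool × Bool) =>
    (posVotes y.2 - negVotes y.2, y.1)) (by fun_prop)).congr (fun _ _ _ => trivial)
    fun _ _ _ => ?_
  rw [pure_bind, Functor.map_map]

theorem randPolyTime_outcome (pr : Params) :
    RandPolyTime (Instance.env (T := T)) (fun I x => x = I.input) fun I _ =>
      RandM.ofPMF (draws I.m (pr.num.eval I.n)) >>= outcome pr I := by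
  have hinput : PolyTime (Instance.env (T := T)) fun x : ℕ × ℕ × List RawGate => x := by fun_prop
  have hdraws := (hinput.randPolyTime fun I x => x = I.input).pair
    ((randPolyTime_draws (env := Instance.env (T := T)) (f := fun x : ℕ × ℕ × List RawGate => x.1)
      (g := fun x => pr.num.eval x.2.1) (by fun_prop) (by fun_prop)).congr
      (fun _ _ _ => trivial) fun _ _ _ => rfl)
  refine ((randPolyTime_estimate pr).comp (randPolyTime_data.comp hdraws ?_)
    fun _ _ _ _ _ => trivial).congr (fun _ _ h => h) ?_
  · rintro I _ rfl b hb
    simp only [pure_bind, RandM.map_ofPMF, RandM.mem_outcomes_ofPMF, PMF.map_comp,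
      PMF.mem_support_map_iff] at hb
    obtain ⟨W, -, rfl⟩ := hb
    exact ⟨rfl, W, rfl⟩
  · rintro I _ rfl
    simp only [pure_bind, ← RandM.map_ofPMF, bind_map_left, bind_assoc]
    refine congrArg (RandM.ofPMF (draws I.m (pr.num.eval I.n)) >>= ·)
      (funext fun W : List (Draw I.m) => ?_)
    simp only [outcome, candidates, coeffData, Instance.input, samples, List.map_map,
      Function.comp_def]
    rfl

theorem enc_rawGate {n : ℕ} (g : Gate n) : enc (rawGate g) = encGate g := by cases g <;> rfl

theorem enc_rawCircuit {n : ℕ} (C : Circuit n) : enc (rawCircuit C) = encCircuit C := by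
  induction C with
  | nil => rfl
  | cons g C ih => exact congrArg₂ Val.cons (enc_rawGate g) ih

theorem enc_input (I : Instance T) :
    enc I.input = .cons (encNat I.m) (.cons (encNat I.n) (encCircuit I.C)) := by
  rw [← enc_rawCircuit]; rfl

theorem encSize_rawGate_le {n : ℕ} (g : Gate n) : encSize (rawGate g) ≤ 9 + 4 * n := by
  have hnat (k : ℕ) : (encNat k).size = 2 * k + 1 := encSize_nat k
  rw [← size_enc, enc_rawGate]
  cases g <;> simp only [encGate, Val.size, hnat] <;> omega

theorem encSize_rawCircuit_le {n : ℕ} (C : Circuit n) :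
    encSize (rawCircuit C) ≤ 1 + C.length * (10 + 4 * n) := by
  have hsize : encSize (rawCircuit C) ≤ 1 + (rawCircuit C).length * (1 + (9 + 4 * n)) :=
    encSize_le_of_forall_mem fun g hg => by
      obtain ⟨g, -, rfl⟩ := List.mem_map.1 hg
      exact encSize_rawGate_le g
  rwa [rawCircuit, List.length_map, ← Nat.add_assoc] at hsize

theorem exists_computes_outcome (pr : Params) (size : Polynomial ℕ) :
    ∃ (A : Prog) (R : Polynomial ℕ), ∀ I : Instance T, I.C.length ≤ size.eval I.n →
      (A.runs I.P I.m I.C (fourierDegree I.f) (1 + maxSupp I.hmn I.C) (R.eval I.n)).Computes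
        (RandM.ofPMF (draws I.m (pr.num.eval I.n)) >>= outcome pr I) (R.eval I.n) := by
  obtain ⟨A, R, hA⟩ := randPolyTime_outcome (T := T) pr
  let S : Polynomial ℕ := 5 * Polynomial.X + 5 + size * (10 + 4 * Polynomial.X)
  refine ⟨A, R.comp S, fun I hI => ?_⟩
  have hsize : I.env.inputSize I.input ≤ S.eval I.n := by
    have hC := (encSize_rawCircuit_le I.C).trans
      (Nat.add_le_add_left (Nat.mul_le_mul_right (10 + 4 * I.n) hI) 1)
    have hpar : I.env.inputSize I.input = I.n + encSize I.input := rfl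
    have := I.hmn
    rw [hpar]
    simp only [S, Instance.input, encSize_prodMk, encSize_nat, Polynomial.eval_add,
      Polynomial.eval_mul, Polynomial.eval_X, Polynomial.eval_ofNat]
    omega
  have hR := eval_mono R hsize
  rw [Polynomial.eval_comp, Prog.runs, ← enc_input]
  exact (hA I I.input rfl _ hR).mono hR

end

/-! ### Correctness of the search -/

/-- The value of a vote. -/
def voteVal (w : Bool × Bool) : ℝ := (if w.1 then 1 else 0) * if w.2 then -1 else 1

theorem posVotes_sub_negVotes (V : List (Bool × Bool)) :
    (posVotes V : ℝ) - negVotes V = (V.map voteVal).sum := by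
  induction V with
  | nil => simp [posVotes, negVotes]
  | cons w V ih =>
    obtain ⟨a, b⟩ := w
    rw [List.map_cons, List.sum_cons, ← ih]
    cases a <;> cases b <;> simp [posVotes, negVotes, voteVal] <;> ring

theorem foldl_xor_sign (l : List Bool) (b : Bool) :
    (if l.foldl xor b then (-1 : ℝ) else 1) =
      (if b then -1 else 1) * (l.map fun c => if c then (-1 : ℝ) else 1).prod := by
  induction l generalizing b with
  | nil => rw [List.foldl_nil, List.map_nil, List.prod_nil, mul_one]
  | cons c l ih =>
    rw [List.foldl_cons, ih, List.map_cons, List.prod_cons]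
    cases b <;> cases c <;> simp

section

variable {m : ℕ}

theorem parity_sign (s u : Bits m) :
    (if parity (List.ofFn s) (List.ofFn u) then (-1 : ℝ) else 1) = chi s u := by
  rw [parity, zip_ofFn, List.map_ofFn, foldl_xor_sign, List.map_ofFn, List.prod_ofFn]
  simp [chi]

/-- The vote of a draw on a Fourier coefficient. -/
def coeffVote (f : Bits m → Bool) (s : Bits m) (w : Draw m) : Bool × Bool :=
  (f fun i => (w i).1, parity (List.ofFn s) (List.ofFn fun i => (w i).1))

theorem voteVal_coeffVote (f : Bits m → Bool) (s : Bits m) (w : Draw m) :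
    voteVal (coeffVote f s w) = coeffTerm f s w := by
  rw [coeffVote, voteVal, parity_sign]
  rfl

theorem votes_coeffData (f : Bits m → Bool) (s : Bits m) (W : List (Draw m)) :
    votes (List.ofFn s) (coeffData f W) = W.map (coeffVote f s) := by
  simp only [votes, coeffData, List.map_map]
  refine List.map_congr_left fun w _ => ?_
  simp only [Function.comp_apply, evalSample, coeffSample_ofFn, ofList_ofFn, coeffVote,
    Bool.and_self]

theorem posVotes_sub_negVotes_weightData (f : Bits m → Bool) (s : Bits m) (W : List (Draw m))
    (j : ℕ) : (posVotes (votes (List.ofFn s) (weightData f W j)) : ℝ) -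
      negVotes (votes (List.ofFn s) (weightData f W j)) =
      (W.map (weightTerm f (mask m j) s)).sum := by
  rw [posVotes_sub_negVotes]
  simp only [votes, weightData, List.map_map]
  refine congrArg List.sum (List.map_congr_left fun w _ => ?_)
  simp only [Function.comp_apply, evalSample, weightSample_ofFn, ofList_ofFn, voteVal,
    parity_sign, weightTerm, realVal]
  by_cases hfst : f (mixFst (mask m j) w) <;> by_cases hsnd : f (mixSnd (mask m j) w) <;>
    simp [hfst, hsnd]

/-- The string that agrees with `s` on the first `k` positions and vanishes elsewhere. -/
def truncate (k : ℕ) (s : Bits m) : Bits m := fun i => s i && decide ((i : ℕ) < k)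

theorem truncate_truncate (k : ℕ) (s : Bits m) : truncate k (truncate k s) = truncate k s := by
  funext i; simp [truncate]

theorem truncate_zero (s : Bits m) : truncate 0 s = fun _ => false := by
  funext i; simp [truncate]

theorem truncate_self (s : Bits m) : truncate m s = s := by
  funext i; simp [truncate]

theorem and_mask_eq_truncate (j : ℕ) (s : Bits m) (i : Fin m) :
    (s i && mask m j i) = truncate (j + 1) s i := by
  simp [truncate, mask]

/-- Set position `j` to one if `b` is true. -/
def extendBits (b : Bool) (j : ℕ) (a : Bits m) : Bits m :=
  fun i => a i || (b && decide ((i : ℕ) = j))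

theorem extend_ofFn (b : Bool) (j : ℕ) (a : Bits m) :
    extend b (unitBits m j) (List.ofFn a) = List.ofFn (extendBits b j a) := by
  simp only [extend, unitBits, map_range_eq_ofFn, zip_ofFn, List.map_ofFn]
  rfl

theorem extendBits_false (j : ℕ) (a : Bits m) : extendBits false j a = a := by
  funext i; simp [extendBits]

theorem extendBits_truncate (j : Fin m) (s : Bits m) :
    extendBits (s j) j (truncate j s) = truncate (j + 1) s := by
  funext i
  rcases lt_trichotomy i j with h | rfl | h
  · simp [extendBits, truncate, h, h.ne, h.le, Fin.val_inj]
  · simp [extendBits, truncate]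
  · simp [extendBits, truncate, h.ne', Fin.val_inj, h.not_gt, Nat.not_lt.2 (Nat.succ_le_of_lt h)]

theorem truncate_extendBits (b : Bool) (j : ℕ) (a : Bits m) :
    truncate j (extendBits b j a) = truncate j a := by
  funext i
  by_cases h : (i : ℕ) = j <;> simp [truncate, extendBits, h]

theorem truncate_succ_extendBits {j : ℕ} (b : Bool) {a : Bits m} (ha : truncate j a = a) :
    truncate (j + 1) (extendBits b j a) = extendBits b j a := by
  rw [← ha]
  funext i
  by_cases h : (i : ℕ) = j <;> simp +contextual [truncate, extendBits, h, le_of_lt]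

/-- The candidates before the vote in round `j` of the search. -/
def children (j : Fin m) (L : List (Bits m)) : List (Bits m) := L ++ L.map (extendBits true j)

theorem truncate_succ_of_mem_children {j : Fin m} {L : List (Bits m)}
    (hL : ∀ a ∈ L, truncate j a = a) {a : Bits m} (ha : a ∈ children j L) :
    truncate (j + 1) a = a := by
  rcases List.mem_append.1 ha with ha | ha
  · simpa only [extendBits_false] using truncate_succ_extendBits false (hL a ha)
  · obtain ⟨a', ha', rfl⟩ := List.mem_map.1 ha
    exact truncate_succ_extendBits true (hL a' ha')

theorem truncate_succ_mem_children {j : Fin m} {L : List (Bits m)} {s : Bits m}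
    (hs : truncate j s ∈ L) : truncate (j + 1) s ∈ children j L := by
  rw [← extendBits_truncate, children, List.mem_append]
  cases s j
  · exact .inl ((extendBits_false j _).symm ▸ hs)
  · exact .inr (List.mem_map_of_mem hs)

theorem nodup_children {j : Fin m} {L : List (Bits m)} (hL : ∀ a ∈ L, truncate j a = a)
    (hnodup : L.Nodup) : (children j L).Nodup := by
  refine hnodup.append (hnodup.map_on fun a ha b hb hab => ?_) fun a ha ha' => ?_
  · rw [← hL a ha, ← hL b hb, ← truncate_extendBits true, hab, truncate_extendBits]
  · obtain ⟨b, -, rfl⟩ := List.mem_map.1 ha'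
    have hj := congrFun (hL _ ha) j
    simp [truncate, extendBits] at hj

/-- The candidates after the vote in round `j` of the search. -/
def survivors (f : Bits m → Bool) (W : List (Draw m)) (thr : ℕ) (j : Fin m) (L : List (Bits m)) :
    List (Bits m) :=
  (children j L).filter fun s => decide (negVotes (votes (List.ofFn s) (weightData f W j)) + thr ≤
    posVotes (votes (List.ofFn s) (weightData f W j)))

theorem mem_survivors {f : Bits m → Bool} {W : List (Draw m)} {thr : ℕ} {j : Fin m}
    {L : List (Bits m)} {a : Bits m} : a ∈ survivors f W thr j L ↔
      a ∈ children j L ∧ (thr : ℝ) ≤ (W.map (weightTerm f (mask m j) a)).sum := by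
  rw [survivors, List.mem_filter, decide_eq_true_eq, ← posVotes_sub_negVotes_weightData,
    le_sub_iff_add_le', ← Nat.cast_add, Nat.cast_le]

theorem searchStep_map_ofFn {f : Bits m → Bool} {W : List (Draw m)} {thr cap : ℕ} {j : Fin m}
    {L : List (Bits m)} (hcap : (survivors f W thr j L).length ≤ cap) :
    searchStep thr cap (L.map List.ofFn) (unitBits m j, weightData f W j) =
      (survivors f W thr j L).map List.ofFn := by
  have hchildren : (L.map List.ofFn).map (extend false (unitBits m j)) ++
      (L.map List.ofFn).map (extend true (unitBits m j)) = (children j L).map List.ofFn := by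
    simp only [List.map_map, Function.comp_def, extend_ofFn, extendBits_false, children,
      List.map_append]
  rw [searchStep, hchildren, List.filter_map, List.take_of_length_le]
  · rfl
  · rwa [List.length_map]

/-- All estimates of sums of squares of Fourier coefficients are accurate up to `thr / 2`. -/
def WeightsAccurate (f : Bits m → Bool) (M thr : ℝ) (W : List (Draw m)) : Prop :=
  ∀ (j : Fin m) (s : Bits m), |(W.map (weightTerm f (mask m j) (truncate (j + 1) s))).sum -
    M * weight f (mask m j) (truncate (j + 1) s)| < thr / 2

/-- The invariant of the search after `k` rounds: the candidates are truncations of strings in the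
spectrum, and no string whose squared Fourier coefficient is at least `heavy` has been lost. -/
structure SearchInv (f : Bits m → Bool) (heavy : ℝ) (k : ℕ) (L : List (Bits m)) : Prop where
  nodup : L.Nodup
  sound : ∀ a ∈ L, ∃ s ∈ spectrum f, truncate k s = a
  complete : ∀ s, heavy ≤ fourier f s ^ 2 → truncate k s ∈ L

theorem SearchInv.truncate_eq {f : Bits m → Bool} {heavy : ℝ} {k : ℕ} {L : List (Bits m)}
    (h : SearchInv f heavy k L) : ∀ a ∈ L, truncate k a = a := by
  intro a ha
  obtain ⟨s, -, rfl⟩ := h.sound a ha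
  exact truncate_truncate k s

theorem SearchInv.length_le {f : Bits m → Bool} {heavy : ℝ} {k : ℕ} {L : List (Bits m)}
    (h : SearchInv f heavy k L) : L.length ≤ (spectrum f).card := by
  rw [← List.toFinset_card_of_nodup h.nodup]
  refine (Finset.card_le_card (t := (spectrum f).image (truncate k)) fun a ha => ?_).trans
    Finset.card_image_le
  exact Finset.mem_image.2 (h.sound a (List.mem_toFinset.1 ha))

section

variable {f : Bits m → Bool} {W : List (Draw m)} {thr : ℕ} {M heavy : ℝ}

theorem exists_mem_spectrum_of_mem_survivors (hthr : 0 < thr) (hM : 0 ≤ M)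
    (hW : WeightsAccurate f M thr W) {j : Fin m} {L : List (Bits m)} {a : Bits m}
    (ha : a ∈ survivors f W thr j L) (htrunc : truncate (j + 1) a = a) :
    ∃ s ∈ spectrum f, truncate (j + 1) s = a := by
  have hestimate := (abs_lt.1 (hW j a)).2
  rw [htrunc] at hestimate
  have hthr' : (0 : ℝ) < thr := Nat.cast_pos.2 hthr
  have hpos : 0 < M * weight f (mask m j) a := by linarith [(mem_survivors.1 ha).2]
  obtain ⟨s, hs, hagree⟩ := exists_mem_spectrum_of_weight_pos (pos_of_mul_pos_right hpos hM)
  exact ⟨s, hs, funext fun i => by rw [← and_mask_eq_truncate, hagree]⟩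

theorem truncate_succ_mem_survivors (hM : 0 ≤ M) (hheavy : 2 * (thr : ℝ) ≤ M * heavy)
    (hW : WeightsAccurate f M thr W) {j : Fin m} {L : List (Bits m)} {s : Bits m}
    (hs : heavy ≤ fourier f s ^ 2) (hL : truncate j s ∈ L) :
    truncate (j + 1) s ∈ survivors f W thr j L := by
  refine mem_survivors.2 ⟨truncate_succ_mem_children hL, ?_⟩
  have hestimate := (abs_lt.1 (hW j s)).1
  have hweight : heavy ≤ weight f (mask m j) (truncate (j + 1) s) :=
    hs.trans (sq_fourier_le_weight f (and_mask_eq_truncate j s))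
  linarith [mul_le_mul_of_nonneg_left hweight hM, Nat.cast_nonneg (α := ℝ) thr]

theorem SearchInv.survivors (hthr : 0 < thr) (hM : 0 ≤ M) (hheavy : 2 * (thr : ℝ) ≤ M * heavy)
    (hW : WeightsAccurate f M thr W) {j : Fin m} {L : List (Bits m)} (h : SearchInv f heavy j L) :
    SearchInv f heavy (j + 1) (survivors f W thr j L) where
  nodup := (nodup_children h.truncate_eq h.nodup).filter _
  sound _ ha := exists_mem_spectrum_of_mem_survivors hthr hM hW ha
    (truncate_succ_of_mem_children h.truncate_eq (mem_survivors.1 ha).1)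
  complete s hs := truncate_succ_mem_survivors hM hheavy hW hs (h.complete s hs)

theorem searchInv_zero (hf : ∃ x, f x = true) : SearchInv f heavy 0 [fun _ => false] where
  nodup := List.nodup_singleton _
  sound a ha := by
    obtain ⟨x, hx⟩ := hf
    have hval : realVal f x ≠ 0 := by simp [realVal, hx]
    rw [realVal_eq_sum] at hval
    obtain ⟨s, -, hs⟩ := Finset.exists_ne_zero_of_sum_ne_zero hval
    exact ⟨s, by simpa [spectrum] using left_ne_zero_of_mul hs,
      (truncate_zero s).trans (List.mem_singleton.1 ha).symm⟩
  complete s _ := List.mem_singleton.2 (truncate_zero s)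

theorem exists_searchInv_candidates (hf : ∃ x, f x = true) (hthr : 0 < thr) (hM : 0 ≤ M)
    (hheavy : 2 * (thr : ℝ) ≤ M * heavy) (hW : WeightsAccurate f M thr W) {cap : ℕ}
    (hcap : (spectrum f).card ≤ cap) : ∃ L : List (Bits m), SearchInv f heavy m L ∧
      candidates f thr cap W = L.map List.ofFn := by
  rw [candidates, search, List.zip_map', List.foldl_map]
  suffices h : ∀ k ≤ m, ∃ L : List (Bits m), SearchInv f heavy k L ∧
      (List.range k).foldl (fun s j => searchStep thr cap s (unitBits m j, weightData f W j))
        [List.replicate m false] = L.map List.ofFn from h m le_rfl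
  intro k hk
  induction k with
  | zero => exact ⟨_, searchInv_zero hf, by simp⟩
  | succ k ih =>
    obtain ⟨L, hL, hfold⟩ := ih (Nat.le_of_succ_le hk)
    have hinv := hL.survivors (j := ⟨k, hk⟩) hthr hM hheavy hW
    refine ⟨_, hinv, ?_⟩
    rw [List.range_succ, List.foldl_append, hfold, List.foldl_cons, List.foldl_nil]
    exact searchStep_map_ofFn (j := ⟨k, hk⟩) (hinv.length_le.trans hcap)

end

end

/-! ### Accuracy of the output -/

section

variable {n m : ℕ}

theorem rawCircuit_lift (C : Circuit n) : rawCircuit C.lift = rawCircuit C := by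
  simp only [rawCircuit, Circuit.lift, List.map_map]
  exact List.map_congr_left fun g _ => by cases g <;> rfl

theorem rawCircuit_inverse (C : Circuit n) : rawCircuit C.inverse = rawInverse (rawCircuit C) := by
  simp only [rawCircuit, Circuit.inverse, rawInverse, ← List.map_reverse, List.map_flatMap,
    List.flatMap_map]
  exact List.flatMap_congr fun g _ => by cases g <;> rfl

theorem rawCircuit_testGate (C : Circuit n) (j : Fin n) :
    rawCircuit (testGate C j) = rawTestGate n (rawCircuit C) j := by
  rw [rawTestGate, ← rawCircuit_lift C, ← rawCircuit_inverse]
  simp only [testGate, rawCircuit, List.map_cons, List.map_append]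
  rfl

theorem rawTest_eq_map_testCircuit (hmn : m ≤ n) (C : Circuit n) (s : Bits m) :
    rawTest m n (rawCircuit C) (List.ofFn s) = (testCircuit hmn C s).map rawCircuit := by
  have hrange : List.range m = List.ofFn fun i : Fin m => (i : ℕ) := by
    rw [← map_range_eq_ofFn m fun i => i, List.map_id']
  rw [rawTest, hrange, zip_ofFn, List.ofFn_eq_map, List.flatMap_map, testCircuit, List.map_map,
    List.map_map]
  induction List.finRange m with
  | nil => rfl
  | cons j l ih =>
    rw [List.flatMap_cons, ih, List.filter_cons]
    cases s j <;> simp [rawCircuit_testGate]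

theorem enc_map_rawCircuit (Q : GateList n) : enc (Q.map rawCircuit) = encGateList Q := by
  induction Q with
  | nil => rfl
  | cons C Q ih => exact congrArg₂ Val.cons (enc_rawCircuit C) ih

theorem getLastD_ofFn (y : Bits (n + 1)) (b : Bool) :
    (List.ofFn y).getLastD b = y (Fin.last n) := by
  rw [List.ofFn_succ', List.concat_eq_append, List.getLastD_concat]

end

section

variable {T : Polynomial ℕ}

theorem answer_rawTest (I : Instance T) {s : Bits I.m} (hs : s ∈ spectrum I.f) :
    answer I (rawTest I.m I.n (rawCircuit I.C) (List.ofFn s)) =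
      RandM.ofPMF ((measure (testCircuit I.hmn I.C s).flatten).map List.ofFn) := by
  have hinj : Function.Injective (encGateList (N := I.n + 1)) :=
    encList_injective encCircuit_injective
  have hcomm : (testCircuit I.hmn I.C s).IsCommuting (fourierDegree I.f)
      (1 + maxSupp I.hmn I.C) :=
    (testCircuit_isCommuting I.hmn I.C s).imp_left fun hlen =>
      hlen.trans (Finset.le_sup (f := fun s : Bits I.m => ∑ j, (s j).toNat) hs)
  rw [rawTest_eq_map_testCircuit I.hmn, answer, enc_map_rawCircuit,
    Function.partialInv_left hinj]
  exact if_pos hcomm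

theorem mapM_congr_left {α β : Type} {F G : α → RandM β} {l : List α} (h : ∀ a ∈ l, F a = G a) :
    l.mapM F = l.mapM G := by
  induction l with
  | nil => rfl
  | cons a l ih =>
    rw [List.forall_mem_cons] at h
    rw [List.mapM_cons, List.mapM_cons, h.1, ih h.2]

/-- The measurement outcomes for all pairs of a candidate and a draw. -/
def measurements (I : Instance T) (l : List (Bits I.m × Draw I.m)) :
    PMF (List (Bits (I.n + 1))) :=
  l.mapM fun k => measure (testCircuit I.hmn I.C k.1).flatten

/-- The votes after the measurements, as a function of the measurement outcomes. -/
def resultVotes {n m : ℕ} (f : Bits m → Bool) (l : List (Bits m × Draw m))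
    (ys : List (Bits (n + 1))) : List (Bool × Bool) :=
  List.zipWith (fun k y => combine (coeffVote f k.1 k.2) (List.ofFn y)) l ys

theorem requests_eq_map_product (I : Instance T) (L : List (Bits I.m)) (W : List (Draw I.m)) :
    requests I.m I.n (rawCircuit I.C) (L.map List.ofFn) (coeffData I.f W) =
      (L ×ˢ W).map fun k => (coeffVote I.f k.1 k.2,
        rawTest I.m I.n (rawCircuit I.C) (List.ofFn k.1)) := by
  rw [requests, List.flatMap_map]
  change _ = (L.flatMap fun s => W.map (Prod.mk s)).map _
  rw [List.map_flatMap]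
  simp only [votes_coeffData, List.map_map]
  rfl

theorem finalVotes_map (I : Instance T) {l : List (Bits I.m × Draw I.m)}
    (hl : ∀ k ∈ l, k.1 ∈ spectrum I.f) :
    finalVotes I (l.map fun k => (coeffVote I.f k.1 k.2,
      rawTest I.m I.n (rawCircuit I.C) (List.ofFn k.1))) =
      RandM.ofPMF ((measurements I l).map (resultVotes I.f l)) := by
  have hvote : ∀ k ∈ l, combine (coeffVote I.f k.1 k.2) <$>
      answer I (rawTest I.m I.n (rawCircuit I.C) (List.ofFn k.1)) =
      RandM.ofPMF ((measure (testCircuit I.hmn I.C k.1).flatten).map fun y =>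
        combine (coeffVote I.f k.1 k.2) (List.ofFn y)) := fun k hk => by
    rw [answer_rawTest I (hl k hk), RandM.map_ofPMF, PMF.map_comp]
    rfl
  rw [finalVotes, List.mapM_map]
  refine (mapM_congr_left hvote).trans ?_
  rw [RandM.mapM_ofPMF, mapM_map_eq_map_mapM_zipWith]
  rfl

theorem outcome_eq_ofPMF (pr : Params) (I : Instance T) {W : List (Draw I.m)} {L : List (Bits I.m)}
    (hL : candidates I.f (pr.thr.eval I.n) (pr.cap.eval I.n) W = L.map List.ofFn)
    (hsub : ∀ s ∈ L, s ∈ spectrum I.f) :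
    outcome pr I W = RandM.ofPMF ((measurements I (L ×ˢ W)).map fun ys =>
      (posVotes (resultVotes I.f (L ×ˢ W) ys) - negVotes (resultVotes I.f (L ×ˢ W) ys),
        pr.num.eval I.n)) := by
  rw [outcome, hL, requests_eq_map_product, finalVotes_map I, RandM.map_ofPMF, PMF.map_comp]
  · rfl
  · exact fun k hk => hsub k.1 (List.mem_product.1 hk).1

end

section

variable {n m : ℕ}

/-- The contribution of a measurement outcome to the estimate of the acceptance probability. -/
def outcomeTerm (f : Bits m → Bool) (k : Bits m × Draw m) (y : Bits (n + 1)) : ℝ :=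
  coeffTerm f k.1 k.2 * if y (Fin.last n) then -1 else 1

theorem abs_outcomeTerm_le (f : Bits m → Bool) (k : Bits m × Draw m) (y : Bits (n + 1)) :
    |outcomeTerm f k y| ≤ 1 := by
  have hsign : |if y (Fin.last n) then (-1 : ℝ) else 1| = 1 := by split_ifs <;> simp
  rw [outcomeTerm, abs_mul, hsign, mul_one]
  exact abs_coeffTerm_le _ _ _

theorem mean_outcomeTerm (hmn : m ≤ n) (C : Circuit n) (f : Bits m → Bool)
    (k : Bits m × Draw m) : mean (measure (testCircuit hmn C k.1).flatten) (outcomeTerm f k) =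
      coeffTerm f k.1 k.2 * charMean hmn C k.1 := by
  rw [← mean_testCircuit, ← mean_const_mul]
  rfl

theorem voteVal_combine (w : Bool × Bool) (y : Bits (n + 1)) :
    voteVal (combine w (List.ofFn y)) = voteVal w * if y (Fin.last n) then -1 else 1 := by
  obtain ⟨a, b⟩ := w
  rw [combine, getLastD_ofFn]
  cases a <;> cases b <;> cases y (Fin.last n) <;> simp [voteVal]

theorem posVotes_sub_negVotes_resultVotes (f : Bits m → Bool) (l : List (Bits m × Draw m))
    (ys : List (Bits (n + 1))) :
    (posVotes (resultVotes f l ys) : ℝ) - negVotes (resultVotes f l ys) =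
      (List.zipWith (outcomeTerm f) l ys).sum := by
  simp only [posVotes_sub_negVotes, resultVotes, List.map_zipWith, voteVal_combine,
    voteVal_coeffVote]
  rfl

theorem sum_map_product (F : Bits m × Draw m → ℝ) (L : List (Bits m)) (W : List (Draw m)) :
    ((L ×ˢ W).map F).sum = (L.map fun s => (W.map fun w => F (s, w)).sum).sum := by
  induction L with
  | nil => rfl
  | cons s L ih =>
    rw [List.product_cons, List.map_append, List.sum_append, ih, List.map_map]
    rfl

/-- All estimates of Fourier coefficients are accurate up to `thr / 2`. -/
def CoeffsAccurate (f : Bits m → Bool) (M thr : ℝ) (W : List (Draw m)) : Prop :=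
  ∀ s : Bits m, |(W.map (coeffTerm f s)).sum - M * fourier f s| < thr / 2

variable {f : Bits m → Bool} {L : List (Bits m)} {W : List (Draw m)} {M thr theta : ℝ}

theorem SearchInv.mem_spectrum {heavy : ℝ} (hL : SearchInv f heavy m L) :
    ∀ s ∈ L, s ∈ spectrum f := by
  intro a ha
  obtain ⟨s, hs, rfl⟩ := hL.sound a ha
  rwa [truncate_self]

theorem SearchInv.abs_fourier_le (hL : SearchInv f (theta ^ 2) m L) (htheta : 0 ≤ theta)
    {s : Bits m} (hs : s ∉ L) : |fourier f s| ≤ theta := by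
  have := hL.complete s
  rw [truncate_self, ← not_imp_not, not_le] at this
  exact (abs_lt_of_sq_lt_sq (this hs) htheta).le

theorem abs_sum_estimates_sub_le (hmn : m ≤ n) (C : Circuit n) (hacc : CoeffsAccurate f M thr W)
    (S : Finset (Bits m)) :
    |∑ s ∈ S, (W.map (coeffTerm f s)).sum * charMean hmn C s -
      M * ∑ s ∈ S, fourier f s * charMean hmn C s| ≤ S.card * (thr / 2) := by
  rw [Finset.mul_sum, ← Finset.sum_sub_distrib, ← nsmul_eq_mul]
  refine (Finset.abs_sum_le_sum_abs _ _).trans (Finset.sum_le_card_nsmul _ _ _ fun s _ => ?_)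
  rw [← mul_assoc, ← sub_mul, abs_mul]
  exact (mul_le_of_le_one_right (abs_nonneg _) (abs_charMean_le hmn C s)).trans (hacc s).le

theorem abs_sum_fourier_mul_charMean_le (hmn : m ≤ n) (C : Circuit n) {S : Finset (Bits m)}
    (hS : ∀ s ∈ S, |fourier f s| ≤ theta) :
    |∑ s ∈ S, fourier f s * charMean hmn C s| ≤ S.card * theta := by
  rw [← nsmul_eq_mul]
  refine (Finset.abs_sum_le_sum_abs _ _).trans (Finset.sum_le_card_nsmul _ _ _ fun s hs => ?_)
  rw [abs_mul]
  exact (mul_le_of_le_one_right (abs_nonneg _) (abs_charMean_le hmn C s)).trans (hS s hs)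

theorem acceptProb_eq_add_sum_sdiff (hmn : m ≤ n) (C : Circuit n) {S : Finset (Bits m)}
    (hS : S ⊆ spectrum f) : acceptProb hmn C f = ∑ s ∈ S, fourier f s * charMean hmn C s +
      ∑ s ∈ spectrum f \ S, fourier f s * charMean hmn C s := by
  rw [acceptProb_eq_sum_fourier, add_comm, Finset.sum_sdiff hS]
  refine (Finset.sum_subset (Finset.subset_univ _) fun s _ hs => ?_).symm
  rw [spectrum, Finset.mem_filter_univ, not_not] at hs
  rw [hs, zero_mul]

theorem abs_sum_coeffTerm_mul_charMean_sub_le (hmn : m ≤ n) (C : Circuit n)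
    (hM : 0 ≤ M) (hthr : 0 ≤ thr) (htheta : 0 ≤ theta) (hL : SearchInv f (theta ^ 2) m L)
    (hacc : CoeffsAccurate f M thr W) :
    |((L ×ˢ W).map fun k => coeffTerm f k.1 k.2 * charMean hmn C k.1).sum -
      M * acceptProb hmn C f| ≤ (spectrum f).card * (thr / 2 + M * theta) := by
  have hsub : L.toFinset ⊆ spectrum f := fun s hs => hL.mem_spectrum s (List.mem_toFinset.1 hs)
  have hsum : ((L ×ˢ W).map fun k => coeffTerm f k.1 k.2 * charMean hmn C k.1).sum =
      ∑ s ∈ L.toFinset, (W.map (coeffTerm f s)).sum * charMean hmn C s := by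
    simp only [sum_map_product, List.sum_map_mul_right, List.sum_toFinset _ hL.nodup]
  have hfound := abs_sum_estimates_sub_le hmn C hacc L.toFinset
  have hlost := abs_sum_fourier_mul_charMean_le (f := f) (theta := theta) hmn C
    (S := spectrum f \ L.toFinset) fun s hs =>
      hL.abs_fourier_le htheta fun h => (Finset.mem_sdiff.1 hs).2 (List.mem_toFinset.2 h)
  rw [hsum, acceptProb_eq_add_sum_sdiff hmn C hsub, mul_add, ← sub_sub]
  refine (abs_sub _ _).trans ?_
  rw [abs_mul, abs_of_nonneg hM, mul_add, mul_left_comm]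
  gcongr
  · refine hfound.trans ?_
    gcongr
  · refine hlost.trans ?_
    gcongr
    exact Finset.sdiff_subset

end

/-! ### The success probability -/

theorem toOuterMeasure_exists_le {α ι : Type} [Fintype ι] (D : PMF α) {B : ι → Set α}
    {c : ENNReal} (hB : ∀ i, D.toOuterMeasure (B i) ≤ c) :
    D.toOuterMeasure {a | ∃ i, a ∈ B i} ≤ Fintype.card ι * c := by
  have hunion : {a | ∃ i, a ∈ B i} = ⋃ i, B i := Set.ext fun _ => Set.mem_iUnion.symm
  rw [hunion, ← nsmul_eq_mul, ← Finset.card_univ]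
  exact (MeasureTheory.measure_iUnion_fintype_le _ _).trans
    (Finset.sum_le_card_nsmul _ _ _ fun i _ => hB i)

section

variable {m : ℕ}

theorem length_of_mem_support_draws {num : ℕ} {W : List (Draw m)}
    (hW : W ∈ (draws m num).support) : W.length = num :=
  (length_of_mem_support_mapM hW).trans List.length_replicate

theorem draws_toOuterMeasure_le_abs_le {g : Draw m → ℝ} (hg : ∀ w, |g w| ≤ 1) {M : ℕ}
    (hM : 0 < M) {d : ℝ} (hd : 0 ≤ d) : (draws m M).toOuterMeasure
      {W | d ≤ |(W.map g).sum - M * mean (PMF.uniformOfFintype (Draw m)) g|} ≤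
      2 * ENNReal.ofReal (Real.exp (-(d ^ 2 / (2 * M)))) := by
  refine (PMF.toOuterMeasure_mono _ ?_).trans (hoeffding_mapM
    (fun _ : Unit => PMF.uniformOfFintype (Draw m)) (fun _ => hg) (l := List.replicate M ())
    (by rw [List.length_replicate]) (Nat.cast_pos.2 hM) hd)
  rintro W ⟨hdev, hW⟩
  have hlen : W.length ≤ (List.replicate M ()).length :=
    (length_of_mem_support_mapM hW).le
  have hzip : List.zipWith (fun _ w => g w) (List.replicate M ()) W = W.map g := by
    rw [← List.map_uncurry_zip_eq_zipWith]
    exact (List.map_map (f := Prod.snd)).symm.trans (congrArg _ (List.map_snd_zip hlen))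
  rw [Set.mem_ofPred_eq, hzip, List.map_replicate, List.sum_replicate, nsmul_eq_mul]
  exact hdev

variable (f : Bits m → Bool) {M : ℕ} {thr : ℝ}

theorem draws_toOuterMeasure_not_coeffsAccurate_le (hM : 0 < M) (hthr : 0 ≤ thr) :
    (draws m M).toOuterMeasure {W | ¬ CoeffsAccurate f M thr W} ≤
      (2 ^ m : ℕ) * (2 * ENNReal.ofReal (Real.exp (-((thr / 2) ^ 2 / (2 * M))))) := by
  have hunion := toOuterMeasure_exists_le (draws m M) fun s =>
    draws_toOuterMeasure_le_abs_le (abs_coeffTerm_le f s) hM (div_nonneg hthr zero_le_two)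
  simpa [mean_coeffTerm, CoeffsAccurate] using hunion

theorem draws_toOuterMeasure_not_weightsAccurate_le (hM : 0 < M) (hthr : 0 ≤ thr) :
    (draws m M).toOuterMeasure {W | ¬ WeightsAccurate f M thr W} ≤
      (m * 2 ^ m : ℕ) * (2 * ENNReal.ofReal (Real.exp (-((thr / 2) ^ 2 / (2 * M))))) := by
  have hunion := toOuterMeasure_exists_le (draws m M) fun x : Fin m × Bits m =>
    draws_toOuterMeasure_le_abs_le
      (abs_weightTerm_le f (mask m x.1) (truncate (x.1 + 1) x.2)) hM (div_nonneg hthr zero_le_two)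
  have hmean (j : Fin m) (s : Bits m) := mean_weightTerm f (mask := mask m j)
    (a := truncate (j + 1) s) fun i hi => by rw [← and_mask_eq_truncate, hi, Bool.and_false]
  simpa [hmean, WeightsAccurate] using hunion

theorem draws_toOuterMeasure_not_accurate_le (hM : 0 < M) (hthr : 0 ≤ thr) :
    (draws m M).toOuterMeasure {W | ¬ (WeightsAccurate f M thr W ∧ CoeffsAccurate f M thr W)} ≤
      ((m + 1) * 2 ^ m : ℕ) *
        (2 * ENNReal.ofReal (Real.exp (-((thr / 2) ^ 2 / (2 * M))))) := by
  simp only [not_and_or]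
  refine (MeasureTheory.measure_union_le _ _).trans ((add_le_add
    (draws_toOuterMeasure_not_weightsAccurate_le f hM hthr)
    (draws_toOuterMeasure_not_coeffsAccurate_le f hM hthr)).trans_eq ?_)
  push_cast
  ring

end

/-- The outputs `(a, b)` with `a / b` at distance at most `ε` from `p`. -/
def goodOutputs (p ε : ℝ) : Set (Option (ℕ × ℕ)) :=
  {o | ∃ a b : ℕ, 0 < b ∧ o = some (a, b) ∧ |p - (a : ℝ) / (b : ℝ)| ≤ ε}

theorem abs_sub_truncated_div_le {p M ε : ℝ} {a b : ℕ} (hp : 0 ≤ p) (hM : 0 < M)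
    (h : |(a : ℝ) - b - M * p| ≤ M * ε) : |p - ((a - b : ℕ) : ℝ) / M| ≤ ε := by
  have hMp : 0 ≤ M * p := mul_nonneg hM.le hp
  have hdiv : p - ((a - b : ℕ) : ℝ) / M = (M * p - ((a - b : ℕ) : ℝ)) / M := by field_simp
  rw [hdiv, abs_div, abs_of_pos hM, div_le_iff₀' hM]
  rcases le_total b a with hab | hab
  · rwa [Nat.cast_sub hab, abs_sub_comm]
  · rw [Nat.sub_eq_zero_of_le hab, Nat.cast_zero, sub_zero, abs_of_nonneg hMp]
    have hneg := (abs_le.1 h).1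
    have := (Nat.cast_le (α := ℝ)).2 hab
    linarith

/-- With these parameters a run on `n` qubits has error at most `ε` up to a failure probability
proportional to `exp (-c)`, where Fourier coefficients of absolute value less than `theta` are
allowed to be missed. -/
structure Params.Suffice (pr : Params) (n : ℕ) (ε theta c : ℝ) : Prop where
  thr_pos : 0 < pr.thr.eval n
  cap_pos : 0 < pr.cap.eval n
  eps_pos : 0 < ε
  theta_pos : 0 < theta
  two_mul_thr_le : 2 * ((pr.thr.eval n : ℕ) : ℝ) ≤ ((pr.num.eval n : ℕ) : ℝ) * theta ^ 2
  error_le : ((pr.cap.eval n : ℕ) : ℝ) *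
      (((pr.thr.eval n : ℕ) : ℝ) / 2 + ((pr.num.eval n : ℕ) : ℝ) * theta) ≤
    ((pr.num.eval n : ℕ) : ℝ) * (ε / 2)
  le_draws : c ≤ (((pr.thr.eval n : ℕ) : ℝ) / 2) ^ 2 / (2 * ((pr.num.eval n : ℕ) : ℝ))
  le_outcome : c ≤ (((pr.num.eval n : ℕ) : ℝ) * (ε / 2)) ^ 2 /
    (2 * (((pr.cap.eval n : ℕ) : ℝ) * ((pr.num.eval n : ℕ) : ℝ)))

theorem Params.Suffice.num_pos {pr : Params} {n : ℕ} {ε theta c : ℝ}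
    (h : pr.Suffice n ε theta c) : 0 < pr.num.eval n := by
  have hthr : (0 : ℝ) < (pr.thr.eval n : ℕ) := Nat.cast_pos.2 h.thr_pos
  have := pos_of_mul_pos_left ((mul_pos two_pos hthr).trans_le h.two_mul_thr_le) (sq_nonneg _)
  exact Nat.cast_pos.1 this

section

variable {T : Polynomial ℕ}

theorem resultVotes_mem_goodOutputs (I : Instance T) {l : List (Bits I.m × Draw I.m)}
    {ys : List (Bits (I.n + 1))} {M : ℕ} {ε mu : ℝ} (hM : 0 < M)
    (hmu : |mu - M * acceptProb I.hmn I.C I.f| ≤ M * (ε / 2))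
    (hys : |(List.zipWith (outcomeTerm I.f) l ys).sum - mu| < M * (ε / 2)) :
    some (posVotes (resultVotes I.f l ys) - negVotes (resultVotes I.f l ys), M) ∈
      goodOutputs (acceptProb I.hmn I.C I.f) ε := by
  refine ⟨_, M, hM, rfl, abs_sub_truncated_div_le (acceptProb_nonneg _ _ _) (Nat.cast_pos.2 hM) ?_⟩
  rw [posVotes_sub_negVotes_resultVotes]
  have := abs_sub_le (List.zipWith (outcomeTerm I.f) l ys).sum mu (M * acceptProb I.hmn I.C I.f)
  linarith

theorem outcome_toOuterMeasure_compl_goodOutputs_le {pr : Params} (I : Instance T) {ε theta c : ℝ}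
    (hpr : pr.Suffice I.n ε theta c) (hf : ∃ x, I.f x = true)
    (hcap : (spectrum I.f).card ≤ pr.cap.eval I.n) {W : List (Draw I.m)}
    (hlen : W.length = pr.num.eval I.n)
    (hweights : WeightsAccurate I.f ((pr.num.eval I.n : ℕ) : ℝ) ((pr.thr.eval I.n : ℕ) : ℝ) W)
    (hcoeffs : CoeffsAccurate I.f ((pr.num.eval I.n : ℕ) : ℝ) ((pr.thr.eval I.n : ℕ) : ℝ) W) :
    (outcome pr I W).run.toOuterMeasure (goodOutputs (acceptProb I.hmn I.C I.f) ε)ᶜ ≤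
      2 * ENNReal.ofReal (Real.exp (-c)) := by
  have hnum := hpr.num_pos
  obtain ⟨L, hL, hcand⟩ := exists_searchInv_candidates hf hpr.thr_pos (Nat.cast_nonneg _)
    hpr.two_mul_thr_le hweights hcap
  have hcard : ((L ×ˢ W).length : ℝ) ≤ (pr.cap.eval I.n : ℕ) * (pr.num.eval I.n : ℕ) := by
    rw [List.length_product, hlen, ← Nat.cast_mul, Nat.cast_le]
    exact Nat.mul_le_mul_right _ (hL.length_le.trans hcap)
  have hpos : (0 : ℝ) < (pr.cap.eval I.n : ℕ) * (pr.num.eval I.n : ℕ) :=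
    mul_pos (Nat.cast_pos.2 hpr.cap_pos) (Nat.cast_pos.2 hnum)
  have htheta := hpr.theta_pos.le
  have herror := (abs_sum_coeffTerm_mul_charMean_sub_le I.hmn I.C (Nat.cast_nonneg _)
    (Nat.cast_nonneg _) htheta hL hcoeffs).trans ((mul_le_mul_of_nonneg_right
      (Nat.cast_le.2 hcap) (by positivity)).trans hpr.error_le)
  have herror_nonneg : 0 ≤ ((pr.num.eval I.n : ℕ) : ℝ) * (ε / 2) :=
    mul_nonneg (Nat.cast_nonneg _) (half_pos hpr.eps_pos).le
  rw [outcome_eq_ofPMF pr I hcand hL.mem_spectrum, RandM.run_ofPMF, PMF.map_comp,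
    PMF.toOuterMeasure_map_apply]
  refine ((PMF.toOuterMeasure_mono _ ?_).trans (hoeffding_mapM
    (fun k : Bits I.m × Draw I.m => measure (testCircuit I.hmn I.C k.1).flatten)
    (abs_outcomeTerm_le I.f) hcard hpos herror_nonneg)).trans ?_
  · rintro ys ⟨hbad, -⟩
    by_contra hlt
    simp only [Set.mem_ofPred_eq, not_le, mean_outcomeTerm] at hlt
    exact hbad (resultVotes_mem_goodOutputs I hnum herror hlt)
  · gcongr
    exact hpr.le_outcome

theorem run_toOuterMeasure_compl_goodOutputs_le {pr : Params} (I : Instance T) {ε theta c : ℝ}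
    (hpr : pr.Suffice I.n ε theta c) (hf : ∃ x, I.f x = true)
    (hcap : (spectrum I.f).card ≤ pr.cap.eval I.n) :
    (RandM.ofPMF (draws I.m (pr.num.eval I.n)) >>= outcome pr I).run.toOuterMeasure
      (goodOutputs (acceptProb I.hmn I.C I.f) ε)ᶜ ≤
      ENNReal.ofReal ((((I.m + 1) * 2 ^ I.m : ℕ) + 1) * (2 * Real.exp (-c))) := by
  have hdraws := draws_toOuterMeasure_not_accurate_le I.f hpr.num_pos
    (thr := ((pr.thr.eval I.n : ℕ) : ℝ)) (Nat.cast_nonneg _)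
  rw [RandM.run_ofPMF_bind]
  refine (toOuterMeasure_bind_le (c' := 2 * ENNReal.ofReal (Real.exp (-c))) _ _ hdraws
    fun W hW haccurate => ?_).trans ?_
  · have haccurate' := not_not.1 haccurate
    exact outcome_toOuterMeasure_compl_goodOutputs_le I hpr hf hcap (length_of_mem_support_draws hW)
      haccurate'.1 haccurate'.2
  · rw [ENNReal.ofReal_mul (by positivity), ENNReal.ofReal_mul zero_le_two,
      ENNReal.ofReal_add (Nat.cast_nonneg _) zero_le_one, ENNReal.ofReal_natCast,
      ENNReal.ofReal_one, ENNReal.ofReal_ofNat, add_one_mul (_ : ENNReal)]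
    gcongr
    exact hpr.le_draws

end

theorem failure_bound_lt {m n : ℕ} (hmn : m ≤ n) :
    (((m + 1) * 2 ^ m : ℕ) + 1) * (2 * Real.exp (-(3 * n + 2))) < 1 / Real.exp n := by
  have htwo : (2 : ℝ) < Real.exp 1 := by linarith [Real.add_one_lt_exp one_ne_zero]
  have hcount : (((m + 1) * 2 ^ m : ℕ) : ℝ) ≤ Real.exp (2 * n) := by
    calc (((m + 1) * 2 ^ m : ℕ) : ℝ) = (m + 1) * 2 ^ m := by push_cast; rfl
      _ ≤ Real.exp m * Real.exp 1 ^ m := by gcongr; exact Real.add_one_le_exp _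
      _ = Real.exp (2 * m) := by rw [← Real.exp_nat_mul, ← Real.exp_add]; ring_nf
      _ ≤ Real.exp (2 * n) := by gcongr
  have hone : 1 ≤ Real.exp (2 * n) := Real.one_le_exp (by positivity)
  calc (((m + 1) * 2 ^ m : ℕ) + 1) * (2 * Real.exp (-(3 * n + 2)))
      ≤ (Real.exp (2 * n) + Real.exp (2 * n)) * (2 * Real.exp (-(3 * n + 2))) := by gcongr
    _ = 2 * 2 * Real.exp (2 * n) * Real.exp (-(3 * n + 2)) := by ring
    _ < Real.exp 1 * Real.exp 1 * Real.exp (2 * n) * Real.exp (-(3 * n + 2)) := by gcongr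
    _ = 1 / Real.exp n := by
      rw [one_div, ← Real.exp_neg, ← Real.exp_add, ← Real.exp_add, ← Real.exp_add]; ring_nf

/-- Parameters for accuracy `1 / q`, Fourier sparsity at most `sparsity` and a failure probability
of less than `exp (-n)`. -/
def accuracyParams (q sparsity : Polynomial ℕ) : Params where
  num := 32 * q ^ 2 * (sparsity + 1) ^ 2 *
    (256 * q ^ 2 * (sparsity + 1) ^ 2 * (3 * Polynomial.X + 2))
  thr := 256 * q ^ 2 * (sparsity + 1) ^ 2 * (3 * Polynomial.X + 2)
  cap := sparsity + 1

theorem accuracyParams_suffice {q : Polynomial ℕ} (sparsity : Polynomial ℕ) {n : ℕ}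
    (hq : 0 < q.eval n) : (accuracyParams q sparsity).Suffice n (1 / ((q.eval n : ℕ) : ℝ))
      (1 / (4 * ((q.eval n : ℕ) : ℝ) * ((sparsity.eval n + 1 : ℕ) : ℝ))) (3 * n + 2) := by
  obtain ⟨Q, hQ⟩ : ∃ Q : ℝ, Q = (q.eval n : ℕ) := ⟨_, rfl⟩
  obtain ⟨S, hS⟩ : ∃ S : ℝ, S = (sparsity.eval n + 1 : ℕ) := ⟨_, rfl⟩
  obtain ⟨c, hc⟩ : ∃ c : ℝ, c = 3 * n + 2 := ⟨_, rfl⟩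
  have hthr : (((accuracyParams q sparsity).thr.eval n : ℕ) : ℝ) = 256 * Q ^ 2 * S ^ 2 * c := by
    simp [accuracyParams, hQ, hS, hc]
  have hnum : (((accuracyParams q sparsity).num.eval n : ℕ) : ℝ) =
      32 * Q ^ 2 * S ^ 2 * (256 * Q ^ 2 * S ^ 2 * c) := by
    simp [accuracyParams, hQ, hS, hc]
  have hcap : (((accuracyParams q sparsity).cap.eval n : ℕ) : ℝ) = S := by
    simp [accuracyParams, hS]
  have hQ1 : 1 ≤ Q := hQ ▸ Nat.one_le_cast.2 hq
  have hS1 : 1 ≤ S := hS ▸ Nat.one_le_cast.2 (Nat.le_add_left _ _)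
  have hQpos := one_pos.trans_le hQ1
  have hSpos := one_pos.trans_le hS1
  have hcpos : 0 < c := by rw [hc]; positivity
  have hQS : 1 ≤ Q ^ 2 * S := one_le_mul_of_one_le_of_one_le (one_le_pow₀ hQ1) hS1
  rw [← hQ, ← hS, ← hc]
  exact
    { thr_pos := Nat.cast_pos (α := ℝ).1 (by rw [hthr]; positivity)
      cap_pos := Nat.cast_pos (α := ℝ).1 (by rwa [hcap])
      eps_pos := by positivity
      theta_pos := by positivity
      two_mul_thr_le := by
        rw [hthr, hnum]
        field_simp
        norm_num
      error_le := by
        rw [hthr, hnum, hcap]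
        field_simp
        nlinarith
      le_draws := by
        rw [hthr, hnum]
        field_simp
        norm_num
      le_outcome := by
        rw [hnum, hcap]
        field_simp
        nlinarith }

section

variable {T : Polynomial ℕ}

theorem one_sub_lt_run_toOuterMeasure_goodOutputs {q sparsity : Polynomial ℕ} (I : Instance T)
    (hq : 0 < q.eval I.n) (hf : ∃ x, I.f x = true)
    (hs : (spectrum I.f).card ≤ sparsity.eval I.m) :
    1 - 1 / Real.exp I.n < ((RandM.ofPMF (draws I.m ((accuracyParams q sparsity).num.eval I.n)) >>=
      outcome (accuracyParams q sparsity) I).run.toOuterMeasure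
        (goodOutputs (acceptProb I.hmn I.C I.f) (1 / ((q.eval I.n : ℕ) : ℝ)))).toReal := by
  have hcap : (spectrum I.f).card ≤ (accuracyParams q sparsity).cap.eval I.n := by
    simpa [accuracyParams] using hs.trans ((eval_mono sparsity I.hmn).trans (Nat.le_succ _))
  refine one_sub_lt_toReal_toOuterMeasure _ ((run_toOuterMeasure_compl_goodOutputs_le I
    (accuracyParams_suffice sparsity hq) hf hcap).trans_lt ?_)
  exact (ENNReal.ofReal_lt_ofReal_iff (by positivity)).2 (failure_bound_lt I.hmn)

end

theorem Runs.Computes.fst_ne_cutoff {α : Type} [TreeEncoding α] {μ : Runs} {D : RandM α} {B : ℕ}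
    (h : μ.Computes D B) {o : Res × ℕ} (ho : o ∈ μ.support) : o.1 ≠ Res.cutoff := by
  obtain ⟨_ | a, -, ha⟩ := h.exists_resOf_eq ho <;> simp [← ha, resOf]

theorem Runs.Computes.toOuterMeasure_goodOutputs_le {μ : Runs} {D : RandM (ℕ × ℕ)} {B : ℕ}
    (h : μ.Computes D B) (p ε : ℝ) :
    D.run.toOuterMeasure (goodOutputs p ε) ≤ μ.toOuterMeasure (goodRuns p ε) := by
  have hgood : goodRuns p ε = Prod.fst ⁻¹' {r | ∃ a b : ℕ, 0 < b ∧
      r = Res.out (.cons (encNat a) (encNat b)) ∧ |p - (a : ℝ) / (b : ℝ)| ≤ ε} := rfl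
  rw [hgood, ← PMF.toOuterMeasure_map_apply, h.dist, PMF.toOuterMeasure_map_apply]
  refine MeasureTheory.measure_mono ?_
  rintro _ ⟨a, b, hb, rfl, hab⟩
  exact ⟨a, b, hb, rfl, hab⟩

end

end SCP

theorem theorem2_general (q size sparsity T : Polynomial ℕ)
    (hq : ∀ n : ℕ, 0 < n → 0 < q.eval n) :
    ∃ (A : SCP.Prog) (R : Polynomial ℕ),
      ∀ (n m : ℕ) (_ : 0 < m) (hmn : m ≤ n) (C : SCP.Circuit n) (_ : C.length ≤ size.eval n)
        (f : SCP.Bits m → Bool) (_ : ∃ x, f x = true)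
        (_ : (SCP.spectrum f).card ≤ sparsity.eval m)
        (P : SCP.Prog) (_ : SCP.Evaluates P f (T.eval m)),
        A.RunsInTime P m C (SCP.fourierDegree f) (1 + SCP.maxSupp hmn C) (R.eval n) ∧
        ((A.runs P m C (SCP.fourierDegree f) (1 + SCP.maxSupp hmn C)
            (R.eval n)).toOuterMeasure
          (SCP.goodRuns (SCP.acceptProb hmn C f) (1 / ((q.eval n : ℕ) : ℝ)))).toReal
          > 1 - 1 / Real.exp n ∧
        ∀ d, C.DepthLE d → 1 + SCP.maxSupp hmn C ≤ 2 ^ d + 1 := by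
  obtain ⟨A, R, hA⟩ :=
    SCP.exists_computes_outcome (T := T) (SCP.accuracyParams q sparsity) size
  refine ⟨A, R, fun n m hm hmn C hC f hf hs P hP => ?_⟩
  let I : SCP.Instance T := ⟨n, m, hmn, C, f, P, hP⟩
  have hcomputes := hA I hC
  refine ⟨fun o ho => ⟨hcomputes.fst_ne_cutoff ho, hcomputes.time_le o ho⟩, ?_, fun d hd =>
    (Nat.add_comm _ _).trans_le (Nat.succ_le_succ (SCP.maxSupp_le_of_depthLE hmn hd))⟩
  exact (SCP.one_sub_lt_run_toOuterMeasure_goodOutputs I (hq n (hm.trans_le hmn)) hf hs).trans_le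
    (ENNReal.toReal_mono (ne_top_of_le_ne_top ENNReal.one_ne_top (SCP.toOuterMeasure_le_one _ _))
      (hcomputes.toOuterMeasure_goodOutputs_le _ _))

theorem theorem2 (d : ℕ) (q r size sparsity T : Polynomial ℕ)
    (hq : ∀ n : ℕ, 0 < n → 0 < q.eval n) :
    ∃ (A : SCP.Prog) (R : Polynomial ℕ),
      ∀ (n m : ℕ) (_ : 0 < m) (hmn : m ≤ n) (_ : n ≤ r.eval m)
        (C : SCP.Circuit n) (_ : C.length ≤ size.eval n) (_ : C.DepthLE d)
        (f : SCP.Bits m → Bool) (_ : ∃ x, f x = true)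
        (_ : (SCP.spectrum f).card ≤ sparsity.eval m)
        (P : SCP.Prog) (_ : SCP.Evaluates P f (T.eval m)),
        A.RunsInTime P m C (SCP.fourierDegree f) (1 + SCP.maxSupp hmn C) (R.eval n) ∧
        ((A.runs P m C (SCP.fourierDegree f) (1 + SCP.maxSupp hmn C)
            (R.eval n)).toOuterMeasure
          (SCP.goodRuns (SCP.acceptProb hmn C f) (1 / ((q.eval n : ℕ) : ℝ)))).toReal
          > 1 - 1 / Real.exp n ∧
        1 + SCP.maxSupp hmn C ≤ 2 ^ d + 1 := by
  obtain ⟨A, R, hA⟩ := theorem2_general q size sparsity T hq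
  exact ⟨A, R, fun n m hm hmn _ C hC hd f hf hs P hP =>
    (hA n m hm hmn C hC f hf hs P hP).imp_right (And.imp_right fun h => h d hd)⟩
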